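/- **Setting.** Let $q=e^{\eta}$ with $\eta\in\mathbb C$, $q^4\neq1$, write $q^x=e^{\eta x}$, and let $\alpha\in\mathbb C$ with $q^{2(\alpha+m)}\ne1$ for all $m\in\mathbb Z$. Write $\zeta=e^{u}$ and $\zeta^{x}=e^{xu}$ ($u\in\mathbb C$; $q^{\pm1}\zeta$ corresponds to $u\pm\eta$). Let $\mathcal H=(\mathbb C^2)^{\otimes n}$ (sites $1,\dots,n$), $S=\frac12\sum_j\sigma^z_j$, $\mathbb S=[S,\cdot\,]$, and let $X\in\operatorname{End}\mathcal H$ have spin $s\in\mathbb Z$, i.e. $\mathbb SX=sX$. *The operators $\mathbf t^*$ and $\mathbf k$.* Let $R_{a,j}(\zeta)$ be the six-vertex $R$-matrix $$R(\zeta)=\begin{pmatrix}1&0&0&0\\0&\beta&\gamma&0\\0&\gamma&\beta&0\\0&0&0&1\end{pmatrix},\qquad \beta=\frac{(1-\zeta^2)q}{1-q^2\zeta^2},\quad \gamma=\frac{(1-q^2)\zeta}{1-q^2\zeta^2},$$ acting on $V_a\otimes V_j$, $V_a=\mathbb C^2$, and let $$L_{A,j}(\zeta)=\begin{pmatrix}1-\zeta^2q^{2D+2}&-\zeta\mathbf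 a\\-\zeta\mathbf a^*&1\end{pmatrix}_j\begin{pmatrix}q^{-D}&0\\0&q^{D}\end{pmatrix}_j ,$$ where $q^{\pm D},\mathbf a,\mathbf a^*$ generate the $q$-oscillator algebra, acting by $q^D|k\rangle=q^k|k\rangle$, $\mathbf a|k\rangle=(1-q^{2k})|k-1\rangle$, $\mathbf a^*|k\rangle=|k+1\rangle$, $k\ge0$. (Scalar prefactors of these matrices are irrelevant below.) Put $T_a=R_{a,n}\cdots R_{a,1}$, $T_A=L_{A,n}\cdots L_{A,1}$ and $$\mathbb T_a(\zeta,\alpha)X=T_a\,q^{\alpha\sigma^z_a}X\,T_a^{-1},\qquad \mathbb T_A(\zeta,\alpha)X=T_A\,q^{2\alpha D}X\,T_A^{-1},$$ $$\mathbf t^*(\zeta,\alpha)X=\operatorname{tr}_a\mathbb T_a(\zeta,\alpha)X,\qquad \mathbf k(\zeta,\alpha)X=\operatorname{tr}_{A,a}\bigl\{\sigma_a^+\,\mathbb T_a(\zeta,\alpha)\mathbb T_A(\zeta,\alpha)\,\zeta^{\alpha-\mathbb S}(q^{-2S}X)\bigr\},$$ where $\operatorname{tr}_A$ is the trace over the span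 of the $|k\rangle$, $k\ge0$, continued as a rational function of $q$ and $q^\alpha$: if $\langle k|x|k\rangle=q^{2\alpha k}\sum_m p_mq^{mk}$ for all $k$ (identically in $q^k$), then $\operatorname{tr}_A x=\sum_m p_m/(1-q^{2\alpha+m})$. *The coefficients.* $\mathbf k_{\rm skal}X=\zeta^{-\alpha-s-1}\mathbf k(\zeta,\alpha)X$ is a function of $z=\zeta^2$. For $1\le j\le n$, $\varepsilon\in\{-1,0,1\}$ and for $1\le j\le s$, respectively, let $$\rho^{(\varepsilon)}_jX=\lim_{z\to q^{2\varepsilon}}\frac{\partial_z^{n-j}}{(n-j)!}(z-q^{2\varepsilon})^n\mathbf k_{\rm skal}X,\qquad \kappa_jX=\lim_{z\to0}\frac{\partial_z^{s-j}}{(s-j)!}z^s\mathbf k_{\rm skal}X,$$ $\kappa_0=\frac12\sum_{j=1}^n(-1)^j\sum_{\varepsilon=-1}^1q^{-2\varepsilon j}\rho^{(\varepsilon)}_j$, $f_j=\frac12\bigl(q^{2j-\alpha-s-1}\rho_j^{(-1)}-q^{\alpha+s+1-2j}\rho_j^{(+1)}\bigr)$ for $1\le j\le n$, $f_0=\frac12\sum_{j=1}^n(-1)^{j-1}f_j$,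 and $d_j=q^{\alpha+s+1-2j}-q^{2j-\alpha-s-1}$. Let $$\mathbf f(\zeta,\alpha)X=\zeta^{\alpha+s+1}\Bigl[\sum_{j=0}^n\frac{f_j}{(\zeta^2-1)^j}+\sum_{j=0}^s\frac{\kappa_j\,\zeta^{-2j}}{d_j}\Bigr]X,$$ $$\mathbf b^*(\zeta,\alpha)X=\mathbf f(q\zeta,\alpha)X+\mathbf f(q^{-1}\zeta,\alpha)X-\mathbf t^*(\zeta,\alpha)\mathbf f(\zeta,\alpha)X$$ (sums up to $s$ are empty if $s<0$), and let $t^*_p$, $p\ge1$, be the Taylor coefficients in $\mathbf t^*(\zeta,\alpha)=\sum_{p\ge1}(\zeta^2-1)^{p-1}t^*_p$ at $\zeta^2=1$. **Lemma.** For all $\zeta$ with $0<|\zeta^2-1|<\min\{1,|q^2-1|,|q^{-2}-1|\}$, $$\mathbf b^*(\zeta,\alpha)X=\zeta^{\alpha+s+1}\sum_{p=1}^\infty(\zeta^2-1)^{p-1}\,b^*_pX,$$ where $$\begin{aligned}b^*_pX=\Bigl[&\sum_{j=0}^n\binom{-j}{p-1}\frac{q^{\alpha+s+p-j}-(-1)^{p+j}q^{j-p-\alpha-s}}{(q-q^{-1})^{p+j-1}}f_j+\sum_{j=0}^s\binom{-j}{p-1}\frac{q^{\alpha+s+1-2j}+q^{2j-\alpha-s-1}}{d_j}\kappa_j\\&-\sum_{j=0}^nt^*_{p+j}f_j-\sum_{j=0}^s\sum_{k=0}^{p-1}\binom{-j}{k}\frac{t^*_{p-k}\kappa_j}{d_j}\Bigr]X.\end{aligned}$$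 In particular $\mathbf b^*$ is regular at $\zeta^2=1$: if $\zeta_0^2=1$, then $\mathbf b^*(\zeta,\alpha)X\to\zeta_0^{\alpha+s+1}b_1^*X$ as $\zeta\to\zeta_0$. -/

import Mathlib

open Filter Topology
open scoped Kronecker LaurentPolynomial

/-!
The deformation parameter is `q = exp η`, and `q ^ x` means `exp (η * x)`.
The spectral parameter is `ζ = exp u`, and `ζ ^ x` means `exp (x * u)`; thus `q ^ (± 1) * ζ`
corresponds to `u ± η`.  A segment of the chain with `n` sites has the sites `0, …, n - 1`
(ordered from left to right), and its space of states `(ℂ²)^{⊗ n}` has the standard basis indexed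
by `XXZ.Conf n`; the index `0 : Fin 2` is spin up.
-/

namespace XXZ

noncomputable section

/-- Spin configurations, the labels of the standard basis of `(ℂ²)^{⊗ n}`. -/
abbrev Conf (n : ℕ) := Fin n → Fin 2

/-- Operators on the space of states of `n` sites. -/
abbrev Op (n : ℕ) := Matrix (Conf n) (Conf n) ℂ

/-- `q ^ x`. -/
def qpow (η x : ℂ) : ℂ := Complex.exp (η * x)

/-! ### The spin -/

/-- Eigenvalue of the total spin `S = (1/2) ∑ σᶻ_j` on a basis vector. -/
def spin {n : ℕ} (x : Conf n) : ℂ := (1 / 2) * ∑ i, (if x i = 0 then (1 : ℂ) else -1)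

/-- The total spin operator. -/
def spinOp (n : ℕ) : Op n := Matrix.diagonal spin

/-- `X` has spin `s`: `[S, X] = s X`. -/
def HasSpin {n : ℕ} (s : ℤ) (X : Op n) : Prop := spinOp n * X - X * spinOp n = (s : ℂ) • X

/-- `ζ ^ (α - 𝕊)`, with `𝕊 = [S, ·]`; the matrix unit `(x, y)` is an eigenvector of `𝕊` with
eigenvalue `spin x - spin y`. -/
def zetaPowAlphaSubSpin {n : ℕ} (u α : ℂ) (X : Op n) : Op n :=
  Matrix.of fun x y => Complex.exp (u * (α - (spin x - spin y))) * X x y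

/-- `q ^ (-2 S)`. -/
def qPowNegTwoSpin (n : ℕ) (η : ℂ) : Op n := Matrix.diagonal fun x => qpow η (-2 * spin x)

/-! ### Adjoint action of a monodromy matrix -/

/-- `𝕃_{n-1} ⋯ 𝕃_0 Y`, where `𝕃_j Y = L_j Y L_j⁻¹`. -/
def adjointMonodromy {n : ℕ} {A : Type*} [MonoidWithZero A] (L : Fin n → A) (Y : A) : A :=
  (List.finRange n).foldl (fun Z j => L j * Z * Ring.inverse (L j)) Y

/-! ### Two-dimensional auxiliary space -/

/-- The six-vertex `R`-matrix. -/
def Rmat (η ζ : ℂ) : Matrix (Fin 2 × Fin 2) (Fin 2 × Fin 2) ℂ :=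
  let q := Complex.exp η
  let β := (1 - ζ ^ 2) * q / (1 - q ^ 2 * ζ ^ 2)
  let γ := (1 - q ^ 2) * ζ / (1 - q ^ 2 * ζ ^ 2)
  Matrix.of fun i j =>
    if i.1 = i.2 then (if j = i then 1 else 0)
    else if j = i then β
    else if j = i.swap then γ
    else 0

/-- `R_{a,j}`, acting on `ℂ² ⊗ (ℂ²)^{⊗ n}`.  It agrees with `L_{a,j}` up to a scalar factor, which
drops out of the adjoint action. -/
def La {n : ℕ} (η ζ : ℂ) (j : Fin n) : Matrix (Fin 2 × Conf n) (Fin 2 × Conf n) ℂ :=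
  Matrix.of fun v w =>
    if ∀ i, i ≠ j → v.2 i = w.2 i then Rmat η ζ (v.1, v.2 j) (w.1, w.2 j) else 0

/-- `𝕋_a (ζ, α) (id_a ⊗ X) = 𝕃_{a,n-1} ⋯ 𝕃_{a,0} (q ^ (α σᶻ_a) ⊗ X)`. -/
def Ta {n : ℕ} (η α u : ℂ) (X : Op n) : Matrix (Fin 2 × Conf n) (Fin 2 × Conf n) ℂ :=
  adjointMonodromy (La η (Complex.exp u))
    (Matrix.diagonal ![qpow η α, qpow η (-α)] ⊗ₖ X)

/-- Partial trace over the auxiliary space `ℂ²`. -/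
def traceAux {n : ℕ} (Y : Matrix (Fin 2 × Conf n) (Fin 2 × Conf n) ℂ) : Op n :=
  Matrix.of fun x y => ∑ a, Y (a, x) (a, y)

/-- `t* (ζ, α) X = tr_a (𝕋_a (ζ, α) (id_a ⊗ X))`. -/
def tStar {n : ℕ} (η α u : ℂ) (X : Op n) : Op n := traceAux (Ta η α u X)

/-! ### The `q`-oscillator algebra and its trace

The oscillator algebra acts on the module with basis `|k⟩`, `k ≥ 0`, by
`q^D |k⟩ = q^k |k⟩`, `a |k⟩ = (1 - q^(2k)) |k - 1⟩`, `a* |k⟩ = |k + 1⟩`.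
In order to have the trace as a rational function of `q ^ α`, the number `q^k` of a base vector
`|k⟩` is kept as an indeterminate `T`: below, the basis vector `single j 1` stands for `|k + j⟩`,
and `T` for `q^k`.  An element of the oscillator algebra has a matrix element
`⟨k| x |k⟩ = ∑ m, p_m (q^k)^m`, the Laurent polynomial `p = ∑ m, p_m T^m` being the coefficient
of `x (single 0 1)` at `0`. -/

/-- Operators on the oscillator module. -/
abbrev OscEnd := Module.End ℂ[T;T⁻¹] (ℤ →₀ ℂ[T;T⁻¹])

/-- `q ^ (m D)`. -/
def oscQD (η : ℂ) (m : ℤ) : OscEnd :=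
  Finsupp.linearCombination ℂ[T;T⁻¹] fun j : ℤ =>
    Finsupp.single j (LaurentPolynomial.C (qpow η (m * j)) * LaurentPolynomial.T m)

/-- The creation operator `a*`. -/
def oscAstar : OscEnd :=
  Finsupp.linearCombination ℂ[T;T⁻¹] fun j : ℤ => Finsupp.single (j + 1) 1

/-- The annihilation operator `a`. -/
def oscA (η : ℂ) : OscEnd :=
  Finsupp.linearCombination ℂ[T;T⁻¹] fun j : ℤ =>
    Finsupp.single (j - 1) (1 - LaurentPolynomial.C (qpow η (2 * j)) * LaurentPolynomial.T 2)

/-- `q ^ (2 α D)` without its factor `q ^ (2 α k)` on the base vector; this factor, which is common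
to all vectors `|k + j⟩`, is restored in `oscTrace`. -/
def oscTwist (η α : ℂ) : OscEnd :=
  Finsupp.linearCombination ℂ[T;T⁻¹] fun j : ℤ =>
    Finsupp.single j (LaurentPolynomial.C (qpow η (2 * α * j)))

/-- The trace: with `⟨k| x |k⟩ = q ^ (2 α k) ∑ m, p_m q ^ (m k)` it is
`∑ k ≥ 0, ⟨k| x |k⟩ = ∑ m, p_m / (1 - q ^ (2 α + m))`, the right-hand side being the continuation
of the left-hand side in `q` and `q ^ α`. -/
def oscTrace (η α : ℂ) (x : OscEnd) : ℂ :=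
  ((x (Finsupp.single 0 1)) 0).coeff.sum fun m c => c / (1 - qpow η (2 * α + m))

/-- The `2 × 2` matrix `L_A (ζ)` with oscillator entries, without its scalar factor, which drops
out of the adjoint action. -/
def Losc (η ζ : ℂ) : Matrix (Fin 2) (Fin 2) OscEnd :=
  !![1 - (ζ ^ 2 * qpow η 2) • oscQD η 2, -(ζ • oscA η); -(ζ • oscAstar), 1] *
    !![oscQD η (-1), 0; 0, oscQD η 1]

/-- `L_{A,j} (ζ)`, acting on `Osc_A ⊗ (ℂ²)^{⊗ n}`. -/
def LA {n : ℕ} (η ζ : ℂ) (j : Fin n) : Matrix (Conf n) (Conf n) OscEnd :=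
  Matrix.of fun x y => if ∀ i, i ≠ j → x i = y i then Losc η ζ (x j) (y j) else 0

/-- `𝕋_A (ζ, α) (id_A ⊗ X) = 𝕃_{A,n-1} ⋯ 𝕃_{A,0} (q ^ (2 α D_A) ⊗ X)`. -/
def TA {n : ℕ} (η α u : ℂ) (X : Op n) : Matrix (Conf n) (Conf n) OscEnd :=
  adjointMonodromy (LA η (Complex.exp u)) (Matrix.of fun x y => X x y • oscTwist η α)

/-- `tr_A (𝕋_A (ζ, α) (id_A ⊗ X))`. -/
def trTA {n : ℕ} (η α u : ℂ) (X : Op n) : Op n :=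
  Matrix.of fun x y => oscTrace η α (TA η α u X x y)

/-! ### The operator `k` and its Laurent coefficients -/

/-- `k (ζ, α) X = tr_{A,a} (σ⁺_a 𝕋_a (ζ, α) 𝕋_A (ζ, α) ζ ^ (α - 𝕊) (id ⊗ q ^ (-2 S) X))`.
Since `σ⁺_a 𝕋_a` acts trivially on `Osc_A`, the trace over `A` is taken first. -/
def kOp {n : ℕ} (η α u : ℂ) (X : Op n) : Op n :=
  traceAux ((!![0, 1; 0, 0] ⊗ₖ (1 : Op n)) *
    Ta η α u (trTA η α u (zetaPowAlphaSubSpin u α (qPowNegTwoSpin n η * X))))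

/-- `k_skal (ζ, α) X = ζ ^ (-α - s - 1) k (ζ, α) X` as a function of `z = ζ ^ 2`
(it does not depend on the choice of the logarithm of `z`). -/
def kSkal {n : ℕ} (η α : ℂ) (s : ℤ) (z : ℂ) (X : Op n) : Op n :=
  Complex.exp ((-α - s - 1) * (Complex.log z / 2)) • kOp η α (Complex.log z / 2) X

/-- `lim_{z → z₀} (1 / k!) ∂_z^k (z - z₀) ^ N k_skal X`, entry by entry. -/
def laurentCoeff {n : ℕ} (η α : ℂ) (s : ℤ) (z₀ : ℂ) (N k : ℕ) (X : Op n) : Op n :=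
  Matrix.of fun x y => limUnder (𝓝[≠] z₀) fun z =>
    (1 / (k.factorial : ℂ)) *
      iteratedDeriv k (fun w => (w - z₀) ^ N * kSkal η α s w X x y) z

/-- `ρ_j^{(ε)} (α) X`, the coefficient of `(ζ² - q^{2ε})^{-j}` in `k_skal X`, for
`j = 1, …, n`. -/
def rho {n : ℕ} (η α : ℂ) (s ε : ℤ) (j : ℕ) (X : Op n) : Op n :=
  laurentCoeff η α s (qpow η (2 * ε)) n (n - j) X

/-- `κ_j (α) X`: for `j = 1, …, s` the coefficient of `ζ^{-2j}` in `k_skal X`, and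
`κ_0 = (1/2) ∑_{j=1}^n (-1)^j ∑_{ε=-1}^1 q^{-2εj} ρ_j^{(ε)}`. -/
def kappa {n : ℕ} (η α : ℂ) (s : ℤ) (j : ℕ) (X : Op n) : Op n :=
  if j = 0 then
    (1 / 2 : ℂ) • ∑ i ∈ Finset.Icc 1 n, (-1 : ℂ) ^ i •
      ∑ ε ∈ Finset.Icc (-1 : ℤ) 1, qpow η (-2 * ε * i) • rho η α s ε i X
  else laurentCoeff η α s 0 s.toNat (s.toNat - j) X

/-- `f_j (α) X` for `j = 1, …, n`. -/
def fCoeffPos {n : ℕ} (η α : ℂ) (s : ℤ) (j : ℕ) (X : Op n) : Op n :=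
  (1 / 2 : ℂ) • (qpow η (2 * j - α - s - 1) • rho η α s (-1) j X -
    qpow η (α + s + 1 - 2 * j) • rho η α s 1 j X)

/-- `f_j (α) X` for `j = 0, …, n`, with `f_0 = (1/2) ∑_{j=1}^n (-1)^{j-1} f_j`. -/
def fCoeff {n : ℕ} (η α : ℂ) (s : ℤ) (j : ℕ) (X : Op n) : Op n :=
  if j = 0 then
    (1 / 2 : ℂ) • ∑ i ∈ Finset.Icc 1 n, (-1 : ℂ) ^ (i - 1) • fCoeffPos η α s i X
  else fCoeffPos η α s j X

/-- `q ^ (α+s+1-2j) - q ^ (2j-α-s-1)`. -/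
def den (η α : ℂ) (s : ℤ) (j : ℕ) : ℂ :=
  qpow η (α + s + 1 - 2 * j) - qpow η (2 * j - α - s - 1)

/-- `f (ζ, α) X` for `X` of spin `s`; the second sum runs over `j = 0, …, s` and is empty for
`s < 0`. -/
def fOp {n : ℕ} (η α : ℂ) (s : ℤ) (u : ℂ) (X : Op n) : Op n :=
  Complex.exp ((α + s + 1) * u) •
    (∑ j ∈ Finset.range (n + 1), ((Complex.exp (2 * u) - 1) ^ j)⁻¹ • fCoeff η α s j X +
      ∑ j ∈ Finset.range (s + 1).toNat,
        (Complex.exp (-2 * j * u) / den η α s j) • kappa η α s j X)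

/-! ### The creation operator `b*` and its modes -/

/-- `b* (ζ, α) X = f (q ζ, α) X + f (q⁻¹ ζ, α) X - t* (ζ, α) f (ζ, α) X` for `X` of spin `s`. -/
def bStar {n : ℕ} (η α : ℂ) (s : ℤ) (u : ℂ) (X : Op n) : Op n :=
  fOp η α s (u + η) X + fOp η α s (u - η) X - tStar η α u (fOp η α s u X)

/-- `t*_p (α)`, `p ≥ 1`: the coefficient of `(ζ² - 1)^{p-1}` in the Taylor expansion of
`t* (ζ, α)`, as a function of `z = ζ²`, around `z = 1`. -/
def tStarMode {n : ℕ} (η α : ℂ) (p : ℕ) (X : Op n) : Op n :=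
  Matrix.of fun x y => (1 / ((p - 1).factorial : ℂ)) *
    iteratedDeriv (p - 1) (fun z => tStar η α (Complex.log z / 2) X x y) 1

/-- The binomial coefficient `(-j choose k)`. -/
def negChoose (j k : ℕ) : ℂ := ((Ring.choose (-(j : ℤ)) k : ℤ) : ℂ)

/-- The mode `b*_p (α) X`, `p ≥ 1`, for `X` of spin `s`. -/
def bStarMode {n : ℕ} (η α : ℂ) (s : ℤ) (p : ℕ) (X : Op n) : Op n :=
  (∑ j ∈ Finset.range (n + 1),
      (negChoose j (p - 1) *
        ((qpow η (α + s + p - j) - (-1) ^ (p + j) * qpow η (j - p - α - s)) /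
          (qpow η 1 - qpow η (-1)) ^ (p + j - 1))) • fCoeff η α s j X) +
  (∑ j ∈ Finset.range (s + 1).toNat,
      (negChoose j (p - 1) *
        ((qpow η (α + s + 1 - 2 * j) + qpow η (2 * j - α - s - 1)) / den η α s j)) •
          kappa η α s j X) -
  (∑ j ∈ Finset.range (n + 1), tStarMode η α (p + j) (fCoeff η α s j X)) -
  (∑ j ∈ Finset.range (s + 1).toNat, ∑ k ∈ Finset.range p,
      (negChoose j k / den η α s j) • tStarMode η α (p - k) (kappa η α s j X))

end

end XXZ

/-! Away from `t* f`, everything is a binomial series. With `w = ζ² - 1`, the powers of `(q^{±1}ζ)²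
- 1` occurring in `f(q^{±1}ζ)` are expanded around `q^{±2} - 1`, and `ζ^{-2j} = (1 + w)^{-j}`. The
Taylor series of `t*` in `w` converges up to its nearest poles, which lie among `ζ² = q^{±2}`.
Multiplying it by `f_j / w^j` shifts the index by `j` and produces negative powers of `w`. The whole
content of the lemma is that these negative powers cancel in the sum over `j`: `t*(ζ)` applied to
the polar part of `f` is regular at `ζ² = 1`.

By the definition of `f_j`, the polar part of `ζ^{-α-s-1} f(ζ)` is that of `(1/2) ζ^{-α-s-1}
(k(q⁻¹ζ) - k(qζ))`, because `k` has poles of order at most `n` at `ζ² = q^{±2}`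
(`exists_kOp_expansion`, `exists_fCoeffPos_expansion`). Hence it suffices that `t*(ζ) (k(q⁻¹ζ) -
k(qζ))` is regular at `ζ² = 1` (`exists_analyticAt_tStar_kOp`).

This is a fusion argument. The product `t*(ζ) k(q^{±1}ζ)` is a trace of one conjugation of `X` by a
monodromy matrix with auxiliary spins `b` (from `t*`), `a` (from `k`) and the oscillator `A`. Two
triangular structures meet there. For the pair `b, a`, whose arguments differ by `q^{±1}`, the
triplet is an invariant subspace (shift `q`) or a quotient (shift `q⁻¹`), and the conjugation on it
is regular at `ζ² = 1` since `q⁴ ≠ 1`. For the pair `a, A`, the column `(a, -1)` or the row `(1, a)`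
reduces the `L`-operator to the oscillator alone, with argument `ζ` in both cases. The trace over
`b` is therefore a combination of regular triplet entries and one matrix element of the monodromy of
`b` and `A` at `ζ` (`trace_plus`, `trace_minus`). The powers of `q` produced by the twist, by the
spin of `X` and by `ζ^{α-𝕊}` multiply to `1` for both shifts, so this element, which may be
singular, drops out of the difference.

What remains is an identity of principal parts: a polynomial in `1/w` without constant term that
stays bounded as `w → 0` vanishes (`sum_tStarMode_eq_zero`). The limit at `ζ₀² = 1` follows from the
series by dominated convergence. -/

set_option linter.unusedSimpArgs false

namespace XXZ

noncomputable section

section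

/-! ### Ordered conjugation -/

section ConjFold

variable {M : Type*} [Monoid M] {n : ℕ}

/-- `L_{n-1} ⋯ L_0 Y L'_0 ⋯ L'_{n-1}`. -/
def conjFold (L L' : Fin n → M) (Y : M) : M :=
  (List.finRange n).foldl (fun Z j => L j * Z * L' j) Y

/-- Each `f j` is pushed past the `g i` that stand later in the list; these have `i ≠ j` because the
list has no repetitions, so `f j` and `g j` need not commute. -/
theorem foldl_comp_of_commute {ι : Type*} {β : Type*} (f g : ι → β → β)
    (h : ∀ i j, i ≠ j → ∀ y, f i (g j y) = g j (f i y)) :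
    ∀ (l : List ι) (_ : l.Nodup) (y : β),
      l.foldl (fun z j => f j (g j z)) y =
        l.foldl (fun z j => f j z) (l.foldl (fun z j => g j z) y) := by
  intro l hl y
  induction l generalizing y with
  | nil => rfl
  | cons j l ih =>
    have hj := (List.nodup_cons.1 hl).1
    have key : ∀ (m : List ι) (_ : j ∉ m) (z : β),
        f j (m.foldl (fun z i => g i z) z) = m.foldl (fun z i => g i z) (f j z) := by
      intro m
      induction m with
      | nil => intro _ z; rfl
      | cons i m ihm =>
        intro him z
        rw [List.mem_cons, not_or] at him
        simp only [List.foldl_cons]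
        rw [ihm him.2, h j i him.1]
    simp only [List.foldl_cons]
    rw [ih (List.nodup_cons.1 hl).2, key l hj]

/-- This merges successive conjugations over different auxiliary spaces into a single one, so that
fusion can be applied site by site. -/
theorem conjFold_mul (A A' B B' : Fin n → M) (h : ∀ i j, i ≠ j → Commute (A i) (B j))
    (h' : ∀ i j, i ≠ j → Commute (A' i) (B' j)) (Y : M) :
    conjFold (fun j => A j * B j) (fun j => B' j * A' j) Y =
      conjFold A A' (conjFold B B' Y) := by
  have := foldl_comp_of_commute (fun j Z => A j * Z * A' j) (fun j Z => B j * Z * B' j)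
    (fun i j hij y => by
      have e1 := (h i j hij).eq
      have e2 := (h' i j hij).eq
      calc A i * (B j * y * B' j) * A' i = (A i * B j) * y * (B' j * A' i) := by
            simp only [mul_assoc]
        _ = B j * (A i * y * A' i) * B' j := by rw [e1, ← e2]; simp only [mul_assoc])
    (List.finRange n) (List.nodup_finRange n) Y
  simp only [conjFold]
  rw [← this]
  congr 1
  funext Z j
  simp only [mul_assoc]

theorem conjFold_induction {N : Type*} [Monoid N] (r : M → N → Prop) (L L' : Fin n → M)
    (K K' : Fin n → N) (h : ∀ j Y Z, r Y Z → r (L j * Y * L' j) (K j * Z * K' j)) {Y : M} {Z : N}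
    (hr : r Y Z) : r (conjFold L L' Y) (conjFold K K' Z) := by
  unfold conjFold
  generalize List.finRange n = l
  induction l generalizing Y Z with
  | nil => exact hr
  | cons j l ih => exact ih (h j Y Z hr)

/-- The railroad argument: a local intertwiner is pulled through the chain one site at a time. `p`
need not be invertible; below it describes an invariant subspace, and in the mirror version a
quotient. -/
theorem conjFold_mul_right (p : M) (L L' K K' : Fin n → M) (h : ∀ j, L j * p = p * K j)
    (h' : ∀ j, L' j * p = p * K' j) {Y Z : M} (hr : Y * p = p * Z) :
    conjFold L L' Y * p = p * conjFold K K' Z := by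
  refine conjFold_induction (fun Y Z => Y * p = p * Z) L L' K K' (fun j Y Z e => ?_) hr
  rw [mul_assoc, h', ← mul_assoc, mul_assoc (L j), e, ← mul_assoc, h]
  simp only [mul_assoc]

theorem conjFold_mul_left (p : M) (L L' K K' : Fin n → M) (h : ∀ j, p * L j = K j * p)
    (h' : ∀ j, p * L' j = K' j * p) {Y Z : M} (hr : p * Y = Z * p) :
    p * conjFold L L' Y = conjFold K K' Z * p := by
  refine conjFold_induction (fun Y Z => p * Y = Z * p) L L' K K' (fun j Y Z e => ?_) hr
  rw [mul_assoc, ← mul_assoc p, h, mul_assoc (K j), ← mul_assoc p, e, mul_assoc Z, h']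
  simp only [mul_assoc]

/-- Since `p` is not invertible, the relation for the inverses is not obtained by inverting both
sides; it needs a left inverse of `L` and a right inverse of `K`. -/
theorem intertwine_inv {p L L' K K' : M} (h : L * p = p * K) (hL : L' * L = 1)
    (hK : K * K' = 1) : L' * p = p * K' := by
  calc L' * p = L' * (p * K) * K' := by rw [mul_assoc, mul_assoc, hK, mul_one]
    _ = p * K' := by rw [← h, ← mul_assoc L', hL, one_mul]

theorem intertwine_inv' {p L L' K K' : M} (h : p * L = K * p) (hL : L * L' = 1)
    (hK : K' * K = 1) : p * L' = K' * p := by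
  calc p * L' = K' * (K * p) * L' := by rw [← mul_assoc K', hK, one_mul]
    _ = K' * p := by rw [← h, mul_assoc, mul_assoc, hL, mul_one]

end ConjFold

theorem ringInverse_eq {A : Type*} [MonoidWithZero A] {a b : A} (h : a * b = 1) (h' : b * a = 1) :
    Ring.inverse a = b :=
  Ring.inverse_unit (⟨a, b, h, h'⟩ : Aˣ)

theorem adjointMonodromy_eq_conjFold {n : ℕ} {A : Type*} [MonoidWithZero A] {L L' : Fin n → A}
    (h : ∀ j, L j * L' j = 1) (h' : ∀ j, L' j * L j = 1) (Y : A) :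
    adjointMonodromy L Y = conjFold L L' Y := by
  simp only [adjointMonodromy, conjFold, ringInverse_eq (h _) (h' _)]

/-- For `c * d = 1` this is the independence of the adjoint action from scalar prefactors; otherwise
it collects denominators into an `n`-th power. -/
theorem conjFold_smul_smul {n : ℕ} {A : Type*} [Ring A] [Algebra ℂ A] (L L' : Fin n → A) (c d : ℂ)
    (Y : A) : conjFold (fun j => c • L j) (fun j => d • L' j) Y = (c * d) ^ n • conjFold L L' Y := by
  unfold conjFold
  have : ∀ (l : List (Fin n)) (Y : A),
      l.foldl (fun Z j => c • L j * Z * d • L' j) Y =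
        (c * d) ^ l.length • l.foldl (fun Z j => L j * Z * L' j) Y := by
    intro l
    induction l using List.reverseRecOn with
    | nil => intro Y; simp
    | append_singleton l j ih =>
      intro Y
      rw [List.foldl_append, List.foldl_append, ih]
      simp only [List.foldl_cons, List.foldl_nil, List.length_append, List.length_singleton,
        smul_mul_assoc, mul_smul_comm, smul_smul]
      congr 1
      ring
  rw [this, List.length_finRange]

theorem conjFold_smul {n : ℕ} {A : Type*} [Ring A] [Algebra ℂ A] (L L' : Fin n → A) (c : ℂ)
    (Y : A) : conjFold L L' (c • Y) = c • conjFold L L' Y := by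
  refine conjFold_induction (fun Z Y => Z = c • Y) L L' L L' (fun j Y Z e => ?_) rfl
  simp [e]

theorem conjFold_add {n : ℕ} {A : Type*} [Ring A] (L L' : Fin n → A)
    (Y Z : A) : conjFold L L' (Y + Z) = conjFold L L' Y + conjFold L L' Z := by
  unfold conjFold
  generalize List.finRange n = l
  induction l generalizing Y Z with
  | nil => rfl
  | cons j l ih => simp only [List.foldl_cons, mul_add, add_mul, ih]

/-! ### Operators acting at one site -/

section Loc

variable {n : ℕ} {E : Type*} [Ring E]

/-- The operator acting by `ℓ` at the site `j`. -/
def loc (j : Fin n) (ℓ : Matrix (Fin 2) (Fin 2) E) : Matrix (Conf n) (Conf n) E :=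
  Matrix.of fun x y => if ∀ i, i ≠ j → x i = y i then ℓ (x j) (y j) else 0

theorem loc_apply (j : Fin n) (ℓ : Matrix (Fin 2) (Fin 2) E) (x y : Conf n) :
    loc j ℓ x y = if ∀ i, i ≠ j → x i = y i then ℓ (x j) (y j) else 0 := rfl

theorem loc_mul (j : Fin n) (a b : Matrix (Fin 2) (Fin 2) E) :
    loc j (a * b) = loc j a * loc j b := by
  ext x y
  -- Only intermediate configurations that differ from `x` at most at `j` contribute, so the sum
  -- reduces to one over the spin at `j`.
  rw [Matrix.mul_apply, loc_apply, ← Fintype.sum_of_injective (Function.update x j)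
    (Function.update_injective x j)
    (fun t => if ∀ i, i ≠ j → x i = y i then a (x j) t * b t (y j) else 0) _ ?_ ?_]
  · split_ifs with h
    · rw [Matrix.mul_apply]
    · simp
  · intro w hw
    rw [loc_apply, if_neg, zero_mul]
    intro hxw
    refine hw ⟨w j, ?_⟩
    ext i
    by_cases hi : i = j
    · subst hi; simp
    · rw [Function.update_of_ne hi, hxw i hi]
  · intro t
    have h0 : ∀ i, i ≠ j → x i = Function.update x j t i :=
      fun i hi => by rw [Function.update_of_ne hi]
    rw [loc_apply, loc_apply, if_pos h0, Function.update_self]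
    have : (∀ i, i ≠ j → Function.update x j t i = y i) ↔ (∀ i, i ≠ j → x i = y i) :=
      forall_congr' fun i => imp_congr_right fun hi => by rw [Function.update_of_ne hi]
    simp only [this]
    split_ifs <;> simp

theorem loc_scalar (j : Fin n) (e : E) :
    loc j (Matrix.scalar (Fin 2) e) = Matrix.scalar (Conf n) e := by
  ext x y
  rw [loc_apply, Matrix.scalar_apply, Matrix.scalar_apply, Matrix.diagonal_apply,
    Matrix.diagonal_apply]
  by_cases h : x = y
  · subst h; simp
  · rw [if_neg h]
    split_ifs with h1 h2
    · refine absurd (funext fun i => ?_) h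
      by_cases hi : i = j
      · rw [hi, h2]
      · exact h1 i hi
    · rfl
    · rfl

theorem loc_one (j : Fin n) : loc j (1 : Matrix (Fin 2) (Fin 2) E) = 1 := by
  simpa using loc_scalar j (1 : E)

theorem loc_smul [Algebra ℂ E] (j : Fin n) (c : ℂ) (a : Matrix (Fin 2) (Fin 2) E) :
    loc j (c • a) = c • loc j a := by
  ext x y
  rw [Matrix.smul_apply, loc_apply, loc_apply]
  split_ifs <;> simp

theorem loc_add (j : Fin n) (a b : Matrix (Fin 2) (Fin 2) E) :
    loc j (a + b) = loc j a + loc j b := by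
  ext x y
  rw [Matrix.add_apply, loc_apply, loc_apply, loc_apply]
  split_ifs <;> simp

theorem loc_mul_loc_of_ne {i j : Fin n} (hij : i ≠ j) (a b : Matrix (Fin 2) (Fin 2) E)
    (x y : Conf n) : (loc i a * loc j b) x y =
      if ∀ k, k ≠ i → k ≠ j → x k = y k then a (x i) (y i) * b (x j) (y j) else 0 := by
  rw [Matrix.mul_apply, Finset.sum_eq_single (Function.update x i (y i))]
  · rw [loc_apply, loc_apply, if_pos (fun k hk => by rw [Function.update_of_ne hk]),
      Function.update_self, Function.update_of_ne hij.symm]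
    have : (∀ k, k ≠ j → Function.update x i (y i) k = y k) ↔
        (∀ k, k ≠ i → k ≠ j → x k = y k) := by
      refine forall_congr' fun k => ?_
      by_cases hk : k = i
      · subst hk; simp
      · rw [Function.update_of_ne hk]; simp [hk]
    simp only [this]
    split_ifs <;> simp
  · intro w _ hw
    rw [loc_apply, loc_apply]
    split_ifs with h1 h2
    · refine absurd (funext fun k => ?_) hw
      by_cases hk : k = i
      · subst hk; simp [h2 k hij]
      · rw [Function.update_of_ne hk, h1 k hk]
    all_goals simp
  · simp

theorem loc_commute {i j : Fin n} (hij : i ≠ j) {a b : Matrix (Fin 2) (Fin 2) E}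
    (h : ∀ s t s' t', Commute (a s t) (b s' t')) : Commute (loc i a) (loc j b) := by
  ext x y
  rw [loc_mul_loc_of_ne hij, loc_mul_loc_of_ne hij.symm, (h _ _ _ _).eq]
  simp only [show (∀ k, k ≠ i → k ≠ j → x k = y k) ↔ (∀ k, k ≠ j → k ≠ i → x k = y k) from
    ⟨fun h k a b => h k b a, fun h k a b => h k b a⟩]

end Loc

end

section

/-! ### Relations of the `q`-oscillator algebra -/

theorem qpow_add (η x y : ℂ) : qpow η (x + y) = qpow η x * qpow η y := by
  rw [qpow, mul_add, Complex.exp_add]; rfl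

theorem qpow_zero (η : ℂ) : qpow η 0 = 1 := by simp [qpow]

theorem qpow_ne_zero (η x : ℂ) : qpow η x ≠ 0 := Complex.exp_ne_zero _

theorem osc_ext {x y : OscEnd}
    (h : ∀ j : ℤ, x (Finsupp.single j 1) = y (Finsupp.single j 1)) : x = y := by
  refine Finsupp.lhom_ext' fun j => LinearMap.ext_ring ?_
  simpa using h j

theorem oscQD_single (η : ℂ) (m j : ℤ) (p : ℂ[T;T⁻¹]) :
    oscQD η m (Finsupp.single j p) =
      Finsupp.single j (p * (LaurentPolynomial.C (qpow η (m * j)) * LaurentPolynomial.T m)) := by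
  rw [oscQD, Finsupp.linearCombination_single, Finsupp.smul_single, smul_eq_mul]

theorem oscAstar_single (j : ℤ) (p : ℂ[T;T⁻¹]) :
    oscAstar (Finsupp.single j p) = Finsupp.single (j + 1) p := by
  simp [oscAstar, Finsupp.linearCombination_single]

theorem oscA_single (η : ℂ) (j : ℤ) (p : ℂ[T;T⁻¹]) :
    oscA η (Finsupp.single j p) = Finsupp.single (j - 1)
      (p * (1 - LaurentPolynomial.C (qpow η (2 * j)) * LaurentPolynomial.T 2)) := by
  rw [oscA, Finsupp.linearCombination_single, Finsupp.smul_single, smul_eq_mul]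

theorem oscTwist_single (η α : ℂ) (j : ℤ) (p : ℂ[T;T⁻¹]) :
    oscTwist η α (Finsupp.single j p) =
      Finsupp.single j (p * LaurentPolynomial.C (qpow η (2 * α * j))) := by
  simp [oscTwist, Finsupp.linearCombination_single]

theorem laurent_smul (c : ℂ) (p : ℂ[T;T⁻¹]) : c • p = LaurentPolynomial.C c * p :=
  LaurentPolynomial.smul_eq_C_mul c p

theorem oscQD_mul (η : ℂ) (m k : ℤ) : oscQD η m * oscQD η k = oscQD η (m + k) := by
  refine osc_ext fun j => ?_
  rw [Module.End.mul_apply]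
  simp only [oscQD_single, one_mul]
  congr 1
  push_cast
  rw [add_mul, qpow_add, map_mul, LaurentPolynomial.T_add]
  ring

theorem oscQD_zero (η : ℂ) : oscQD η 0 = 1 := by
  refine osc_ext fun j => ?_
  simp [oscQD_single, qpow_zero]

theorem oscA_mul_oscAstar (η : ℂ) :
    oscA η * oscAstar = 1 - qpow η 2 • oscQD η 2 := by
  refine osc_ext fun j => ?_
  rw [Module.End.mul_apply, LinearMap.sub_apply, LinearMap.smul_apply]
  simp only [oscQD_single, oscAstar_single, oscA_single, one_mul, Module.End.one_apply,
    Finsupp.smul_single, add_sub_cancel_right, ← Finsupp.single_sub, laurent_smul]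
  congr 2
  rw [← mul_assoc, ← map_mul, ← qpow_add]
  push_cast
  ring_nf

theorem oscAstar_mul_oscA (η : ℂ) : oscAstar * oscA η = 1 - oscQD η 2 := by
  refine osc_ext fun j => ?_
  rw [Module.End.mul_apply, LinearMap.sub_apply]
  simp only [oscQD_single, oscAstar_single, oscA_single, one_mul, Module.End.one_apply,
    sub_add_cancel, ← Finsupp.single_sub]
  simp

theorem oscQD_mul_oscA (η : ℂ) (m : ℤ) :
    oscQD η m * oscA η = qpow η (-m) • (oscA η * oscQD η m) := by
  refine osc_ext fun j => ?_
  rw [Module.End.mul_apply, LinearMap.smul_apply, Module.End.mul_apply]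
  simp only [oscQD_single, oscA_single, one_mul, Finsupp.smul_single, laurent_smul]
  congr 1
  push_cast
  rw [show (m * (j - 1) : ℂ) = -m + m * j by ring, qpow_add, map_mul]
  ring

theorem oscQD_mul_oscAstar (η : ℂ) (m : ℤ) :
    oscQD η m * oscAstar = qpow η m • (oscAstar * oscQD η m) := by
  refine osc_ext fun j => ?_
  rw [Module.End.mul_apply, LinearMap.smul_apply, Module.End.mul_apply]
  simp only [oscQD_single, oscAstar_single, one_mul, Finsupp.smul_single, laurent_smul]
  congr 1
  push_cast
  rw [show (m * (j + 1) : ℂ) = m + m * j by ring, qpow_add, map_mul]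
  ring

theorem oscTwist_mul_oscA (η' α η : ℂ) :
    oscTwist η' α * oscA η = qpow η' (-2 * α) • (oscA η * oscTwist η' α) := by
  refine osc_ext fun j => ?_
  rw [Module.End.mul_apply, LinearMap.smul_apply, Module.End.mul_apply]
  simp only [oscTwist_single, oscA_single, one_mul, Finsupp.smul_single, laurent_smul]
  congr 1
  push_cast
  rw [show (2 * α * (j - 1) : ℂ) = -2 * α + 2 * α * j by ring, qpow_add, map_mul]
  ring

theorem oscTwist_mul_oscAstar (η' α : ℂ) :
    oscTwist η' α * oscAstar = qpow η' (2 * α) • (oscAstar * oscTwist η' α) := by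
  refine osc_ext fun j => ?_
  rw [Module.End.mul_apply, LinearMap.smul_apply, Module.End.mul_apply]
  simp only [oscTwist_single, oscAstar_single, one_mul, Finsupp.smul_single, laurent_smul]
  congr 1
  push_cast
  rw [show (2 * α * (j + 1) : ℂ) = 2 * α + 2 * α * j by ring, qpow_add, map_mul]

theorem oscTwist_mul_oscQD (η' α η : ℂ) (m : ℤ) :
    oscTwist η' α * oscQD η m = oscQD η m * oscTwist η' α := by
  refine osc_ext fun j => ?_
  rw [Module.End.mul_apply, Module.End.mul_apply]
  simp only [oscTwist_single, oscQD_single, one_mul]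
  congr 1
  ring

theorem oscTwist_mul_oscTwist (η₁ α₁ η₂ α₂ : ℂ) :
    oscTwist η₁ α₁ * oscTwist η₂ α₂ = oscTwist η₂ α₂ * oscTwist η₁ α₁ := by
  refine osc_ext fun j => ?_
  rw [Module.End.mul_apply, Module.End.mul_apply]
  simp only [oscTwist_single, one_mul]
  congr 1
  ring

theorem qpow_one_mul_qpow_neg_one (η : ℂ) : qpow η 1 * qpow η (-1) = 1 := by
  rw [← qpow_add, add_neg_cancel, qpow_zero]

theorem qpow_two (η : ℂ) : qpow η 2 = qpow η 1 ^ 2 := by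
  rw [sq, ← qpow_add]; norm_num

/-- A `ℂ`-algebra with elements `d = q^D`, `d' = q^{-D}`, `A = a`, `C = a*` satisfying the relations
of the `q`-oscillator algebra. -/
structure OscAlg (O : Type*) [Ring O] [Algebra ℂ O] (q : ℂ) where
  d : O
  d' : O
  A : O
  C : O
  q_ne_zero : q ≠ 0
  d_d' : d * d' = 1
  d'_d : d' * d = 1
  A_C : A * C = 1 - q ^ 2 • (d * d)
  C_A : C * A = 1 - d * d
  d_A : d * A = q⁻¹ • (A * d)
  d_C : d * C = q • (C * d)
  d'_A : d' * A = q • (A * d')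
  d'_C : d' * C = q⁻¹ • (C * d')

namespace OscAlg

variable {O : Type*} [Ring O] [Algebra ℂ O] {q : ℂ} (R : OscAlg O q)

/-- Together with the defining relations, the right-associated forms make `simp` bring words to
normal order: `A` and `C` move to the left of `d` and `d'`, and the products `A C` and `C A` are
eliminated. -/
theorem A_C_assoc (x : O) : R.A * (R.C * x) = x - q ^ 2 • (R.d * (R.d * x)) := by
  rw [← mul_assoc, R.A_C, sub_mul, one_mul, smul_mul_assoc, mul_assoc]
theorem C_A_assoc (x : O) : R.C * (R.A * x) = x - R.d * (R.d * x) := by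
  rw [← mul_assoc, R.C_A, sub_mul, one_mul, mul_assoc]
theorem d_A_assoc (x : O) : R.d * (R.A * x) = q⁻¹ • (R.A * (R.d * x)) := by
  rw [← mul_assoc, R.d_A, smul_mul_assoc, mul_assoc]
theorem d_C_assoc (x : O) : R.d * (R.C * x) = q • (R.C * (R.d * x)) := by
  rw [← mul_assoc, R.d_C, smul_mul_assoc, mul_assoc]
theorem d'_A_assoc (x : O) : R.d' * (R.A * x) = q • (R.A * (R.d' * x)) := by
  rw [← mul_assoc, R.d'_A, smul_mul_assoc, mul_assoc]
theorem d'_C_assoc (x : O) : R.d' * (R.C * x) = q⁻¹ • (R.C * (R.d' * x)) := by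
  rw [← mul_assoc, R.d'_C, smul_mul_assoc, mul_assoc]

/-- The `L`-operator. -/
def L (ζ : ℂ) : Matrix (Fin 2) (Fin 2) O :=
  !![R.d' - (ζ ^ 2 * q ^ 2) • R.d, -(ζ • (R.A * R.d)); -(ζ • (R.C * R.d')), R.d]

/-- `1 - ζ²` times the inverse of the `L`-operator. -/
def Ladj (ζ : ℂ) : Matrix (Fin 2) (Fin 2) O :=
  !![R.d, ζ • (R.d * R.A); ζ • (R.d' * R.C), R.d' - ζ ^ 2 • R.d]

/-- The scalar `1 - ζ²` plays the role of a quantum determinant: the `L`-operator degenerates only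
at `ζ² = 1`, which is the source of the singular term in `t* k`. -/
theorem L_mul_Ladj (ζ : ℂ) : R.L ζ * R.Ladj ζ = (1 - ζ ^ 2) • 1 := by
  have hq := R.q_ne_zero
  rw [L, Ladj, Matrix.mul_fin_two]
  ext i j
  fin_cases i <;> fin_cases j <;>
  simp [mul_add, add_mul, sub_mul, mul_sub, mul_assoc, R.d_d', R.d'_d, R.A_C, R.C_A, R.d_A, R.d_C,
    R.d'_A, R.d'_C, R.A_C_assoc, R.C_A_assoc, R.d_A_assoc,
    R.d_C_assoc, R.d'_A_assoc, R.d'_C_assoc] <;> match_scalars <;> field_simp <;> ring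

theorem Ladj_mul_L (ζ : ℂ) : R.Ladj ζ * R.L ζ = (1 - ζ ^ 2) • 1 := by
  have hq := R.q_ne_zero
  rw [L, Ladj, Matrix.mul_fin_two]
  ext i j
  fin_cases i <;> fin_cases j <;>
  simp [mul_add, add_mul, sub_mul, mul_sub, mul_assoc, R.d_d', R.d'_d, R.A_C, R.C_A, R.d_A, R.d_C,
    R.d'_A, R.d'_C, R.A_C_assoc, R.C_A_assoc, R.d_A_assoc,
    R.d_C_assoc, R.d'_A_assoc, R.d'_C_assoc] <;> match_scalars <;> field_simp <;> ring

end OscAlg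

/-- The `q`-oscillator algebra acting on the oscillator module. -/
def oscAlg (η : ℂ) : OscAlg OscEnd (Complex.exp η) where
  d := oscQD η 1
  d' := oscQD η (-1)
  A := oscA η
  C := oscAstar
  q_ne_zero := Complex.exp_ne_zero η
  d_d' := by rw [oscQD_mul]; exact oscQD_zero η
  d'_d := by rw [oscQD_mul]; exact oscQD_zero η
  A_C := by
    rw [oscA_mul_oscAstar, oscQD_mul, qpow_two, qpow, mul_one]; rfl
  C_A := by rw [oscAstar_mul_oscA, oscQD_mul]; rfl
  d_A := by rw [oscQD_mul_oscA]; simp [qpow, Complex.exp_neg]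
  d_C := by rw [oscQD_mul_oscAstar]; simp [qpow]
  d'_A := by rw [oscQD_mul_oscA]; simp [qpow]
  d'_C := by rw [oscQD_mul_oscAstar]; simp [qpow, Complex.exp_neg]

theorem Losc_eq (η ζ : ℂ) : Losc η ζ = (oscAlg η).L ζ := by
  have e : (1 - (ζ ^ 2 * qpow η 2) • oscQD η 2) * oscQD η (-1) =
      oscQD η (-1) - (ζ ^ 2 * Complex.exp η ^ 2) • oscQD η 1 := by
    have h := sub_mul (1 : OscEnd) ((ζ ^ 2 * qpow η 2) • oscQD η 2) (oscQD η (-1))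
    refine h.trans ?_
    rw [one_mul, smul_mul_assoc, oscQD_mul, qpow_two, qpow, mul_one]
    rfl
  rw [Losc, Matrix.mul_fin_two, OscAlg.L]
  simp only [mul_zero, add_zero, zero_add, e, one_mul, neg_mul, smul_mul_assoc]
  rfl

end

section

/-! ### Adding an auxiliary spin -/

/-- Operators at one site with coefficients in `Mat₂ F`, for a two-dimensional auxiliary space. -/
abbrev AuxMat (F : Type*) := Matrix (Fin 2) (Fin 2) (Matrix (Fin 2) (Fin 2) F)

section Aux

variable (F : Type*) [Ring F] [Algebra ℂ F]

/-- The inclusion of operators acting trivially on the auxiliary spin. -/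
def auxIncl : Matrix (Fin 2) (Fin 2) F →ₐ[ℂ] AuxMat F :=
  (Matrix.scalarAlgHom (Fin 2) ℂ).mapMatrix

/-- Extension of scalars. -/
def auxLift : AuxMat ℂ →ₐ[ℂ] AuxMat F :=
  (Algebra.ofId ℂ F).mapMatrix.mapMatrix

variable {F}

theorem auxIncl_apply (a : Matrix (Fin 2) (Fin 2) F) (s t i k : Fin 2) :
    auxIncl F a s t i k = if i = k then a s t else 0 := by
  simp [auxIncl, Matrix.diagonal_apply]

theorem auxLift_apply (a : AuxMat ℂ) (s t i k : Fin 2) :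
    auxLift F a s t i k = algebraMap ℂ F (a s t i k) := by
  simp [auxLift, Algebra.ofId_apply]

end Aux

/-- A six-vertex matrix with weights `a`, `b`, `c`; the outer indices belong to the site, the inner
ones to the auxiliary space. -/
def sixVertex (a b c : ℂ) : AuxMat ℂ :=
  !![!![a, 0; 0, b], !![0, 0; c, 0]; !![0, c; 0, 0], !![b, 0; 0, a]]

theorem sixVertex_mul (a b c a' b' c' : ℂ) (h : b * b' + c * c' = a * a')
    (h' : b * c' + c * b' = 0) :
    sixVertex a b c * sixVertex a' b' c' = (a * a') • 1 := by
  have h'' : c * b' + b * c' = 0 := by rw [add_comm]; exact h'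
  have h''' : c * c' + b * b' = a * a' := by rw [add_comm]; exact h
  ext s t i k
  fin_cases s <;> fin_cases t <;> fin_cases i <;> fin_cases k <;>
    simp [sixVertex, Matrix.mul_apply, Fin.sum_univ_two, h, h', h'', h''']

/-- The `R`-matrix multiplied by `1 - q² ζ²`. -/
def Rsc (q ζ : ℂ) : AuxMat ℂ :=
  sixVertex (1 - q ^ 2 * ζ ^ 2) ((1 - ζ ^ 2) * q) ((1 - q ^ 2) * ζ)

/-- The inverse of `Rsc q ζ`, multiplied by `(1 - q² ζ²) (q² - ζ²)`. -/
def Radj (q ζ : ℂ) : AuxMat ℂ :=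
  sixVertex (q ^ 2 - ζ ^ 2) ((1 - ζ ^ 2) * q) (-((1 - q ^ 2) * ζ))

/-- The two zeros of the scalar, `ζ² = q^{-2}` and `ζ² = q²`, are the only places where conjugation
by the `R`-matrix can be singular; they govern the poles of `t*` and those of `k` away from `ζ² =
1`. -/
theorem Rsc_mul_Radj (q ζ : ℂ) :
    Rsc q ζ * Radj q ζ = ((1 - q ^ 2 * ζ ^ 2) * (q ^ 2 - ζ ^ 2)) • 1 :=
  sixVertex_mul _ _ _ _ _ _ (by ring) (by ring)

theorem Radj_mul_Rsc (q ζ : ℂ) :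
    Radj q ζ * Rsc q ζ = ((1 - q ^ 2 * ζ ^ 2) * (q ^ 2 - ζ ^ 2)) • 1 := by
  rw [mul_comm (1 - q ^ 2 * ζ ^ 2)]
  exact sixVertex_mul _ _ _ _ _ _ (by ring) (by ring)

/-! ### Fusion of two auxiliary spins -/

/-- A matrix commuting with `S^z`, acting on the triplet part of the tensor product of two auxiliary
spins (spanned by the labels `(0, 0)`, `(1, 0)`, `(1, 1)`), and as the identity at the label
`(0, 1)`. -/
def fused (e d₁ d₀ x y : ℂ) : AuxMat (Matrix (Fin 2) (Fin 2) ℂ) :=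
  !![!![!![e, 0; 0, 1], 0; 0, !![d₀, 0; 0, d₁]], !![0, 0; !![x, 0; 0, 0], !![0, 0; y, 0]];
    !![0, !![y, 0; 0, 0]; 0, !![0, x; 0, 0]], !![!![d₁, 0; 0, 1], 0; 0, !![d₀, 0; 0, e]]]

theorem zero_vec_two {F : Type*} [Zero F] : (![0, 0] : Fin 2 → F) = 0 := by
  ext i; fin_cases i <;> rfl

theorem fused_mul (e d₁ d₀ x y e' d₁' d₀' x' y' : ℂ) (he : e * e' = 1)
    (h₁ : d₁ * d₁' + y * x' = 1) (h₂ : d₀ * d₀' + x * y' = 1)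
    (h₃ : x * d₁' + d₀ * x' = 0) (h₄ : d₁ * y' + y * d₀' = 0) :
    fused e d₁ d₀ x y * fused e' d₁' d₀' x' y' = 1 := by
  have h₁' : y * x' + d₁ * d₁' = 1 := by rw [add_comm]; exact h₁
  have h₂' : x * y' + d₀ * d₀' = 1 := by rw [add_comm]; exact h₂
  have h₃' : d₀ * x' + x * d₁' = 0 := by rw [add_comm]; exact h₃
  have h₄' : y * d₀' + d₁ * y' = 0 := by rw [add_comm]; exact h₄
  simp [fused, Matrix.mul_fin_two, Matrix.one_fin_two, he, h₁, h₂, h₃, h₄, h₁', h₂', h₃', h₄',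
    zero_vec_two]

/-- The columns of this matrix are the triplet vectors. -/
def triplet : Matrix (Fin 2) (Fin 2) (Matrix (Fin 2) (Fin 2) ℂ) :=
  !![!![1, 0; 0, 0], !![0, 0; 1, 0]; 0, !![1, 0; 0, 1]]

/-- The transpose of `triplet`. -/
def triplet' : Matrix (Fin 2) (Fin 2) (Matrix (Fin 2) (Fin 2) ℂ) :=
  !![!![1, 0; 0, 0], 0; !![0, 1; 0, 0], !![1, 0; 0, 1]]

theorem scalar_fin_two {F : Type*} [Ring F] (a : F) :
    Matrix.scalar (Fin 2) a = !![a, 0; 0, a] := by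
  ext i k; fin_cases i <;> fin_cases k <;> simp

theorem auxLift_sixVertex (F : Type*) [Ring F] [Algebra ℂ F] (a b c : ℂ) :
    auxLift F (sixVertex a b c) =
      !![!![a • 1, 0; 0, b • 1], !![0, 0; c • 1, 0]; !![0, c • 1; 0, 0], !![b • 1, 0; 0, a • 1]] := by
  ext s t i k
  rw [auxLift_apply]
  fin_cases s <;> fin_cases t <;> fin_cases i <;> fin_cases k <;>
    simp [sixVertex, Algebra.algebraMap_eq_smul_one]

theorem auxIncl_fin_two {F : Type*} [Ring F] [Algebra ℂ F] (a b c d : F) :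
    auxIncl F !![a, b; c, d] =
      !![!![a, 0; 0, a], !![b, 0; 0, b]; !![c, 0; 0, c], !![d, 0; 0, d]] := by
  ext s t i k
  rw [auxIncl_apply]
  fin_cases s <;> fin_cases t <;> fin_cases i <;> fin_cases k <;> simp

/-- At arguments with ratio `q` the symmetric tensors of the two spins are invariant under the
product of `R`-matrices. The column `(0, 1)` of `triplet` vanishes, so the entry `1` of `fused` at
that label is harmless and keeps the matrix square and invertible. -/
theorem fused_triplet (q ζ : ℂ) :
    auxLift (Matrix (Fin 2) (Fin 2) ℂ) (Rsc q ζ) * auxIncl _ (Rsc q (q * ζ)) *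
        Matrix.scalar (Fin 2) triplet =
      (1 - q ^ 2 * ζ ^ 2) • (Matrix.scalar (Fin 2) triplet *
        fused (1 - q ^ 4 * ζ ^ 2) (q ^ 2 * (1 - ζ ^ 2)) (q * (1 - q ^ 2 * ζ ^ 2))
          ((1 - q ^ 2) * q * ζ) ((1 - q ^ 4) * ζ)) := by
  rw [Rsc, auxLift_sixVertex, Rsc, sixVertex, auxIncl_fin_two, scalar_fin_two, triplet, fused]
  simp only [Matrix.mul_fin_two, Matrix.one_fin_two]
  simp [zero_vec_two]
  constructorm* _ ∧ _ <;> first | ring1 | (left; ring1)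

/-- For the inverse ratio the triplet is a quotient instead, whence rows in place of columns. -/
theorem triplet'_fused (q ζ : ℂ) (hq : q ≠ 0) :
    Matrix.scalar (Fin 2) triplet' *
        (auxLift (Matrix (Fin 2) (Fin 2) ℂ) (Rsc q ζ) * auxIncl _ (Rsc q (q⁻¹ * ζ))) =
      (1 - ζ ^ 2) • (fused (1 - q ^ 2 * ζ ^ 2) (q ^ 2 - ζ ^ 2) (q * (1 - ζ ^ 2))
          (q⁻¹ * (1 - q ^ 4) * ζ) ((1 - q ^ 2) * ζ) * Matrix.scalar (Fin 2) triplet') := by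
  rw [Rsc, auxLift_sixVertex, Rsc, sixVertex, auxIncl_fin_two, scalar_fin_two, triplet', fused]
  simp only [Matrix.mul_fin_two, Matrix.one_fin_two]
  simp [zero_vec_two]
  constructorm* _ ∧ _ <;> field_simp <;> ring1

/-! ### Fusion of an auxiliary spin and an oscillator -/

namespace OscAlg

variable {O : Type*} [Ring O] [Algebra ℂ O] {q : ℂ} (R : OscAlg O q)

/-- The column `(a, -1)`, spanning an invariant subspace. -/
def sub : Matrix (Fin 2) (Fin 2) O := !![R.A, 0; -1, 0]

/-- The row `(1, a)`, defining an invariant quotient. -/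
def quo : Matrix (Fin 2) (Fin 2) O := !![1, R.A; 0, 0]

/-- The triangularity behind Baxter's TQ relation: at equal arguments the product of spin and
oscillator operators maps the column `(a, -1)` to a multiple of itself from the right, the
multiplier being again an `L`-operator, with argument shifted by `q⁻¹`. -/
theorem Rsc_L_sub (ζ : ℂ) :
    auxLift O (Rsc q ζ) * auxIncl O (R.L ζ) * Matrix.scalar (Fin 2) R.sub =
      (1 - q ^ 2 * ζ ^ 2) • (Matrix.scalar (Fin 2) R.sub *
        (auxIncl O (R.L (q⁻¹ * ζ)) * Matrix.diagonal ![q • 1, 1])) := by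
  have hq := R.q_ne_zero
  have hd : Matrix.diagonal ![q • (1 : Matrix (Fin 2) (Fin 2) O), 1] =
      !![!![q • 1, 0; 0, q • 1], 0; 0, 1] := by
    ext s t i k
    fin_cases s <;> fin_cases t <;> fin_cases i <;> fin_cases k <;> simp
  rw [hd, Rsc, auxLift_sixVertex, L, L, auxIncl_fin_two, auxIncl_fin_two, scalar_fin_two, sub]
  simp only [Matrix.mul_fin_two, Matrix.one_fin_two]
  simp [zero_vec_two]
  simp [mul_add, add_mul, sub_mul, mul_sub, mul_assoc, R.d_d', R.d'_d, R.A_C, R.C_A, R.d_A, R.d_C,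
    R.d'_A, R.d'_C, R.A_C_assoc, R.C_A_assoc, R.d_A_assoc,
    R.d_C_assoc, R.d'_A_assoc, R.d'_C_assoc]
  constructorm* _ ∧ _ <;> match_scalars <;> field_simp <;> ring1

/-- The complementary block of the same triangular structure, with the opposite shift; the row `(1,
a)` annihilates the column `(a, -1)`. -/
theorem quo_Rsc_L (ζ : ℂ) :
    Matrix.scalar (Fin 2) R.quo * (auxLift O (Rsc q ζ) * auxIncl O (R.L ζ)) =
      (1 - ζ ^ 2) • (auxIncl O (R.L (q * ζ)) * Matrix.diagonal ![1, q • 1] *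
        Matrix.scalar (Fin 2) R.quo) := by
  have hq := R.q_ne_zero
  have hd : Matrix.diagonal ![1, q • (1 : Matrix (Fin 2) (Fin 2) O)] =
      !![1, 0; 0, !![q • 1, 0; 0, q • 1]] := by
    ext s t i k
    fin_cases s <;> fin_cases t <;> fin_cases i <;> fin_cases k <;> simp
  rw [hd, Rsc, auxLift_sixVertex, L, L, auxIncl_fin_two, auxIncl_fin_two, scalar_fin_two, quo]
  simp only [Matrix.mul_fin_two, Matrix.one_fin_two]
  simp [zero_vec_two]
  simp [mul_add, add_mul, sub_mul, mul_sub, mul_assoc, R.d_d', R.d'_d, R.A_C, R.C_A, R.d_A, R.d_C,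
    R.d'_A, R.d'_C, R.A_C_assoc, R.C_A_assoc, R.d_A_assoc,
    R.d_C_assoc, R.d'_A_assoc, R.d'_C_assoc]
  constructorm* _ ∧ _ <;> match_scalars <;> field_simp <;> ring1

end OscAlg

end

section

/-! ### Conjugation by the same matrix at all sites -/

section LocFold

variable {n : ℕ} {E : Type*} [Ring E]

/-- Ordered conjugation by one and the same local operator at all sites. -/
def locFold (a a' : Matrix (Fin 2) (Fin 2) E) (Y : Matrix (Conf n) (Conf n) E) :
    Matrix (Conf n) (Conf n) E :=
  conjFold (fun j => loc j a) (fun j => loc j a') Y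

theorem locFold_mul {a a' b b' : Matrix (Fin 2) (Fin 2) E}
    (h : ∀ s t s' t', Commute (a s t) (b s' t'))
    (h' : ∀ s t s' t', Commute (a' s t) (b' s' t')) (Y : Matrix (Conf n) (Conf n) E) :
    locFold (a * b) (b' * a') Y = locFold a a' (locFold b b' Y) := by
  simp only [locFold, loc_mul]
  exact conjFold_mul _ _ _ _ (fun i j hij => loc_commute hij h) (fun i j hij => loc_commute hij h') Y

theorem locFold_mul_right {p : E} {a a' b b' : Matrix (Fin 2) (Fin 2) E}
    {Y Z : Matrix (Conf n) (Conf n) E}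
    (h : a * Matrix.scalar (Fin 2) p = Matrix.scalar (Fin 2) p * b)
    (ha : a' * a = 1) (hb : b * b' = 1)
    (hY : Y * Matrix.scalar (Conf n) p = Matrix.scalar (Conf n) p * Z) :
    locFold a a' Y * Matrix.scalar (Conf n) p = Matrix.scalar (Conf n) p * locFold b b' Z := by
  have h' := intertwine_inv h ha hb
  refine conjFold_mul_right _ _ _ _ _ (fun j => ?_) (fun j => ?_) hY
  · rw [← loc_scalar j, ← loc_mul, ← loc_mul, h]
  · rw [← loc_scalar j, ← loc_mul, ← loc_mul, h']

theorem locFold_mul_left {p : E} {a a' b b' : Matrix (Fin 2) (Fin 2) E}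
    {Y Z : Matrix (Conf n) (Conf n) E}
    (h : Matrix.scalar (Fin 2) p * a = b * Matrix.scalar (Fin 2) p)
    (ha : a * a' = 1) (hb : b' * b = 1)
    (hY : Matrix.scalar (Conf n) p * Y = Z * Matrix.scalar (Conf n) p) :
    Matrix.scalar (Conf n) p * locFold a a' Y = locFold b b' Z * Matrix.scalar (Conf n) p := by
  have h' := intertwine_inv' h ha hb
  refine conjFold_mul_left _ _ _ _ _ (fun j => ?_) (fun j => ?_) hY
  · rw [← loc_scalar j, ← loc_mul, ← loc_mul, h]
  · rw [← loc_scalar j, ← loc_mul, ← loc_mul, h']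

theorem locFold_smul_smul [Algebra ℂ E] (a a' : Matrix (Fin 2) (Fin 2) E) (c d : ℂ)
    (Y : Matrix (Conf n) (Conf n) E) : locFold (c • a) (d • a') Y = (c * d) ^ n • locFold a a' Y := by
  simp only [locFold, loc_smul]
  exact conjFold_smul_smul _ _ _ _ _

theorem locFold_smul [Algebra ℂ E] (a a' : Matrix (Fin 2) (Fin 2) E) (c : ℂ)
    (Y : Matrix (Conf n) (Conf n) E) : locFold a a' (c • Y) = c • locFold a a' Y :=
  conjFold_smul _ _ _ _

theorem loc_diagonal (j : Fin n) (f : Fin 2 → E) :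
    loc j (Matrix.diagonal f) = Matrix.diagonal fun x => f (x j) := by
  ext x y
  rw [loc_apply, Matrix.diagonal_apply, Matrix.diagonal_apply]
  by_cases h : x = y
  · subst h; simp
  · rw [if_neg h]
    split_ifs with h1 h2
    · refine absurd (funext fun i => ?_) h
      by_cases hi : i = j
      · rw [hi, h2]
      · exact h1 i hi
    · rfl
    · rfl

theorem locFold_diagonal [Algebra ℂ E] (f g : Fin 2 → ℂ) (Y : Matrix (Conf n) (Conf n) E) :
    locFold (Matrix.diagonal fun i => f i • 1) (Matrix.diagonal fun i => g i • 1) Y =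
      Matrix.of fun x y => ((∏ j, f (x j)) * ∏ j, g (y j)) • Y x y := by
  have : ∀ l : List (Fin n), ∀ Y : Matrix (Conf n) (Conf n) E,
      l.foldl (fun Z j => loc j (Matrix.diagonal fun i => f i • (1 : E)) * Z *
        loc j (Matrix.diagonal fun i => g i • (1 : E))) Y =
      Matrix.of fun x y => ((l.map fun j => f (x j)).prod * (l.map fun j => g (y j)).prod) • Y x y := by
    intro l
    induction l with
    | nil => intro Y; ext x y; simp
    | cons j l ih =>
      intro Y
      rw [List.foldl_cons, ih]
      ext x y
      simp only [Matrix.of_apply, loc_diagonal, Matrix.mul_diagonal, Matrix.diagonal_mul,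
        List.map_cons, List.prod_cons, smul_mul_assoc, one_mul, mul_smul_comm, mul_one, smul_smul]
      congr 1
      ring
  rw [locFold, conjFold, this]
  ext x y
  simp only [Matrix.of_apply, Fin.prod_univ_def]

end LocFold

/-! ### Traces over the auxiliary spaces -/

section Bridge

variable {n : ℕ}

/-- The inverse of `Rsc q ζ`. -/
def Rinv (q ζ : ℂ) : AuxMat ℂ := ((1 - q ^ 2 * ζ ^ 2) * (q ^ 2 - ζ ^ 2))⁻¹ • Radj q ζ

theorem Rsc_mul_Rinv {q ζ : ℂ} (h₁ : 1 - q ^ 2 * ζ ^ 2 ≠ 0) (h₂ : q ^ 2 - ζ ^ 2 ≠ 0) :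
    Rsc q ζ * Rinv q ζ = 1 := by
  rw [Rinv, mul_smul_comm, Rsc_mul_Radj, smul_smul, inv_mul_cancel₀ (mul_ne_zero h₁ h₂), one_smul]

theorem Rinv_mul_Rsc {q ζ : ℂ} (h₁ : 1 - q ^ 2 * ζ ^ 2 ≠ 0) (h₂ : q ^ 2 - ζ ^ 2 ≠ 0) :
    Rinv q ζ * Rsc q ζ = 1 := by
  rw [Rinv, smul_mul_assoc, Radj_mul_Rsc, smul_smul, inv_mul_cancel₀ (mul_ne_zero h₁ h₂), one_smul]

/-- The inverse of the `L`-operator. -/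
def OscAlg.Linv {O : Type*} [Ring O] [Algebra ℂ O] {q : ℂ} (R : OscAlg O q) (ζ : ℂ) :
    Matrix (Fin 2) (Fin 2) O := (1 - ζ ^ 2)⁻¹ • R.Ladj ζ

theorem OscAlg.L_mul_Linv {O : Type*} [Ring O] [Algebra ℂ O] {q : ℂ} (R : OscAlg O q) {ζ : ℂ}
    (h : 1 - ζ ^ 2 ≠ 0) : R.L ζ * R.Linv ζ = 1 := by
  rw [Linv, mul_smul_comm, L_mul_Ladj, smul_smul, inv_mul_cancel₀ h, one_smul]

theorem OscAlg.Linv_mul_L {O : Type*} [Ring O] [Algebra ℂ O] {q : ℂ} (R : OscAlg O q) {ζ : ℂ}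
    (h : 1 - ζ ^ 2 ≠ 0) : R.Linv ζ * R.L ζ = 1 := by
  rw [Linv, smul_mul_assoc, Ladj_mul_L, smul_smul, inv_mul_cancel₀ h, one_smul]

/-- Merging the auxiliary index with the site indices, and applying `φ` to the entries. -/
def flatten {F G : Type*} (φ : F → G) (Y : Matrix (Conf n) (Conf n) (Matrix (Fin 2) (Fin 2) F)) :
    Matrix (Fin 2 × Conf n) (Fin 2 × Conf n) G :=
  Matrix.of fun v w => φ (Y v.2 w.2 v.1 w.1)

theorem flatten_loc_mul {F : Type*} [Ring F] [Algebra ℂ F] (φ : F →ₗ[ℂ] ℂ) (j : Fin n) (a : AuxMat ℂ)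
    (Y : Matrix (Conf n) (Conf n) (Matrix (Fin 2) (Fin 2) F)) :
    flatten φ (loc j (auxLift F a) * Y) = flatten id (loc j a) * flatten φ Y := by
  ext ⟨i, x⟩ ⟨k, y⟩
  simp only [flatten, Matrix.of_apply, Matrix.mul_apply, Fintype.sum_prod_type, Matrix.sum_apply,
    map_sum, id]
  rw [Finset.sum_comm]
  refine Finset.sum_congr rfl fun l _ => Finset.sum_congr rfl fun z _ => ?_
  simp only [loc_apply]
  split_ifs
  · rw [auxLift_apply, Algebra.algebraMap_eq_smul_one, smul_mul_assoc, one_mul, map_smul, smul_eq_mul]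
  · simp

theorem flatten_mul_loc {F : Type*} [Ring F] [Algebra ℂ F] (φ : F →ₗ[ℂ] ℂ) (j : Fin n) (a : AuxMat ℂ)
    (Y : Matrix (Conf n) (Conf n) (Matrix (Fin 2) (Fin 2) F)) :
    flatten φ (Y * loc j (auxLift F a)) = flatten φ Y * flatten id (loc j a) := by
  ext ⟨i, x⟩ ⟨k, y⟩
  simp only [flatten, Matrix.of_apply, Matrix.mul_apply, Fintype.sum_prod_type, Matrix.sum_apply,
    map_sum, id]
  rw [Finset.sum_comm]
  refine Finset.sum_congr rfl fun l _ => Finset.sum_congr rfl fun z _ => ?_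
  simp only [loc_apply]
  split_ifs
  · rw [auxLift_apply, Algebra.algebraMap_eq_smul_one, mul_smul_comm, mul_one, map_smul, smul_eq_mul,
      mul_comm]
  · simp

theorem flatten_mul (a b : Matrix (Conf n) (Conf n) (Matrix (Fin 2) (Fin 2) ℂ)) :
    flatten id (a * b) = flatten id a * flatten id b := by
  ext ⟨i, x⟩ ⟨k, y⟩
  simp only [flatten, Matrix.of_apply, Matrix.mul_apply, Fintype.sum_prod_type, Matrix.sum_apply, id]
  rw [Finset.sum_comm]

theorem flatten_one :
    flatten id (1 : Matrix (Conf n) (Conf n) (Matrix (Fin 2) (Fin 2) ℂ)) = 1 := by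
  ext ⟨i, x⟩ ⟨k, y⟩
  simp only [flatten, Matrix.of_apply, id, Matrix.one_apply, Prod.mk.injEq]
  by_cases h : x = y <;> by_cases h' : i = k <;> simp [h, h', Matrix.one_apply]

theorem La_eq (η ζ : ℂ) (h : 1 - Complex.exp η ^ 2 * ζ ^ 2 ≠ 0) (j : Fin n) :
    La η ζ j = (1 - Complex.exp η ^ 2 * ζ ^ 2)⁻¹ • flatten id (loc j (Rsc (Complex.exp η) ζ)) := by
  have key : ∀ s t i k : Fin 2, Rmat η ζ (i, s) (k, t) =
      (1 - Complex.exp η ^ 2 * ζ ^ 2)⁻¹ * Rsc (Complex.exp η) ζ s t i k := by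
    intro s t i k
    fin_cases s <;> fin_cases t <;> fin_cases i <;> fin_cases k <;>
      simp [Rmat, Rsc, sixVertex] <;> field_simp
  ext ⟨i, x⟩ ⟨k, y⟩
  simp only [La, flatten, Matrix.of_apply, Matrix.smul_apply, id, loc_apply, smul_eq_mul]
  split_ifs
  · exact key _ _ _ _
  · simp

/-- The entries of the `R`-matrices are scalars, so a linear form `φ` on the remaining auxiliary
factor commutes with the conjugation. This allows the trace over the oscillator to be taken last. -/
theorem adjointMonodromy_La {η ζ : ℂ} (h₁ : 1 - Complex.exp η ^ 2 * ζ ^ 2 ≠ 0)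
    (h₂ : Complex.exp η ^ 2 - ζ ^ 2 ≠ 0) {F : Type*} [Ring F] [Algebra ℂ F] (φ : F →ₗ[ℂ] ℂ)
    (Y : Matrix (Conf n) (Conf n) (Matrix (Fin 2) (Fin 2) F)) :
    adjointMonodromy (La η ζ) (flatten φ Y) =
      flatten φ (locFold (auxLift F (Rsc (Complex.exp η) ζ)) (auxLift F (Rinv (Complex.exp η) ζ)) Y) := by
  set q := Complex.exp η
  set c := 1 - q ^ 2 * ζ ^ 2
  have e₁ : ∀ j : Fin n, flatten id (loc j (Rsc q ζ)) * flatten id (loc j (Rinv q ζ)) = 1 := fun j => by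
    rw [← flatten_mul, ← loc_mul, Rsc_mul_Rinv h₁ h₂, loc_one, flatten_one]
  have e₂ : ∀ j : Fin n, flatten id (loc j (Rinv q ζ)) * flatten id (loc j (Rsc q ζ)) = 1 := fun j => by
    rw [← flatten_mul, ← loc_mul, Rinv_mul_Rsc h₁ h₂, loc_one, flatten_one]
  have e₃ : La η ζ = fun j : Fin n => c⁻¹ • flatten id (loc j (Rsc q ζ)) := funext (La_eq η ζ h₁)
  rw [e₃, adjointMonodromy_eq_conjFold (L' := fun j => c • flatten id (loc j (Rinv q ζ)))
    (fun j => by rw [smul_mul_smul_comm, e₁, inv_mul_cancel₀ h₁, one_smul])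
    (fun j => by rw [smul_mul_smul_comm, e₂, mul_inv_cancel₀ h₁, one_smul]),
    conjFold_smul_smul, inv_mul_cancel₀ h₁, one_pow, one_smul]
  refine (conjFold_induction (fun Z Y => Y = flatten φ Z) _ _ _ _ (fun j Z Y e => ?_) rfl).symm ▸ rfl
  rw [e, flatten_mul_loc, flatten_loc_mul]

/-- `Y` tensored with a diagonal matrix on the auxiliary space. -/
def dress {F : Type*} [Ring F] [Algebra ℂ F] (D : Fin 2 → ℂ) (Y : Matrix (Conf n) (Conf n) F) :
    Matrix (Conf n) (Conf n) (Matrix (Fin 2) (Fin 2) F) :=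
  Matrix.of fun x y => Matrix.diagonal fun i => D i • Y x y

theorem dress_locFold {F : Type*} [Ring F] [Algebra ℂ F] (D : Fin 2 → ℂ)
    (a a' : Matrix (Fin 2) (Fin 2) F) (Y : Matrix (Conf n) (Conf n) F) :
    dress D (locFold a a' Y) = locFold (auxIncl F a) (auxIncl F a') (dress D Y) := by
  refine conjFold_induction (fun Y Z => dress D Y = Z) _ _ _ _ (fun j Y Z e => ?_) rfl
  subst e
  have hl : ∀ a : Matrix (Fin 2) (Fin 2) F, ∀ x y i k, loc j (auxIncl F a) x y i k =
      if i = k then loc j a x y else 0 := by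
    intro a x y i k
    simp only [loc_apply]
    split_ifs with h1 h2 h2
    · rw [auxIncl_apply, if_pos h2]
    · rw [auxIncl_apply, if_neg h2]
    · rfl
    · rfl
  ext x y i k
  simp only [dress, Matrix.of_apply, Matrix.mul_apply, Matrix.sum_apply, hl, Matrix.diagonal_apply,
    Fin.sum_univ_two, Finset.sum_mul]
  fin_cases i <;> fin_cases k <;> simp [Finset.smul_sum, Finset.sum_mul]

theorem flatten_dress {F : Type*} [Ring F] [Algebra ℂ F] (φ : F →ₗ[ℂ] ℂ) (a b : ℂ)
    (Y : Matrix (Conf n) (Conf n) F) :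
    flatten φ (dress ![a, b] Y) = Matrix.diagonal ![a, b] ⊗ₖ Y.map φ := by
  ext ⟨i, x⟩ ⟨k, y⟩
  rw [Matrix.kroneckerMap_apply]
  simp only [flatten, dress, Matrix.of_apply, Matrix.diagonal_apply, Matrix.map_apply]
  split_ifs <;> simp

theorem Ta_eq {η α u : ℂ} (h₁ : 1 - Complex.exp η ^ 2 * Complex.exp u ^ 2 ≠ 0)
    (h₂ : Complex.exp η ^ 2 - Complex.exp u ^ 2 ≠ 0) {F : Type*} [Ring F] [Algebra ℂ F]
    (φ : F →ₗ[ℂ] ℂ) (Y : Matrix (Conf n) (Conf n) F) :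
    Ta η α u (Y.map φ) =
      flatten φ (locFold (auxLift F (Rsc (Complex.exp η) (Complex.exp u)))
        (auxLift F (Rinv (Complex.exp η) (Complex.exp u))) (dress ![qpow η α, qpow η (-α)] Y)) := by
  rw [Ta, ← flatten_dress, adjointMonodromy_La h₁ h₂]

/-- The trace over the oscillator module as a linear map. -/
def oscTraceLin (η α : ℂ) : OscEnd →ₗ[ℂ] ℂ where
  toFun := oscTrace η α
  map_add' x y := by
    simp only [oscTrace, LinearMap.add_apply, Finsupp.add_apply]
    exact Finsupp.sum_add_index' (fun _ => zero_div _) (fun _ _ _ => add_div _ _ _)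
  map_smul' c x := by
    simp only [oscTrace, LinearMap.smul_apply, Finsupp.smul_apply, RingHom.id_apply, smul_eq_mul]
    refine (Finsupp.sum_smul_index' (fun _ => zero_div _)).trans ?_
    rw [Finsupp.mul_sum]
    exact Finset.sum_congr rfl fun _ _ => mul_div_assoc c _ _

/-- The starting point of the monodromy over the oscillator module. -/
def oscInit {O : Type*} [Ring O] [Algebra ℂ O] (t : O) (X : Op n) : Matrix (Conf n) (Conf n) O :=
  Matrix.of fun x y => X x y • t

theorem TA_eq {η α u : ℂ} (h : 1 - Complex.exp u ^ 2 ≠ 0) (X : Op n) :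
    TA η α u X = locFold ((oscAlg η).L (Complex.exp u)) ((oscAlg η).Linv (Complex.exp u))
      (oscInit (oscTwist η α) X) := by
  have e : LA η (Complex.exp u) = fun j : Fin n => loc j ((oscAlg η).L (Complex.exp u)) := by
    funext j; rw [← Losc_eq]; rfl
  rw [TA, e, adjointMonodromy_eq_conjFold
    (L' := fun j => loc j ((oscAlg η).Linv (Complex.exp u)))
    (fun j => by rw [← loc_mul, OscAlg.L_mul_Linv _ h, loc_one])
    (fun j => by rw [← loc_mul, OscAlg.Linv_mul_L _ h, loc_one])]
  rfl

end Bridge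

end

/-! ### The product `t* k` as one conjugation over two auxiliary spins and the oscillator -/

section

variable {n : ℕ}

/-- `q^{2αD} ⊗ X` and a twisted auxiliary spin, after conjugation by the `L`- and `R`-operators. -/
def spinOscMonodromy {O : Type*} [Ring O] [Algebra ℂ O] {q : ℂ} (R : OscAlg O q) (t : O)
    (D : Fin 2 → ℂ) (ζ : ℂ) (X : Op n) : Matrix (Conf n) (Conf n) (Matrix (Fin 2) (Fin 2) O) :=
  locFold (auxLift O (Rsc q ζ)) (auxLift O (Rinv q ζ))
    (dress D (locFold (R.L ζ) (R.Linv ζ) (oscInit t X)))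

/-- The argument of the monodromy operators in the definition of `k`. -/
def kArg (η α u : ℂ) (X : Op n) : Op n := zetaPowAlphaSubSpin u α (qPowNegTwoSpin n η * X)

/-- Under the trace over `a`, the factor `σ⁺` selects the matrix element `(1, 0)`. -/
theorem kOp_apply {η α u : ℂ} (h₁ : 1 - Complex.exp η ^ 2 * Complex.exp u ^ 2 ≠ 0)
    (h₂ : Complex.exp η ^ 2 - Complex.exp u ^ 2 ≠ 0) (h₃ : 1 - Complex.exp u ^ 2 ≠ 0) (X : Op n)
    (x y : Conf n) : kOp η α u X x y =
      oscTraceLin η α (spinOscMonodromy (oscAlg η) (oscTwist η α) ![qpow η α, qpow η (-α)]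
        (Complex.exp u) (kArg η α u X) x y 1 0) := by
  have e : trTA η α u (kArg η α u X) =
      (TA η α u (kArg η α u X)).map (oscTraceLin η α) := rfl
  rw [kOp, ← kArg, e, Ta_eq h₁ h₂ (oscTraceLin η α) (TA η α u (kArg η α u X)), TA_eq h₃,
    ← spinOscMonodromy]
  simp only [traceAux, Matrix.of_apply, Matrix.mul_apply, Fintype.sum_prod_type,
    Matrix.kroneckerMap_apply, Fin.sum_univ_two, flatten]
  simp [Matrix.one_apply]

/-- The `L`-operator of two auxiliary spins and the oscillator. -/
def spinSpinOscL {O : Type*} [Ring O] [Algebra ℂ O] {q : ℂ} (R : OscAlg O q) (ζ ζ' : ℂ) :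
    AuxMat (Matrix (Fin 2) (Fin 2) O) :=
  auxLift _ (Rsc q ζ) * (auxIncl _ (auxLift O (Rsc q ζ')) * auxIncl _ (auxIncl O (R.L ζ')))

/-- The inverse of `spinSpinOscL`. -/
def spinSpinOscLinv {O : Type*} [Ring O] [Algebra ℂ O] {q : ℂ} (R : OscAlg O q) (ζ ζ' : ℂ) :
    AuxMat (Matrix (Fin 2) (Fin 2) O) :=
  auxIncl _ (auxIncl O (R.Linv ζ')) * auxIncl _ (auxLift O (Rinv q ζ')) * auxLift _ (Rinv q ζ)

theorem commute_auxLift_scalar {F : Type*} [Ring F] [Algebra ℂ F] (a : AuxMat ℂ) (s t : Fin 2)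
    (b : F) : Commute (auxLift F a s t) (Matrix.scalar (Fin 2) b) := by
  ext i k
  rw [Matrix.scalar_apply, Matrix.mul_diagonal, Matrix.diagonal_mul, auxLift_apply,
    Algebra.commutes]

theorem commute_auxLift_auxIncl {F : Type*} [Ring F] [Algebra ℂ F] (a : AuxMat ℂ)
    (b : Matrix (Fin 2) (Fin 2) F) (s t s' t' : Fin 2) :
    Commute (auxLift F a s t) (auxIncl F b s' t') :=
  commute_auxLift_scalar a s t (b s' t')

theorem commute_auxIncl_auxIncl {F : Type*} [Ring F] [Algebra ℂ F] {a b : Matrix (Fin 2) (Fin 2) F}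
    {s t s' t' : Fin 2} (h : Commute (a s t) (b s' t')) :
    Commute (auxIncl F a s t) (auxIncl F b s' t') :=
  h.map (Matrix.scalar (Fin 2))

/-- Conjugation of the twisted identity by the monodromy matrix of two auxiliary spins and the
oscillator. -/
def spinSpinOscMonodromy {O : Type*} [Ring O] [Algebra ℂ O] {q : ℂ} (R : OscAlg O q) (t : O)
    (D : Fin 2 → ℂ) (ζ ζ' : ℂ) (X : Op n) :
    Matrix (Conf n) (Conf n) (Matrix (Fin 2) (Fin 2) (Matrix (Fin 2) (Fin 2) O)) :=
  locFold (spinSpinOscL R ζ ζ') (spinSpinOscLinv R ζ ζ') (dress D (dress D (oscInit t X)))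

/-- Local operators at different sites commute as soon as they act on different auxiliary spaces, so
`conjFold_mul` merges the conjugations by `b`, `a` and the oscillator. -/
theorem spinSpinOscMonodromy_eq {O : Type*} [Ring O] [Algebra ℂ O] {q : ℂ} (R : OscAlg O q) (t : O)
    (D : Fin 2 → ℂ) (ζ ζ' : ℂ) (X : Op n) :
    spinSpinOscMonodromy R t D ζ ζ' X =
      locFold (auxLift _ (Rsc q ζ)) (auxLift _ (Rinv q ζ))
        (dress D (spinOscMonodromy R t D ζ' X)) := by
  rw [spinOscMonodromy, dress_locFold, dress_locFold, dress_locFold, spinSpinOscMonodromy,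
    spinSpinOscL, spinSpinOscLinv, locFold_mul, locFold_mul]
  · exact fun s t s' t' => commute_auxIncl_auxIncl (commute_auxLift_auxIncl _ _ _ _ _ _)
  · exact fun s t s' t' => commute_auxIncl_auxIncl (commute_auxLift_auxIncl _ _ _ _ _ _)
  · intro s t s' t'
    rw [← map_mul]
    exact commute_auxLift_auxIncl _ _ _ _ _ _
  · intro s t s' t'
    rw [← map_mul]
    exact commute_auxLift_auxIncl _ _ _ _ _ _

/-- A matrix element over the inner auxiliary space, followed by a linear form. -/
def entryLin {O : Type*} [Ring O] [Algebra ℂ O] (φ : O →ₗ[ℂ] ℂ) (i k : Fin 2) :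
    Matrix (Fin 2) (Fin 2) O →ₗ[ℂ] ℂ :=
  φ ∘ₗ Matrix.entryLinearMap ℂ O i k

theorem tStar_kOp_apply {η α u v : ℂ} (h₁ : 1 - Complex.exp η ^ 2 * Complex.exp u ^ 2 ≠ 0)
    (h₂ : Complex.exp η ^ 2 - Complex.exp u ^ 2 ≠ 0)
    (h₃ : 1 - Complex.exp η ^ 2 * Complex.exp v ^ 2 ≠ 0)
    (h₄ : Complex.exp η ^ 2 - Complex.exp v ^ 2 ≠ 0) (h₅ : 1 - Complex.exp v ^ 2 ≠ 0) (X : Op n)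
    (x y : Conf n) : tStar η α u (kOp η α v X) x y =
      ∑ b, oscTraceLin η α (spinSpinOscMonodromy (oscAlg η) (oscTwist η α)
        ![qpow η α, qpow η (-α)] (Complex.exp u) (Complex.exp v) (kArg η α v X) x y b b 1 0) := by
  have e : kOp η α v X = (spinOscMonodromy (oscAlg η) (oscTwist η α) ![qpow η α, qpow η (-α)]
        (Complex.exp v) (kArg η α v X)).map (entryLin (oscTraceLin η α) 1 0) := by
    ext x y
    rw [kOp_apply h₃ h₄ h₅]
    rfl
  rw [tStar, e, Ta_eq h₁ h₂ (entryLin (oscTraceLin η α) 1 0)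
    (spinOscMonodromy (oscAlg η) (oscTwist η α) ![qpow η α, qpow η (-α)] (Complex.exp v)
      (kArg η α v X)), ← spinSpinOscMonodromy_eq]
  rfl

/-! ### Triangularity -/

section Core

variable {O : Type*} [Ring O] [Algebra ℂ O] {q : ℂ} (R : OscAlg O q)

/-- The `L`-operator of one auxiliary spin and the oscillator; the inner spin is inert. -/
def spinOscL (ζ : ℂ) : AuxMat (Matrix (Fin 2) (Fin 2) O) :=
  auxLift _ (Rsc q ζ) * auxIncl _ (auxIncl O (R.L ζ))

/-- The inverse of `spinOscL`. -/
def spinOscLinv (ζ : ℂ) : AuxMat (Matrix (Fin 2) (Fin 2) O) :=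
  auxIncl _ (auxIncl O (R.Linv ζ)) * auxLift _ (Rinv q ζ)

/-- The conjugation by the monodromy matrix built from `spinOscL`. -/
def spinOscMonodromy' (t : O) (D : Fin 2 → ℂ) (ζ : ℂ) (X : Op n) :
    Matrix (Conf n) (Conf n) (Matrix (Fin 2) (Fin 2) (Matrix (Fin 2) (Fin 2) O)) :=
  locFold (spinOscL R ζ) (spinOscLinv R ζ) (dress D (dress ![1, 1] (oscInit t X)))

/-- Extension of scalars in matrices over two auxiliary spins. -/
def lift₂ (O : Type*) [Ring O] [Algebra ℂ O] : Matrix (Fin 2) (Fin 2) (Matrix (Fin 2) (Fin 2) ℂ) →ₐ[ℂ]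
    Matrix (Fin 2) (Fin 2) (Matrix (Fin 2) (Fin 2) O) :=
  (Algebra.ofId ℂ O).mapMatrix.mapMatrix

/-- Extension of scalars in matrices over one site and two auxiliary spins. -/
def lift₃ (O : Type*) [Ring O] [Algebra ℂ O] : AuxMat (Matrix (Fin 2) (Fin 2) ℂ) →ₐ[ℂ]
    AuxMat (Matrix (Fin 2) (Fin 2) O) :=
  (lift₂ O).mapMatrix

theorem lift₃_auxLift (a : AuxMat ℂ) :
    lift₃ O (auxLift (Matrix (Fin 2) (Fin 2) ℂ) a) = auxLift (Matrix (Fin 2) (Fin 2) O) a := by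
  ext s t i k j l
  simp [lift₃, lift₂, auxLift_apply, Algebra.ofId_apply, Matrix.algebraMap_matrix_apply]

theorem lift₃_auxIncl (a : AuxMat ℂ) :
    lift₃ O (auxIncl (Matrix (Fin 2) (Fin 2) ℂ) a) =
      auxIncl (Matrix (Fin 2) (Fin 2) O) (auxLift O a) := by
  ext s t i k j l
  simp only [lift₃, lift₂, AlgHom.mapMatrix_apply, Matrix.map_apply, auxIncl_apply]
  split_ifs
  · rw [auxLift_apply]; rfl
  · simp

theorem lift₃_scalar (p : Matrix (Fin 2) (Fin 2) (Matrix (Fin 2) (Fin 2) ℂ)) :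
    lift₃ O (Matrix.scalar (Fin 2) p) = Matrix.scalar (Fin 2) (lift₂ O p) := by
  ext s t i k j l
  simp only [lift₃, AlgHom.mapMatrix_apply, Matrix.map_apply, Matrix.scalar_apply,
    Matrix.diagonal_apply]
  split_ifs <;> simp

theorem lift₂_commute (p : Matrix (Fin 2) (Fin 2) (Matrix (Fin 2) (Fin 2) ℂ)) (o : O) :
    Commute (Matrix.scalar (Fin 2) (Matrix.scalar (Fin 2) o)) (lift₂ O p) := by
  ext i k j l
  simp [lift₂, Matrix.diagonal_mul, Matrix.mul_diagonal, Algebra.ofId_apply, Algebra.commutes]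

theorem scalar_commute {F : Type*} [Ring F] {a : Matrix (Fin 2) (Fin 2) F} {p : F}
    (h : ∀ s t, Commute (a s t) p) : Commute a (Matrix.scalar (Fin 2) p) := by
  ext s t
  rw [Matrix.scalar_apply, Matrix.mul_diagonal, Matrix.diagonal_mul, (h s t).eq]

theorem L_commute_lift₂ (a : Matrix (Fin 2) (Fin 2) O)
    (p : Matrix (Fin 2) (Fin 2) (Matrix (Fin 2) (Fin 2) ℂ)) :
    Commute (auxIncl (Matrix (Fin 2) (Fin 2) O) (auxIncl O a)) (Matrix.scalar (Fin 2) (lift₂ O p)) :=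
  scalar_commute fun s t => lift₂_commute p (a s t)

theorem fusedL_triplet (ζ : ℂ) :
    spinSpinOscL R ζ (q * ζ) * Matrix.scalar (Fin 2) (lift₂ O triplet) =
      Matrix.scalar (Fin 2) (lift₂ O triplet) * ((1 - q ^ 2 * ζ ^ 2) •
        (lift₃ O (fused (1 - q ^ 4 * ζ ^ 2) (q ^ 2 * (1 - ζ ^ 2)) (q * (1 - q ^ 2 * ζ ^ 2))
          ((1 - q ^ 2) * q * ζ) ((1 - q ^ 4) * ζ)) * auxIncl _ (auxIncl O (R.L (q * ζ))))) := by
  have h := congrArg (lift₃ O) (fused_triplet q ζ)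
  simp only [map_mul, map_smul, lift₃_auxLift, lift₃_auxIncl, lift₃_scalar] at h
  rw [spinSpinOscL, mul_assoc, mul_assoc, (L_commute_lift₂ _ _).eq, ← mul_assoc, ← mul_assoc, h,
    smul_mul_assoc, mul_smul_comm, mul_assoc]

theorem triplet'_fusedL (ζ : ℂ) :
    Matrix.scalar (Fin 2) (lift₂ O triplet') * spinSpinOscL R ζ (q⁻¹ * ζ) =
      ((1 - ζ ^ 2) • (lift₃ O (fused (1 - q ^ 2 * ζ ^ 2) (q ^ 2 - ζ ^ 2) (q * (1 - ζ ^ 2))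
          (q⁻¹ * (1 - q ^ 4) * ζ) ((1 - q ^ 2) * ζ)) *
            auxIncl _ (auxIncl O (R.L (q⁻¹ * ζ))))) * Matrix.scalar (Fin 2) (lift₂ O triplet') := by
  have h := congrArg (lift₃ O) (triplet'_fused q ζ R.q_ne_zero)
  simp only [map_mul, map_smul, lift₃_auxLift, lift₃_auxIncl, lift₃_scalar] at h
  rw [spinSpinOscL, ← mul_assoc (auxLift _ _), ← mul_assoc, h, smul_mul_assoc, mul_assoc,
    ← (L_commute_lift₂ _ _).eq, smul_mul_assoc]
  simp only [mul_assoc]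

/-- The pair `a`, `A` at `qζ` collapses to the oscillator at `ζ`, while the operator of `b` passes
through because its entries are scalars. What is left is `spinOscL` at `ζ`, the same operator that
`quo_spinSpinOscL` yields for the opposite shift. -/
theorem spinSpinOscL_sub (ζ : ℂ) :
    spinSpinOscL R ζ (q * ζ) * Matrix.scalar (Fin 2) (Matrix.scalar (Fin 2) R.sub) =
      Matrix.scalar (Fin 2) (Matrix.scalar (Fin 2) R.sub) * ((1 - q ^ 4 * ζ ^ 2) •
        (spinOscL R ζ * Matrix.diagonal ![q • 1, 1])) := by
  have h := congrArg (auxIncl (Matrix (Fin 2) (Fin 2) O)) (R.Rsc_L_sub (q * ζ))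
  have hs : auxIncl (Matrix (Fin 2) (Fin 2) O) (Matrix.scalar (Fin 2) R.sub) =
      Matrix.scalar (Fin 2) (Matrix.scalar (Fin 2) R.sub) := by
    ext s t i k j l
    simp only [auxIncl_apply, Matrix.scalar_apply, Matrix.diagonal_apply]
    split_ifs <;> simp [*]
  have hd : auxIncl (Matrix (Fin 2) (Fin 2) O) (Matrix.diagonal ![q • 1, 1]) =
      Matrix.diagonal ![q • 1, 1] := by
    ext s t i k j l
    fin_cases s <;> fin_cases t <;> (simp [auxIncl_apply, Matrix.one_apply]; try (split_ifs <;> simp [*]))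
  have hq : q⁻¹ * (q * ζ) = ζ := by rw [← mul_assoc, inv_mul_cancel₀ R.q_ne_zero, one_mul]
  simp only [map_mul, map_smul, hs, hd, hq] at h
  have hc : Commute (auxLift (Matrix (Fin 2) (Fin 2) O) (Rsc q ζ))
      (Matrix.scalar (Fin 2) (Matrix.scalar (Fin 2) R.sub)) :=
    scalar_commute fun s t => commute_auxLift_scalar _ s t R.sub
  rw [spinSpinOscL, mul_assoc, h, mul_smul_comm, ← mul_assoc, hc.eq, mul_smul_comm, mul_assoc,
    spinOscL, mul_assoc]
  congr 1
  ring

theorem quo_spinSpinOscL (ζ : ℂ) :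
    Matrix.scalar (Fin 2) (Matrix.scalar (Fin 2) R.quo) * spinSpinOscL R ζ (q⁻¹ * ζ) =
      ((1 - q⁻¹ ^ 2 * ζ ^ 2) • (spinOscL R ζ * Matrix.diagonal ![1, q • 1])) *
        Matrix.scalar (Fin 2) (Matrix.scalar (Fin 2) R.quo) := by
  have h := congrArg (auxIncl (Matrix (Fin 2) (Fin 2) O)) (R.quo_Rsc_L (q⁻¹ * ζ))
  have hs : auxIncl (Matrix (Fin 2) (Fin 2) O) (Matrix.scalar (Fin 2) R.quo) =
      Matrix.scalar (Fin 2) (Matrix.scalar (Fin 2) R.quo) := by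
    ext s t i k j l
    simp only [auxIncl_apply, Matrix.scalar_apply, Matrix.diagonal_apply]
    split_ifs <;> simp [*]
  have hd : auxIncl (Matrix (Fin 2) (Fin 2) O) (Matrix.diagonal ![1, q • 1]) =
      Matrix.diagonal ![1, q • 1] := by
    ext s t i k j l
    fin_cases s <;> fin_cases t <;> (simp [auxIncl_apply, Matrix.one_apply]; try (split_ifs <;> simp [*]))
  have hq : q * (q⁻¹ * ζ) = ζ := by rw [← mul_assoc, mul_inv_cancel₀ R.q_ne_zero, one_mul]
  simp only [map_mul, map_smul, hs, hd, hq] at h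
  have hc : Commute (auxLift (Matrix (Fin 2) (Fin 2) O) (Rsc q ζ))
      (Matrix.scalar (Fin 2) (Matrix.scalar (Fin 2) R.quo)) :=
    scalar_commute fun s t => commute_auxLift_scalar _ s t R.quo
  rw [spinSpinOscL, ← mul_assoc, ← hc.eq, mul_assoc, h, mul_smul_comm, smul_mul_assoc, spinOscL]
  simp only [mul_assoc]
  congr 1
  ring

end Core

end

/-! ### Inverses, twists, and the trace of `t* k` at the two shifts -/

section

/-- The inverse of `fused e d₁ d₀ x y`. -/
def fusedInv (e d₁ d₀ x y : ℂ) : AuxMat (Matrix (Fin 2) (Fin 2) ℂ) :=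
  fused e⁻¹ (d₀ / (d₁ * d₀ - x * y)) (d₁ / (d₁ * d₀ - x * y)) (-x / (d₁ * d₀ - x * y))
    (-y / (d₁ * d₀ - x * y))

theorem fused_mul_fusedInv {e d₁ d₀ x y : ℂ} (he : e ≠ 0) (hd : d₁ * d₀ - x * y ≠ 0) :
    fused e d₁ d₀ x y * fusedInv e d₁ d₀ x y = 1 :=
  fused_mul _ _ _ _ _ _ _ _ _ _ (mul_inv_cancel₀ he)
    (by rw [← div_self hd]; ring) (by rw [← div_self hd]; ring) (by ring) (by ring)

theorem fusedInv_mul_fused {e d₁ d₀ x y : ℂ} (he : e ≠ 0) (hd : d₁ * d₀ - x * y ≠ 0) :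
    fusedInv e d₁ d₀ x y * fused e d₁ d₀ x y = 1 :=
  fused_mul _ _ _ _ _ _ _ _ _ _ (inv_mul_cancel₀ he)
    (by rw [← div_self hd]; ring) (by rw [← div_self hd]; ring) (by ring) (by ring)

section

variable {n : ℕ} {O : Type*} [Ring O] [Algebra ℂ O] {q : ℂ} (R : OscAlg O q)

/-- The `L`-operator of the triplet of two auxiliary spins and the oscillator. -/
def tripletL (e d₁ d₀ x y ζ : ℂ) : AuxMat (Matrix (Fin 2) (Fin 2) O) :=
  lift₃ O (fused e d₁ d₀ x y) * auxIncl _ (auxIncl O (R.L ζ))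

/-- The inverse of `tripletL`. -/
def tripletLinv (e d₁ d₀ x y ζ : ℂ) : AuxMat (Matrix (Fin 2) (Fin 2) O) :=
  auxIncl _ (auxIncl O (R.Linv ζ)) * lift₃ O (fusedInv e d₁ d₀ x y)

theorem mul_mul_mul_cancel {M : Type*} [Monoid M] {a a' b b' : M} (ha : a * a' = 1)
    (hb : b * b' = 1) : a * b * (b' * a') = 1 := by
  rw [mul_assoc, ← mul_assoc b, hb, one_mul, ha]

theorem tripletL_mul_tripletLinv {e d₁ d₀ x y ζ : ℂ} (he : e ≠ 0) (hd : d₁ * d₀ - x * y ≠ 0)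
    (hζ : 1 - ζ ^ 2 ≠ 0) :
    tripletL R e d₁ d₀ x y ζ * tripletLinv R e d₁ d₀ x y ζ = 1 := by
  refine mul_mul_mul_cancel ?_ ?_
  · rw [← map_mul, fused_mul_fusedInv he hd, map_one]
  · rw [← map_mul, ← map_mul, R.L_mul_Linv hζ, map_one, map_one]

theorem tripletLinv_mul_tripletL {e d₁ d₀ x y ζ : ℂ} (he : e ≠ 0) (hd : d₁ * d₀ - x * y ≠ 0)
    (hζ : 1 - ζ ^ 2 ≠ 0) :
    tripletLinv R e d₁ d₀ x y ζ * tripletL R e d₁ d₀ x y ζ = 1 := by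
  refine mul_mul_mul_cancel ?_ ?_
  · rw [← map_mul, ← map_mul, R.Linv_mul_L hζ, map_one, map_one]
  · rw [← map_mul, fusedInv_mul_fused he hd, map_one]

theorem spinOscL_mul_spinOscLinv {ζ : ℂ} (h₁ : 1 - q ^ 2 * ζ ^ 2 ≠ 0) (h₂ : q ^ 2 - ζ ^ 2 ≠ 0)
    (h₃ : 1 - ζ ^ 2 ≠ 0) : spinOscL R ζ * spinOscLinv R ζ = 1 := by
  refine mul_mul_mul_cancel ?_ ?_
  · rw [← map_mul, Rsc_mul_Rinv h₁ h₂, map_one]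
  · rw [← map_mul, ← map_mul, R.L_mul_Linv h₃, map_one, map_one]

theorem spinOscLinv_mul_spinOscL {ζ : ℂ} (h₁ : 1 - q ^ 2 * ζ ^ 2 ≠ 0) (h₂ : q ^ 2 - ζ ^ 2 ≠ 0)
    (h₃ : 1 - ζ ^ 2 ≠ 0) : spinOscLinv R ζ * spinOscL R ζ = 1 := by
  refine mul_mul_mul_cancel ?_ ?_
  · rw [← map_mul, ← map_mul, R.Linv_mul_L h₃, map_one, map_one]
  · rw [← map_mul, Rinv_mul_Rsc h₁ h₂, map_one]

theorem spinSpinOscL_mul_inv {ζ ζ' : ℂ} (h₁ : 1 - q ^ 2 * ζ ^ 2 ≠ 0) (h₂ : q ^ 2 - ζ ^ 2 ≠ 0)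
    (h₃ : 1 - q ^ 2 * ζ' ^ 2 ≠ 0) (h₄ : q ^ 2 - ζ' ^ 2 ≠ 0) (h₅ : 1 - ζ' ^ 2 ≠ 0) :
    spinSpinOscL R ζ ζ' * spinSpinOscLinv R ζ ζ' = 1 := by
  refine mul_mul_mul_cancel ?_ (mul_mul_mul_cancel ?_ ?_)
  · rw [← map_mul, Rsc_mul_Rinv h₁ h₂, map_one]
  · rw [← map_mul, ← map_mul, Rsc_mul_Rinv h₃ h₄, map_one, map_one]
  · rw [← map_mul, ← map_mul, R.L_mul_Linv h₅, map_one, map_one]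

theorem spinSpinOscL_inv_mul {ζ ζ' : ℂ} (h₁ : 1 - q ^ 2 * ζ ^ 2 ≠ 0) (h₂ : q ^ 2 - ζ ^ 2 ≠ 0)
    (h₃ : 1 - q ^ 2 * ζ' ^ 2 ≠ 0) (h₄ : q ^ 2 - ζ' ^ 2 ≠ 0) (h₅ : 1 - ζ' ^ 2 ≠ 0) :
    spinSpinOscLinv R ζ ζ' * spinSpinOscL R ζ ζ' = 1 := by
  refine mul_mul_mul_cancel (mul_mul_mul_cancel ?_ ?_) ?_
  · rw [← map_mul, ← map_mul, R.Linv_mul_L h₅, map_one, map_one]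
  · rw [← map_mul, ← map_mul, Rinv_mul_Rsc h₃ h₄, map_one, map_one]
  · rw [← map_mul, Rinv_mul_Rsc h₁ h₂, map_one]

/-! ### The twist -/

/-- The twist of two auxiliary spins and the oscillator. -/
def twist (D D' : Fin 2 → ℂ) (t : O) : Matrix (Fin 2) (Fin 2) (Matrix (Fin 2) (Fin 2) O) :=
  Matrix.diagonal fun b => Matrix.diagonal fun a => (D b * D' a) • t

theorem dress_dress_oscInit (D D' : Fin 2 → ℂ) (t : O) (X : Op n) :
    dress D (dress D' (oscInit t X)) = Matrix.of fun x y => X x y • twist D D' t := by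
  ext x y b b' a a'
  simp only [dress, oscInit, twist, Matrix.of_apply, Matrix.smul_apply, Matrix.diagonal_apply]
  split_ifs
  · simp only [Matrix.smul_apply, Matrix.diagonal_apply]
    split_ifs
    · simp only [smul_smul]; congr 1; ring
    · simp
  · simp

theorem dress_mul_scalar {D₁ D₂ D₁' D₂' : Fin 2 → ℂ} {t : O} (X : Op n) {c : ℂ}
    {p : Matrix (Fin 2) (Fin 2) (Matrix (Fin 2) (Fin 2) O)}
    (h : twist D₁ D₂ t * p = p * (c • twist D₁' D₂' t)) :
    dress D₁ (dress D₂ (oscInit t X)) * Matrix.scalar (Conf n) p =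
      Matrix.scalar (Conf n) p * (c • dress D₁' (dress D₂' (oscInit t X))) := by
  rw [dress_dress_oscInit, dress_dress_oscInit]
  refine Matrix.ext fun x y => ?_
  rw [Matrix.scalar_apply, Matrix.mul_diagonal, Matrix.diagonal_mul, Matrix.smul_apply,
    Matrix.of_apply, Matrix.of_apply, smul_mul_assoc, h, smul_comm c, ← mul_smul_comm]

theorem scalar_mul_dress {D₁ D₂ D₁' D₂' : Fin 2 → ℂ} {t : O} (X : Op n) {c : ℂ}
    {p : Matrix (Fin 2) (Fin 2) (Matrix (Fin 2) (Fin 2) O)}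
    (h : p * twist D₁ D₂ t = (c • twist D₁' D₂' t) * p) :
    Matrix.scalar (Conf n) p * dress D₁ (dress D₂ (oscInit t X)) =
      (c • dress D₁' (dress D₂' (oscInit t X))) * Matrix.scalar (Conf n) p := by
  rw [dress_dress_oscInit, dress_dress_oscInit]
  refine Matrix.ext fun x y => ?_
  rw [Matrix.scalar_apply, Matrix.mul_diagonal, Matrix.diagonal_mul, Matrix.smul_apply,
    Matrix.of_apply, Matrix.of_apply, mul_smul_comm, h, smul_comm c, ← smul_mul_assoc]

theorem twist_triplet (D : Fin 2 → ℂ) (t : O) :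
    twist D D t * lift₂ O triplet = lift₂ O triplet * ((1 : ℂ) • twist D D t) := by
  ext b b' a a'
  fin_cases b <;> fin_cases b' <;> fin_cases a <;> fin_cases a' <;>
    simp [twist, triplet, lift₂, Matrix.mul_apply, Fin.sum_univ_two, mul_comm (D 0)]

theorem triplet'_twist (D : Fin 2 → ℂ) (t : O) :
    lift₂ O triplet' * twist D D t = ((1 : ℂ) • twist D D t) * lift₂ O triplet' := by
  ext b b' a a'
  fin_cases b <;> fin_cases b' <;> fin_cases a <;> fin_cases a' <;>
    simp [twist, triplet', lift₂, Matrix.mul_apply, Fin.sum_univ_two, mul_comm (D 0)]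

/-- The annihilation operator changes `D_A` by one unit and the spin of `a` flips along the column
`(a, -1)`; by `ht` the two effects on the twist compensate, so the twist of `a` reduces to the
scalar `D 1`. -/
theorem twist_sub {D : Fin 2 → ℂ} {t : O} (ht : D 0 • (t * R.A) = D 1 • (R.A * t)) :
    twist D D t * Matrix.scalar (Fin 2) R.sub =
      Matrix.scalar (Fin 2) R.sub * (D 1 • twist D ![1, 1] t) := by
  ext b b' a a'
  fin_cases b <;> fin_cases b' <;> fin_cases a <;> fin_cases a' <;>
    simp [twist, OscAlg.sub, Matrix.mul_apply, Fin.sum_univ_two, mul_smul, ht, smul_comm (D 1),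
      Matrix.vecMul_diagonal] <;>
    rw [smul_comm (D 0), ht]

theorem quo_twist {D : Fin 2 → ℂ} {t : O} (ht : D 0 • (t * R.A) = D 1 • (R.A * t)) :
    Matrix.scalar (Fin 2) R.quo * twist D D t =
      (D 0 • twist D ![1, 1] t) * Matrix.scalar (Fin 2) R.quo := by
  ext b b' a a'
  fin_cases b <;> fin_cases b' <;> fin_cases a <;> fin_cases a' <;>
    simp [twist, OscAlg.quo, Matrix.mul_apply, Fin.sum_univ_two, mul_smul, ← ht, smul_comm (D 1),
      Matrix.vecMul_diagonal]

theorem locFold_diagonal_oscInit {F : Type*} [Ring F] [Algebra ℂ F] {f g : Fin 2 → ℂ} {σ : ℂ}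
    {X : Op n} (hX : ∀ x y, ((∏ j, f (x j)) * ∏ j, g (y j)) * X x y = σ * X x y) (w : F) :
    locFold (Matrix.diagonal fun i => f i • 1) (Matrix.diagonal fun i => g i • 1)
      (Matrix.of fun x y => X x y • w) = σ • Matrix.of fun x y => X x y • w := by
  rw [locFold_diagonal]
  refine Matrix.ext fun x y => ?_
  rw [Matrix.of_apply, Matrix.smul_apply, Matrix.of_apply, smul_smul, hX, mul_smul]

/-- The conjugation by a monodromy matrix with diagonal local factors. -/
theorem locFold_spinOscL_diagonal {c σ d : ℂ} (hc : c ≠ 0) {f g : Fin 2 → ℂ} {X : Op n}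
    (hX : ∀ x y, ((∏ j, f (x j)) * ∏ j, g (y j)) * X x y = σ * X x y) (t : O) (D : Fin 2 → ℂ)
    (ζ : ℂ) :
    locFold (c • (spinOscL R ζ * Matrix.diagonal fun i => f i • 1))
        (c⁻¹ • ((Matrix.diagonal fun i => g i • 1) * spinOscLinv R ζ))
        (d • dress D (dress ![1, 1] (oscInit t X))) = (d * σ) • spinOscMonodromy' R t D ζ X := by
  rw [locFold_smul_smul, mul_inv_cancel₀ hc, one_pow, one_smul, locFold_smul, locFold_mul,
    dress_dress_oscInit, locFold_diagonal_oscInit hX, locFold_smul, smul_smul, ← dress_dress_oscInit,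
    spinOscMonodromy']
  · intro s s' t t'
    rw [Matrix.diagonal_apply]
    split_ifs
    · exact (Commute.one_right _).smul_right _
    · exact Commute.zero_right _
  · intro s s' t t'
    rw [Matrix.diagonal_apply]
    split_ifs
    · exact (Commute.one_right _).smul_right _
    · exact Commute.zero_right _

theorem diagonal_smul_one_mul {f g : Fin 2 → ℂ} (h : ∀ i, f i * g i = 1) {F : Type*} [Ring F]
    [Algebra ℂ F] : (Matrix.diagonal fun i => f i • (1 : F)) * (Matrix.diagonal fun i => g i • 1) =
      1 := by
  rw [Matrix.diagonal_mul_diagonal, ← Matrix.diagonal_one]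
  congr 1
  funext i
  rw [smul_mul_smul_comm, h, one_smul, one_mul]

/-- The trace over `b` consists of two diagonal entries. The triplet determines one of them, but of
the other only its sum with an off-diagonal entry; the invariant column `(a, -1)` supplies the
latter. Only linearity of `φ` enters, no cyclicity of the trace. -/
theorem trace_plus {ζ σ : ℂ} (h₁ : 1 - q ^ 2 * ζ ^ 2 ≠ 0) (h₂ : q ^ 2 - ζ ^ 2 ≠ 0)
    (h₃ : 1 - q ^ 2 * (q * ζ) ^ 2 ≠ 0) (h₄ : 1 - ζ ^ 2 ≠ 0) (t : O) (D : Fin 2 → ℂ)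
    (ht : D 0 • (t * R.A) = D 1 • (R.A * t)) {X : Op n}
    (hX : ∀ x y, ((∏ j, ![q, 1] (x j)) * ∏ j, ![q⁻¹, 1] (y j)) * X x y = σ * X x y)
    (φ : O →ₗ[ℂ] ℂ) (x y : Conf n) (N : Matrix (Conf n) (Conf n) _)
    (hN : N = locFold
      (tripletL R (1 - q ^ 4 * ζ ^ 2) (q ^ 2 * (1 - ζ ^ 2)) (q * (1 - q ^ 2 * ζ ^ 2))
        ((1 - q ^ 2) * q * ζ) ((1 - q ^ 4) * ζ) (q * ζ))
      (tripletLinv R (1 - q ^ 4 * ζ ^ 2) (q ^ 2 * (1 - ζ ^ 2)) (q * (1 - q ^ 2 * ζ ^ 2))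
        ((1 - q ^ 2) * q * ζ) ((1 - q ^ 4) * ζ) (q * ζ)) (dress D (dress D (oscInit t X)))) :
    ∑ b, φ (spinSpinOscMonodromy R t D ζ (q * ζ) X x y b b 1 0) =
      φ (N x y 1 0 0 0) + φ (N x y 1 1 1 0) - φ (N x y 1 0 1 0 * R.A) -
        D 1 * σ * φ (spinOscMonodromy' R t D ζ X x y 1 0 0 0) := by
  have hq := R.q_ne_zero
  have h₅ : q ^ 2 - (q * ζ) ^ 2 ≠ 0 := by
    rw [show q ^ 2 - (q * ζ) ^ 2 = q ^ 2 * (1 - ζ ^ 2) by ring]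
    exact mul_ne_zero (pow_ne_zero 2 hq) h₄
  have h₆ : 1 - (q * ζ) ^ 2 ≠ 0 := by rw [mul_pow]; exact h₁
  have h₇ : 1 - q ^ 4 * ζ ^ 2 ≠ 0 := by
    rw [show 1 - q ^ 4 * ζ ^ 2 = 1 - q ^ 2 * (q * ζ) ^ 2 by ring]; exact h₃
  -- The determinant of the `2 × 2` block of the triplet operator. It does not contain the factor `1
  -- - ζ²`, and this makes the triplet part regular at `ζ² = 1`.
  have hΔ : q ^ 2 * (1 - ζ ^ 2) * (q * (1 - q ^ 2 * ζ ^ 2)) -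
      (1 - q ^ 2) * q * ζ * ((1 - q ^ 4) * ζ) ≠ 0 := by
    rw [show q ^ 2 * (1 - ζ ^ 2) * (q * (1 - q ^ 2 * ζ ^ 2)) -
      (1 - q ^ 2) * q * ζ * ((1 - q ^ 4) * ζ) = q * (q ^ 2 - ζ ^ 2) * (1 - q ^ 4 * ζ ^ 2) by ring]
    exact mul_ne_zero (mul_ne_zero hq h₂) h₇
  have hinv := spinSpinOscL_inv_mul R h₁ h₂ h₃ h₅ h₆
  -- the triplet is invariant
  have hP := locFold_mul_right (n := n) (Y := dress D (dress D (oscInit t X)))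
    (Z := (1 : ℂ) • dress D (dress D (oscInit t X)))
    (b' := (1 - q ^ 2 * ζ ^ 2)⁻¹ • tripletLinv R (1 - q ^ 4 * ζ ^ 2) (q ^ 2 * (1 - ζ ^ 2))
      (q * (1 - q ^ 2 * ζ ^ 2)) ((1 - q ^ 2) * q * ζ) ((1 - q ^ 4) * ζ) (q * ζ))
    (fusedL_triplet R ζ) hinv
    (by rw [smul_mul_smul_comm, mul_inv_cancel₀ h₁, one_smul]
        exact tripletL_mul_tripletLinv R h₇ hΔ h₆) (dress_mul_scalar X (twist_triplet D t))
  rw [locFold_smul_smul, mul_inv_cancel₀ h₁, one_pow, one_smul, one_smul] at hP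
  change _ = _ * locFold (tripletL R _ _ _ _ _ _) _ _ at hP
  rw [← hN, ← spinSpinOscMonodromy] at hP
  -- an invariant subspace of the oscillator module and one spin
  have hd : (Matrix.diagonal ![q • 1, 1] : AuxMat (Matrix (Fin 2) (Fin 2) O)) =
      Matrix.diagonal fun i => ![q, 1] i • 1 := by
    congr 1; funext i; fin_cases i <;> simp
  have hK' := spinSpinOscL_sub R ζ
  rw [hd] at hK'
  have hK := locFold_mul_right (n := n) (Y := dress D (dress D (oscInit t X)))
    (b' := (1 - q ^ 4 * ζ ^ 2)⁻¹ • ((Matrix.diagonal fun i => ![q⁻¹, 1] i • 1) * spinOscLinv R ζ))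
    hK' hinv
    (by rw [smul_mul_smul_comm, mul_inv_cancel₀ h₇, one_smul]
        exact mul_mul_mul_cancel (spinOscL_mul_spinOscLinv R h₁ h₂ h₄)
          (diagonal_smul_one_mul fun i => by fin_cases i <;> simp [hq]))
    (dress_mul_scalar X (twist_sub R ht))
  rw [locFold_spinOscL_diagonal R h₇ hX, ← spinSpinOscMonodromy] at hK
  set W := spinSpinOscMonodromy R t D ζ (q * ζ) X
  set U := spinOscMonodromy' R t D ζ X
  have eP : ∀ b b' a a', (W x y * lift₂ O triplet) b b' a a' = (lift₂ O triplet * N x y) b b' a a' := by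
    intro b b' a a'
    have := congrFun (congrFun hP x) y
    rw [Matrix.scalar_apply, Matrix.mul_diagonal, Matrix.diagonal_mul] at this
    rw [this]
  have eK : (W x y * Matrix.scalar (Fin 2) R.sub) 1 0 1 0 =
      (Matrix.scalar (Fin 2) R.sub * ((D 1 * σ) • U x y)) 1 0 1 0 := by
    have := congrFun (congrFun hK x) y
    rw [Matrix.scalar_apply, Matrix.mul_diagonal, Matrix.diagonal_mul, Matrix.smul_apply] at this
    rw [this]
  have e1 := eP 0 0 1 0
  have e2 := eP 1 1 1 0
  have e3 := eP 1 0 1 0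
  simp [triplet, lift₂, Matrix.mul_apply, Fin.sum_univ_two] at e1 e2 e3
  simp [OscAlg.sub, Matrix.mul_apply, Fin.sum_univ_two, Matrix.vecMul, dotProduct] at eK
  -- The off-diagonal entry that the triplet leaves undetermined.
  have e4 : W x y 1 0 1 1 = N x y 1 0 1 0 * R.A + (D 1 * σ) • U x y 1 0 0 0 := by
    rw [← e3]
    have := congrArg (fun z => W x y 1 0 1 0 * R.A - z) eK
    simp only [sub_add_cancel_left, neg_neg] at this
    rw [this, sub_neg_eq_add]
  have e5 : W x y 1 1 1 0 = N x y 1 1 1 0 - W x y 1 0 1 1 := by rw [← e2, add_sub_cancel_left]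
  rw [Fin.sum_univ_two, e1, e5, e4, map_sub, map_add, map_smul, smul_eq_mul]
  ring

/-- Mirror image of `trace_plus`, with quotients for subspaces. The same matrix element of
`spinOscMonodromy'` at the same `ζ` appears, now with the factor `D 0`. -/
theorem trace_minus {ζ σ : ℂ} (h₁ : 1 - q ^ 2 * ζ ^ 2 ≠ 0) (h₂ : q ^ 2 - ζ ^ 2 ≠ 0)
    (h₃ : q ^ 2 - (q⁻¹ * ζ) ^ 2 ≠ 0) (h₄ : 1 - ζ ^ 2 ≠ 0) (t : O) (D : Fin 2 → ℂ)
    (ht : D 0 • (t * R.A) = D 1 • (R.A * t)) {X : Op n}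
    (hX : ∀ x y, ((∏ j, ![1, q] (x j)) * ∏ j, ![1, q⁻¹] (y j)) * X x y = σ * X x y)
    (φ : O →ₗ[ℂ] ℂ) (x y : Conf n) (N : Matrix (Conf n) (Conf n) _)
    (hN : N = locFold
      (tripletL R (1 - q ^ 2 * ζ ^ 2) (q ^ 2 - ζ ^ 2) (q * (1 - ζ ^ 2))
        (q⁻¹ * (1 - q ^ 4) * ζ) ((1 - q ^ 2) * ζ) (q⁻¹ * ζ))
      (tripletLinv R (1 - q ^ 2 * ζ ^ 2) (q ^ 2 - ζ ^ 2) (q * (1 - ζ ^ 2))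
        (q⁻¹ * (1 - q ^ 4) * ζ) ((1 - q ^ 2) * ζ) (q⁻¹ * ζ)) (dress D (dress D (oscInit t X)))) :
    ∑ b, φ (spinSpinOscMonodromy R t D ζ (q⁻¹ * ζ) X x y b b 1 0) =
      φ (N x y 1 0 0 0) + φ (N x y 1 1 1 0) + φ (R.A * N x y 1 0 1 0) -
        D 0 * σ * φ (spinOscMonodromy' R t D ζ X x y 1 0 0 0) := by
  have hq := R.q_ne_zero
  have h₅ : 1 - q ^ 2 * (q⁻¹ * ζ) ^ 2 ≠ 0 := by
    rw [show 1 - q ^ 2 * (q⁻¹ * ζ) ^ 2 = 1 - ζ ^ 2 by field_simp]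
    exact h₄
  have h₆ : 1 - (q⁻¹ * ζ) ^ 2 ≠ 0 := by
    rw [show 1 - (q⁻¹ * ζ) ^ 2 = (q ^ 2)⁻¹ * (q ^ 2 - ζ ^ 2) by field_simp]
    exact mul_ne_zero (inv_ne_zero (pow_ne_zero 2 hq)) h₂
  have h₆' : 1 - q⁻¹ ^ 2 * ζ ^ 2 ≠ 0 := by rw [← mul_pow]; exact h₆
  have hΔ : (q ^ 2 - ζ ^ 2) * (q * (1 - ζ ^ 2)) -
      q⁻¹ * (1 - q ^ 4) * ζ * ((1 - q ^ 2) * ζ) ≠ 0 := by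
    rw [show (q ^ 2 - ζ ^ 2) * (q * (1 - ζ ^ 2)) -
      q⁻¹ * (1 - q ^ 4) * ζ * ((1 - q ^ 2) * ζ) =
        q * (q ^ 2 - (q⁻¹ * ζ) ^ 2) * (1 - q ^ 2 * ζ ^ 2) by field_simp; ring]
    exact mul_ne_zero (mul_ne_zero hq h₃) h₁
  have hinv := spinSpinOscL_mul_inv R h₁ h₂ h₅ h₃ h₆
  have hP := locFold_mul_left (n := n) (Y := dress D (dress D (oscInit t X)))
    (Z := (1 : ℂ) • dress D (dress D (oscInit t X)))
    (b' := (1 - ζ ^ 2)⁻¹ • tripletLinv R (1 - q ^ 2 * ζ ^ 2) (q ^ 2 - ζ ^ 2) (q * (1 - ζ ^ 2))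
        (q⁻¹ * (1 - q ^ 4) * ζ) ((1 - q ^ 2) * ζ) (q⁻¹ * ζ))
    (triplet'_fusedL R ζ) hinv
    (by rw [smul_mul_smul_comm, inv_mul_cancel₀ h₄, one_smul]
        exact tripletLinv_mul_tripletL R h₁ hΔ h₆) (scalar_mul_dress X (triplet'_twist D t))
  rw [locFold_smul_smul, mul_inv_cancel₀ h₄, one_pow, one_smul, one_smul] at hP
  change _ = locFold (tripletL R _ _ _ _ _ _) _ _ * _ at hP
  rw [← hN, ← spinSpinOscMonodromy] at hP
  have hd : (Matrix.diagonal ![1, q • 1] : AuxMat (Matrix (Fin 2) (Fin 2) O)) =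
      Matrix.diagonal fun i => ![1, q] i • 1 := by
    congr 1; funext i; fin_cases i <;> simp
  have hK' := quo_spinSpinOscL R ζ
  rw [hd] at hK'
  have hK := locFold_mul_left (n := n) (Y := dress D (dress D (oscInit t X)))
    (b' := (1 - q⁻¹ ^ 2 * ζ ^ 2)⁻¹ •
      ((Matrix.diagonal fun i => ![1, q⁻¹] i • 1) * spinOscLinv R ζ))
    hK' hinv
    (by rw [smul_mul_smul_comm, inv_mul_cancel₀ h₆', one_smul]
        exact mul_mul_mul_cancel (diagonal_smul_one_mul fun i => by fin_cases i <;> simp [hq])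
          (spinOscLinv_mul_spinOscL R h₁ h₂ h₄))
    (scalar_mul_dress X (quo_twist R ht))
  rw [locFold_spinOscL_diagonal R h₆' hX, ← spinSpinOscMonodromy] at hK
  set W := spinSpinOscMonodromy R t D ζ (q⁻¹ * ζ) X
  set U := spinOscMonodromy' R t D ζ X
  have eP : ∀ b b' a a', (lift₂ O triplet' * W x y) b b' a a' = (N x y * lift₂ O triplet') b b' a a' := by
    intro b b' a a'
    have := congrFun (congrFun hP x) y
    rw [Matrix.scalar_apply, Matrix.mul_diagonal, Matrix.diagonal_mul] at this
    rw [this]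
  -- The quotient by the column `(a, -1)` expresses an entry off-diagonal in `b` through the
  -- monodromy of `b` and the oscillator.
  have eK : (Matrix.scalar (Fin 2) R.quo * W x y) 1 0 0 0 =
      (((D 0 * σ) • U x y) * Matrix.scalar (Fin 2) R.quo) 1 0 0 0 := by
    have := congrFun (congrFun hK x) y
    rw [Matrix.scalar_apply, Matrix.mul_diagonal, Matrix.diagonal_mul, Matrix.smul_apply] at this
    rw [this]
  have e1 := eP 1 0 0 0
  have e2 := eP 1 1 1 0
  have e3 := eP 1 0 1 0
  simp [triplet', lift₂, Matrix.mul_apply, Fin.sum_univ_two] at e1 e2 e3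
  simp [OscAlg.quo, Matrix.mul_apply, Fin.sum_univ_two, Matrix.vecMul, dotProduct] at eK
  have e4 : W x y 1 0 0 0 = (D 0 * σ) • U x y 1 0 0 0 - R.A * N x y 1 0 1 0 := by
    rw [← e3, ← eK, add_sub_cancel_right]
  have e5 : W x y 0 0 1 0 = N x y 1 0 0 0 - W x y 1 0 0 0 := by rw [← e1, add_sub_cancel_right]
  rw [Fin.sum_univ_two, e2, e5, e4, map_sub, map_sub, map_smul, smul_eq_mul]
  ring

end

end

section

/-! ### Analytic families in an algebra -/

section Regular

variable {u₀ : ℂ} {E E' : Type*}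

/-- The functions `∑ i, g i u • x i` (finite sums) with coefficients analytic at `u₀`. -/
def regular (u₀ : ℂ) (E : Type*) [AddCommGroup E] [Module ℂ E] : Submodule ℂ (ℂ → E) :=
  Submodule.span ℂ {F | ∃ g : ℂ → ℂ, ∃ x : E, AnalyticAt ℂ g u₀ ∧ F = fun u => g u • x}

theorem smul_mem_regular [AddCommGroup E] [Module ℂ E] {g : ℂ → ℂ} (hg : AnalyticAt ℂ g u₀) (x : E) :
    (fun u => g u • x) ∈ regular u₀ E :=
  Submodule.subset_span ⟨g, x, hg, rfl⟩

theorem const_mem_regular [AddCommGroup E] [Module ℂ E] (x : E) :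
    (fun _ => x) ∈ regular u₀ E := by
  simpa using smul_mem_regular (analyticAt_const (v := (1 : ℂ))) x

theorem add_mem_regular [AddCommGroup E] [Module ℂ E] {F G : ℂ → E} (hF : F ∈ regular u₀ E)
    (hG : G ∈ regular u₀ E) : (fun u => F u + G u) ∈ regular u₀ E :=
  Submodule.add_mem _ hF hG

theorem const_smul_mem_regular [AddCommGroup E] [Module ℂ E] (c : ℂ) {F : ℂ → E}
    (hF : F ∈ regular u₀ E) : (fun u => c • F u) ∈ regular u₀ E :=
  Submodule.smul_mem _ c hF

theorem smul_fun_mem_regular [AddCommGroup E] [Module ℂ E] {g : ℂ → ℂ} {F : ℂ → E}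
    (hg : AnalyticAt ℂ g u₀) (hF : F ∈ regular u₀ E) : (fun u => g u • F u) ∈ regular u₀ E := by
  refine Submodule.span_induction (p := fun F _ => (fun u => g u • F u) ∈ regular u₀ E) ?_ ?_ ?_ ?_ hF
  · rintro _ ⟨h, x, hh, rfl⟩
    simp only [smul_smul]
    exact smul_mem_regular (hg.mul hh) x
  · simpa using const_mem_regular (u₀ := u₀) (0 : E)
  · intro F G _ _ h₁ h₂
    simpa using add_mem_regular h₁ h₂
  · intro c F _ h
    simpa only [Pi.smul_apply, smul_comm (g _) c] using const_smul_mem_regular c h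

/-- `regular` needs no topology on the oscillator algebra: linear maps act on the vectors and leave
the analytic coefficients alone. In the end a linear form to `ℂ` turns membership into genuine
analyticity. -/
theorem map_mem_regular [AddCommGroup E] [Module ℂ E] [AddCommGroup E'] [Module ℂ E']
    (φ : E →ₗ[ℂ] E') {F : ℂ → E} (hF : F ∈ regular u₀ E) : (fun u => φ (F u)) ∈ regular u₀ E' := by
  refine Submodule.span_induction (p := fun F _ => (fun u => φ (F u)) ∈ regular u₀ E') ?_ ?_ ?_ ?_ hF
  · rintro _ ⟨h, x, hh, rfl⟩
    simp only [map_smul]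
    exact smul_mem_regular hh _
  · simpa using const_mem_regular (u₀ := u₀) (0 : E')
  · intro F G _ _ h₁ h₂
    simpa using add_mem_regular h₁ h₂
  · intro c F _ h
    simpa using const_smul_mem_regular c h

theorem analyticAt_of_mem_regular {F : ℂ → ℂ} (hF : F ∈ regular u₀ ℂ) : AnalyticAt ℂ F u₀ := by
  refine Submodule.span_induction (p := fun F _ => AnalyticAt ℂ F u₀) ?_ ?_ ?_ ?_ hF
  · rintro _ ⟨h, x, hh, rfl⟩
    exact hh.smul analyticAt_const
  · exact analyticAt_const
  · exact fun F G _ _ h₁ h₂ => h₁.add h₂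
  · exact fun c F _ h => analyticAt_const.smul h

theorem mul_mem_regular [Ring E] [Algebra ℂ E] {F G : ℂ → E} (hF : F ∈ regular u₀ E)
    (hG : G ∈ regular u₀ E) : (fun u => F u * G u) ∈ regular u₀ E := by
  refine Submodule.span_induction (p := fun F _ => (fun u => F u * G u) ∈ regular u₀ E) ?_ ?_ ?_ ?_ hF
  · rintro _ ⟨h, x, hh, rfl⟩
    simp only [smul_mul_assoc]
    exact smul_fun_mem_regular hh (map_mem_regular (LinearMap.mulLeft ℂ x) hG)
  · simpa using const_mem_regular (u₀ := u₀) (0 : E)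
  · intro F F' _ _ h₁ h₂
    simpa [add_mul] using add_mem_regular h₁ h₂
  · intro c F _ h
    simpa using const_smul_mem_regular c h

theorem matrix_mem_regular {ι : Type*} [Fintype ι] [DecidableEq ι] [AddCommGroup E] [Module ℂ E]
    {F : ℂ → Matrix ι ι E} (h : ∀ i j, (fun u => F u i j) ∈ regular u₀ E) :
    F ∈ regular u₀ (Matrix ι ι E) := by
  have e : F = ∑ i, ∑ j, fun u => Matrix.singleLinearMap ℂ i j (F u i j) := by
    funext u
    simp only [Finset.sum_apply]
    exact Matrix.matrix_eq_sum_single (F u)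
  rw [e]
  exact Submodule.sum_mem _ fun i _ => Submodule.sum_mem _ fun j _ => map_mem_regular _ (h i j)

theorem fin_two_mem_regular [AddCommGroup E] [Module ℂ E] {a b c d : ℂ → E}
    (ha : a ∈ regular u₀ E) (hb : b ∈ regular u₀ E) (hc : c ∈ regular u₀ E)
    (hd : d ∈ regular u₀ E) : (fun u => !![a u, b u; c u, d u]) ∈ regular u₀ _ := by
  refine matrix_mem_regular fun i j => ?_
  fin_cases i <;> fin_cases j
  exacts [ha, hb, hc, hd]

theorem scalar_mem_regular {g : ℂ → ℂ} (hg : AnalyticAt ℂ g u₀) :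
    (fun u => g u) ∈ regular u₀ ℂ := by
  simpa using smul_mem_regular hg (1 : ℂ)

theorem apply_mem_regular {ι : Type*} [AddCommGroup E] [Module ℂ E]
    {F : ℂ → Matrix ι ι E} (hF : F ∈ regular u₀ (Matrix ι ι E)) (i j : ι) :
    (fun u => F u i j) ∈ regular u₀ E :=
  map_mem_regular (Matrix.entryLinearMap ℂ E i j) hF

/-- `loc j` as a linear map. -/
def locLin {n : ℕ} (E : Type*) [Ring E] [Algebra ℂ E] (j : Fin n) :
    Matrix (Fin 2) (Fin 2) E →ₗ[ℂ] Matrix (Conf n) (Conf n) E where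
  toFun := loc j
  map_add' := loc_add j
  map_smul' := loc_smul j

theorem locFold_mem_regular {n : ℕ} [Ring E] [Algebra ℂ E] {a a' : ℂ → Matrix (Fin 2) (Fin 2) E}
    {Y : ℂ → Matrix (Conf n) (Conf n) E} (ha : a ∈ regular u₀ _) (ha' : a' ∈ regular u₀ _)
    (hY : Y ∈ regular u₀ _) : (fun u => locFold (a u) (a' u) (Y u)) ∈ regular u₀ _ := by
  unfold locFold conjFold
  generalize List.finRange n = l
  induction l generalizing Y with
  | nil => exact hY
  | cons j l ih =>
    exact ih (mul_mem_regular (mul_mem_regular (map_mem_regular (locLin E j) ha) hY)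
      (map_mem_regular (locLin E j) ha'))

theorem sixVertex_mem_regular {a b c : ℂ → ℂ} (ha : AnalyticAt ℂ a u₀) (hb : AnalyticAt ℂ b u₀)
    (hc : AnalyticAt ℂ c u₀) : (fun u => sixVertex (a u) (b u) (c u)) ∈ regular u₀ _ := by
  have ha' := scalar_mem_regular ha
  have hb' := scalar_mem_regular hb
  have hc' := scalar_mem_regular hc
  unfold sixVertex
  repeat first | exact const_mem_regular _ | assumption | refine fin_two_mem_regular ?_ ?_ ?_ ?_

theorem fused_mem_regular {e d₁ d₀ x y : ℂ → ℂ} (he : AnalyticAt ℂ e u₀) (hd₁ : AnalyticAt ℂ d₁ u₀)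
    (hd₀ : AnalyticAt ℂ d₀ u₀) (hx : AnalyticAt ℂ x u₀) (hy : AnalyticAt ℂ y u₀) :
    (fun u => fused (e u) (d₁ u) (d₀ u) (x u) (y u)) ∈ regular u₀ _ := by
  have he' := scalar_mem_regular he
  have hd₁' := scalar_mem_regular hd₁
  have hd₀' := scalar_mem_regular hd₀
  have hx' := scalar_mem_regular hx
  have hy' := scalar_mem_regular hy
  unfold fused
  repeat first | exact const_mem_regular _ | assumption | refine fin_two_mem_regular ?_ ?_ ?_ ?_

theorem fusedInv_mem_regular {e d₁ d₀ x y : ℂ → ℂ} (he : AnalyticAt ℂ e u₀)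
    (hd₁ : AnalyticAt ℂ d₁ u₀) (hd₀ : AnalyticAt ℂ d₀ u₀) (hx : AnalyticAt ℂ x u₀)
    (hy : AnalyticAt ℂ y u₀) (h : e u₀ ≠ 0) (hΔ : d₁ u₀ * d₀ u₀ - x u₀ * y u₀ ≠ 0) :
    (fun u => fusedInv (e u) (d₁ u) (d₀ u) (x u) (y u)) ∈ regular u₀ _ :=
  fused_mem_regular (he.inv h) (hd₀.div ((hd₁.mul hd₀).sub (hx.mul hy)) hΔ)
    (hd₁.div ((hd₁.mul hd₀).sub (hx.mul hy)) hΔ) (hx.neg.div ((hd₁.mul hd₀).sub (hx.mul hy)) hΔ)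
    (hy.neg.div ((hd₁.mul hd₀).sub (hx.mul hy)) hΔ)

variable {n : ℕ} {O : Type*} [Ring O] [Algebra ℂ O] {q : ℂ} (R : OscAlg O q)

theorem L_mem_regular {ζ : ℂ → ℂ} (hζ : AnalyticAt ℂ ζ u₀) :
    (fun u => R.L (ζ u)) ∈ regular u₀ _ := by
  have e : (fun u => R.L (ζ u)) = fun u => !![R.d', 0; 0, R.d] +
      (ζ u) ^ 2 • !![-(q ^ 2 • R.d), 0; 0, 0] + ζ u • !![0, -(R.A * R.d); -(R.C * R.d'), 0] := by
    funext u
    ext s t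
    fin_cases s <;> fin_cases t <;> simp [OscAlg.L, sub_eq_add_neg, smul_smul]
  rw [e]
  exact add_mem_regular (add_mem_regular (const_mem_regular _) (smul_mem_regular (hζ.pow 2) _))
    (smul_mem_regular hζ _)

theorem Linv_mem_regular {ζ : ℂ → ℂ} (hζ : AnalyticAt ℂ ζ u₀) (h : 1 - ζ u₀ ^ 2 ≠ 0) :
    (fun u => R.Linv (ζ u)) ∈ regular u₀ _ := by
  have e : (fun u => R.Ladj (ζ u)) = fun u => !![R.d, 0; 0, R.d'] +
      (ζ u) ^ 2 • !![0, 0; 0, -R.d] + ζ u • !![0, R.d * R.A; R.d' * R.C, 0] := by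
    funext u
    ext s t
    fin_cases s <;> fin_cases t <;> simp [OscAlg.Ladj, sub_eq_add_neg, smul_smul]
  have h' : (fun u => R.Ladj (ζ u)) ∈ regular u₀ _ := by
    rw [e]
    exact add_mem_regular (add_mem_regular (const_mem_regular _) (smul_mem_regular (hζ.pow 2) _))
      (smul_mem_regular hζ _)
  exact smul_fun_mem_regular ((analyticAt_const.sub (hζ.pow 2)).inv h) h'

theorem tripletL_mem_regular {e d₁ d₀ x y ζ : ℂ → ℂ} (he : AnalyticAt ℂ e u₀)
    (hd₁ : AnalyticAt ℂ d₁ u₀) (hd₀ : AnalyticAt ℂ d₀ u₀) (hx : AnalyticAt ℂ x u₀)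
    (hy : AnalyticAt ℂ y u₀) (hζ : AnalyticAt ℂ ζ u₀) :
    (fun u => tripletL R (e u) (d₁ u) (d₀ u) (x u) (y u) (ζ u)) ∈ regular u₀ _ :=
  mul_mem_regular (map_mem_regular (lift₃ O).toLinearMap (fused_mem_regular he hd₁ hd₀ hx hy))
    (map_mem_regular (auxIncl (Matrix (Fin 2) (Fin 2) O)).toLinearMap
      (map_mem_regular (auxIncl O).toLinearMap (L_mem_regular R hζ)))

theorem tripletLinv_mem_regular {e d₁ d₀ x y ζ : ℂ → ℂ} (he : AnalyticAt ℂ e u₀)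
    (hd₁ : AnalyticAt ℂ d₁ u₀) (hd₀ : AnalyticAt ℂ d₀ u₀) (hx : AnalyticAt ℂ x u₀)
    (hy : AnalyticAt ℂ y u₀) (hζ : AnalyticAt ℂ ζ u₀) (h : e u₀ ≠ 0)
    (hΔ : d₁ u₀ * d₀ u₀ - x u₀ * y u₀ ≠ 0) (h' : 1 - ζ u₀ ^ 2 ≠ 0) :
    (fun u => tripletLinv R (e u) (d₁ u) (d₀ u) (x u) (y u) (ζ u)) ∈ regular u₀ _ :=
  mul_mem_regular (map_mem_regular (auxIncl (Matrix (Fin 2) (Fin 2) O)).toLinearMap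
      (map_mem_regular (auxIncl O).toLinearMap (Linv_mem_regular R hζ h')))
    (map_mem_regular (lift₃ O).toLinearMap (fusedInv_mem_regular he hd₁ hd₀ hx hy h hΔ))

theorem Rsc_mem_regular {ζ : ℂ → ℂ} (hζ : AnalyticAt ℂ ζ u₀) :
    (fun u => Rsc q (ζ u)) ∈ regular u₀ _ :=
  sixVertex_mem_regular (by fun_prop) (by fun_prop) (by fun_prop)

theorem Radj_mem_regular {ζ : ℂ → ℂ} (hζ : AnalyticAt ℂ ζ u₀) :
    (fun u => Radj q (ζ u)) ∈ regular u₀ _ :=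
  sixVertex_mem_regular (by fun_prop) (by fun_prop) (by fun_prop)

theorem Rinv_mem_regular {ζ : ℂ → ℂ} (hζ : AnalyticAt ℂ ζ u₀) (h₁ : 1 - q ^ 2 * ζ u₀ ^ 2 ≠ 0)
    (h₂ : q ^ 2 - ζ u₀ ^ 2 ≠ 0) : (fun u => Rinv q (ζ u)) ∈ regular u₀ _ :=
  smul_fun_mem_regular (AnalyticAt.inv (by fun_prop) (mul_ne_zero h₁ h₂)) (Radj_mem_regular hζ)

theorem auxLift_mem_regular {a : ℂ → AuxMat ℂ} (ha : a ∈ regular u₀ _) :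
    (fun u => auxLift O (a u)) ∈ regular u₀ _ :=
  map_mem_regular (auxLift O).toLinearMap ha

/-- `dress` as a linear map. -/
def dressLin (F : Type*) [Ring F] [Algebra ℂ F] (D : Fin 2 → ℂ) :
    Matrix (Conf n) (Conf n) F →ₗ[ℂ] Matrix (Conf n) (Conf n) (Matrix (Fin 2) (Fin 2) F) where
  toFun := dress D
  map_add' Y Z := by
    ext x y i k
    simp only [dress, Matrix.add_apply, Matrix.of_apply, Matrix.diagonal_apply]
    split_ifs <;> simp
  map_smul' c Y := by
    ext x y i k
    simp only [dress, Matrix.smul_apply, Matrix.of_apply, Matrix.diagonal_apply, RingHom.id_apply]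
    split_ifs
    · exact smul_comm _ _ _
    · simp

theorem dress_smul {F : Type*} [Ring F] [Algebra ℂ F] (D : Fin 2 → ℂ) (c : ℂ)
    (Y : Matrix (Conf n) (Conf n) F) : dress D (c • Y) = c • dress D Y :=
  (dressLin F D).map_smul c Y

theorem dress_mem_regular {F : Type*} [Ring F] [Algebra ℂ F] (D : Fin 2 → ℂ)
    {Y : ℂ → Matrix (Conf n) (Conf n) F} (hY : Y ∈ regular u₀ _) :
    (fun u => dress D (Y u)) ∈ regular u₀ _ :=
  map_mem_regular (dressLin F D) hY

theorem oscInit_smul (t : O) (c : ℂ) (X : Op n) : oscInit t (c • X) = c • oscInit t X := by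
  ext x y
  simp [oscInit, mul_smul]

end Regular

end

section

variable {n : ℕ}

/-! ### Operators of definite spin -/

theorem HasSpin.spin_sub {s : ℤ} {X : Op n} (hX : HasSpin s X) {x y : Conf n} (h : X x y ≠ 0) :
    spin x - spin y = s := by
  have e := congrFun (congrFun hX x) y
  rw [Matrix.sub_apply, spinOp, Matrix.diagonal_mul, Matrix.mul_diagonal, Matrix.smul_apply,
    smul_eq_mul] at e
  exact mul_right_cancel₀ h (by rw [← e]; ring)

theorem HasSpin.qPowNegTwoSpin_mul {s : ℤ} {X : Op n} (hX : HasSpin s X) (η : ℂ) :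
    HasSpin s (qPowNegTwoSpin n η * X) := by
  have : Commute (spinOp n) (qPowNegTwoSpin n η) := by
    rw [spinOp, qPowNegTwoSpin, commute_iff_eq, Matrix.diagonal_mul_diagonal,
      Matrix.diagonal_mul_diagonal]
    simp only [mul_comm]
  rw [HasSpin, ← mul_assoc, this.eq, mul_assoc, mul_assoc, ← mul_sub, hX, mul_smul_comm]

theorem kArg_eq {s : ℤ} {X : Op n} (hX : HasSpin s X) (η α v : ℂ) :
    kArg η α v X = Complex.exp (v * (α - s)) • (qPowNegTwoSpin n η * X) := by
  ext x y
  rw [kArg, zetaPowAlphaSubSpin, Matrix.of_apply, Matrix.smul_apply, smul_eq_mul]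
  by_cases h : (qPowNegTwoSpin n η * X) x y = 0
  · rw [h, mul_zero, mul_zero]
  · rw [(hX.qPowNegTwoSpin_mul η).spin_sub h]

theorem prod_up (η : ℂ) (x : Conf n) :
    ∏ j, ![Complex.exp η, 1] (x j) = Complex.exp (η * (spin x + n / 2)) := by
  have e : ∀ i : Fin 2, ![Complex.exp η, 1] i =
      Complex.exp (η * ((1 / 2) * ((if i = 0 then (1 : ℂ) else -1) + 1))) := by
    intro i; fin_cases i <;> norm_num
  simp only [e]
  rw [← Complex.exp_sum, ← Finset.mul_sum, ← Finset.mul_sum, Finset.sum_add_distrib, spin]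
  congr 2
  simp
  ring

theorem prod_down (η : ℂ) (x : Conf n) :
    ∏ j, ![1, Complex.exp η] (x j) = Complex.exp (η * (n / 2 - spin x)) := by
  have e : ∀ i : Fin 2, ![1, Complex.exp η] i =
      Complex.exp (η * ((1 / 2) * (1 - if i = 0 then (1 : ℂ) else -1))) := by
    intro i; fin_cases i <;> norm_num
  simp only [e]
  rw [← Complex.exp_sum, ← Finset.mul_sum, ← Finset.mul_sum, Finset.sum_sub_distrib, spin]
  congr 2
  simp
  ring

/-- The diagonal factors left by the invariant column act as conjugation by `q^S` up to a scalar: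
the contributions `q^{±n/2}` cancel and `q^s` remains. -/
theorem HasSpin.up {s : ℤ} {X : Op n} (hX : HasSpin s X) (η : ℂ) (x y : Conf n) :
    ((∏ j, ![Complex.exp η, 1] (x j)) * ∏ j, ![(Complex.exp η)⁻¹, 1] (y j)) * X x y =
      Complex.exp (η * s) * X x y := by
  by_cases h : X x y = 0
  · rw [h, mul_zero, mul_zero]
  · rw [← hX.spin_sub h, ← Complex.exp_neg, prod_up, prod_up, ← Complex.exp_add]
    ring_nf

theorem adjointMonodromy_eq_conjFold_inverse {A : Type*} [MonoidWithZero A] (L : Fin n → A) (Y : A) :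
    adjointMonodromy L Y = conjFold L (fun j => Ring.inverse (L j)) Y := rfl

theorem HasSpin.down {s : ℤ} {X : Op n} (hX : HasSpin s X) (η : ℂ) (x y : Conf n) :
    ((∏ j, ![1, Complex.exp η] (x j)) * ∏ j, ![1, (Complex.exp η)⁻¹] (y j)) * X x y =
      Complex.exp (-η * s) * X x y := by
  by_cases h : X x y = 0
  · rw [h, mul_zero, mul_zero]
  · rw [← hX.spin_sub h, ← Complex.exp_neg, prod_down, prod_down, ← Complex.exp_add]
    ring_nf

/-! ### Linearity -/

/-- `t*` as a linear map. -/
def tStarLin (η α u : ℂ) : Op n →ₗ[ℂ] Op n where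
  toFun := tStar η α u
  map_add' X Y := by
    ext x y
    simp only [tStar, traceAux, Ta, Matrix.of_apply, Matrix.add_apply, Matrix.kronecker_add,
      adjointMonodromy_eq_conjFold_inverse, conjFold_add, Finset.sum_add_distrib]
  map_smul' c X := by
    ext x y
    simp only [tStar, traceAux, Ta, Matrix.of_apply, Matrix.smul_apply, Matrix.kronecker_smul,
      adjointMonodromy_eq_conjFold_inverse, conjFold_smul, RingHom.id_apply, Finset.smul_sum]

theorem tStar_add (η α u : ℂ) (X Y : Op n) :
    tStar η α u (X + Y) = tStar η α u X + tStar η α u Y := (tStarLin η α u).map_add X Y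

theorem tStar_sub (η α u : ℂ) (X Y : Op n) :
    tStar η α u (X - Y) = tStar η α u X - tStar η α u Y := (tStarLin η α u).map_sub X Y

theorem tStar_smul (η α u c : ℂ) (X : Op n) :
    tStar η α u (c • X) = c • tStar η α u X := (tStarLin η α u).map_smul c X

theorem tStar_sum (η α u : ℂ) {ι : Type*} (t : Finset ι) (X : ι → Op n) :
    tStar η α u (∑ i ∈ t, X i) = ∑ i ∈ t, tStar η α u (X i) := map_sum (tStarLin η α u) X t

section Monodromy

variable {O : Type*} [Ring O] [Algebra ℂ O] {q : ℂ} (R : OscAlg O q)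

theorem spinOscMonodromy_smul (t : O) (D : Fin 2 → ℂ) (ζ c : ℂ) (X : Op n) :
    spinOscMonodromy R t D ζ (c • X) = c • spinOscMonodromy R t D ζ X := by
  simp only [spinOscMonodromy, oscInit_smul, dress_smul, locFold_smul]

theorem spinSpinOscMonodromy_smul (t : O) (D : Fin 2 → ℂ) (ζ ζ' c : ℂ) (X : Op n) :
    spinSpinOscMonodromy R t D ζ ζ' (c • X) = c • spinSpinOscMonodromy R t D ζ ζ' X := by
  simp only [spinSpinOscMonodromy, oscInit_smul, dress_smul, locFold_smul]

end Monodromy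

/-! ### Regularity of `t*` and `k` -/

theorem tStar_apply {η α u : ℂ} (h₁ : 1 - Complex.exp η ^ 2 * Complex.exp u ^ 2 ≠ 0)
    (h₂ : Complex.exp η ^ 2 - Complex.exp u ^ 2 ≠ 0) (X : Op n) (x y : Conf n) :
    tStar η α u X x y = ∑ b, locFold (auxLift ℂ (Rsc (Complex.exp η) (Complex.exp u)))
      (auxLift ℂ (Rinv (Complex.exp η) (Complex.exp u))) (dress ![qpow η α, qpow η (-α)] X) x y b b := by
  rw [tStar, show X = X.map (LinearMap.id : ℂ →ₗ[ℂ] ℂ) from (Matrix.map_id X).symm, Ta_eq h₁ h₂]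
  rfl

theorem analyticAt_exp {u₀ : ℂ} : AnalyticAt ℂ Complex.exp u₀ := by fun_prop

theorem analyticAt_tStar {η u₀ : ℂ} (α : ℂ) (h₁ : 1 - Complex.exp η ^ 2 * Complex.exp u₀ ^ 2 ≠ 0)
    (h₂ : Complex.exp η ^ 2 - Complex.exp u₀ ^ 2 ≠ 0) (X : Op n) (x y : Conf n) :
    AnalyticAt ℂ (fun u => tStar η α u X x y) u₀ := by
  have c₁ : ∀ᶠ u in 𝓝 u₀, 1 - Complex.exp η ^ 2 * Complex.exp u ^ 2 ≠ 0 :=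
    ContinuousAt.eventually_ne (by fun_prop) h₁
  have c₂ : ∀ᶠ u in 𝓝 u₀, Complex.exp η ^ 2 - Complex.exp u ^ 2 ≠ 0 :=
    ContinuousAt.eventually_ne (by fun_prop) h₂
  have key : AnalyticAt ℂ (fun u => ∑ b, locFold (auxLift ℂ (Rsc (Complex.exp η) (Complex.exp u)))
      (auxLift ℂ (Rinv (Complex.exp η) (Complex.exp u))) (dress ![qpow η α, qpow η (-α)] X) x y b b)
      u₀ := by
    have hR := auxLift_mem_regular (O := ℂ) (Rsc_mem_regular (q := Complex.exp η)
      (u₀ := u₀) analyticAt_exp)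
    have hR' := auxLift_mem_regular (O := ℂ) (Rinv_mem_regular analyticAt_exp h₁ h₂)
    have hN := locFold_mem_regular hR hR' (const_mem_regular (dress ![qpow η α, qpow η (-α)] X))
    exact Finset.analyticAt_fun_sum _ fun b _ =>
      analyticAt_of_mem_regular (apply_mem_regular (apply_mem_regular hN x y) b b)
  refine key.congr ?_
  filter_upwards [c₁, c₂] with u h₁ h₂
  exact (tStar_apply h₁ h₂ X x y).symm

/-- The numerator of `spinOscMonodromy`. -/
def spinOscNum {O : Type*} [Ring O] [Algebra ℂ O] {q : ℂ} (R : OscAlg O q) (t : O)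
    (D : Fin 2 → ℂ) (ζ : ℂ) (X : Op n) : Matrix (Conf n) (Conf n) (Matrix (Fin 2) (Fin 2) O) :=
  locFold (auxLift O (Rsc q ζ)) (auxLift O (Radj q ζ))
    (dress D (locFold (R.L ζ) (R.Linv ζ) (oscInit t X)))

/-- Each site contributes one scalar denominator from the inverse `R`-matrix, which bounds the pole
orders at `ζ² = q^{±2}` by `n`. -/
theorem spinOscMonodromy_eq_spinOscNum {O : Type*} [Ring O] [Algebra ℂ O] {q : ℂ} (R : OscAlg O q)
    (t : O) (D : Fin 2 → ℂ) (ζ : ℂ) (X : Op n) : spinOscMonodromy R t D ζ X =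
      (((1 - q ^ 2 * ζ ^ 2) * (q ^ 2 - ζ ^ 2))⁻¹) ^ n • spinOscNum R t D ζ X := by
  rw [spinOscMonodromy, Rinv, map_smul]
  conv_lhs => rw [← one_smul ℂ (auxLift O (Rsc q ζ))]
  rw [locFold_smul_smul, one_mul, spinOscNum]

theorem spinOscNum_mem_regular {O : Type*} [Ring O] [Algebra ℂ O] {q : ℂ} (R : OscAlg O q) (t : O)
    (D : Fin 2 → ℂ) (X : Op n) {v₀ : ℂ} {ζ : ℂ → ℂ} (hζ : AnalyticAt ℂ ζ v₀)
    (h : 1 - ζ v₀ ^ 2 ≠ 0) : (fun v => spinOscNum R t D (ζ v) X) ∈ regular v₀ _ := by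
  have hL := locFold_mem_regular (L_mem_regular R hζ) (Linv_mem_regular R hζ h)
    (const_mem_regular (oscInit t X))
  exact locFold_mem_regular (auxLift_mem_regular (Rsc_mem_regular hζ))
    (auxLift_mem_regular (Radj_mem_regular hζ)) (dress_mem_regular D hL)

theorem analyticAt_entry {O : Type*} [Ring O] [Algebra ℂ O] {v₀ : ℂ}
    {N : ℂ → Matrix (Conf n) (Conf n) (Matrix (Fin 2) (Fin 2) O)} (hN : N ∈ regular v₀ _)
    (φ : O →ₗ[ℂ] ℂ) (x y : Conf n) (i k : Fin 2) : AnalyticAt ℂ (fun v => φ (N v x y i k)) v₀ :=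
  analyticAt_of_mem_regular (map_mem_regular φ (apply_mem_regular (apply_mem_regular hN x y) i k))

/-- The numerator of `k (ζ, α) X` for `X` of spin `s`. -/
def kNum (η α : ℂ) (s : ℤ) (v : ℂ) (X : Op n) : Op n :=
  Matrix.of fun x y => Complex.exp (v * (α - s)) * oscTraceLin η α (spinOscNum (oscAlg η)
    (oscTwist η α) ![qpow η α, qpow η (-α)] (Complex.exp v) (qPowNegTwoSpin n η * X) x y 1 0)

theorem analyticAt_kNum (η α : ℂ) (s : ℤ) {v₀ : ℂ} (h : 1 - Complex.exp v₀ ^ 2 ≠ 0) (X : Op n)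
    (x y : Conf n) : AnalyticAt ℂ (fun v => kNum η α s v X x y) v₀ :=
  AnalyticAt.mul (by fun_prop)
    (analyticAt_entry (spinOscNum_mem_regular (oscAlg η) (oscTwist η α) ![qpow η α, qpow η (-α)]
      (qPowNegTwoSpin n η * X) analyticAt_exp h) (oscTraceLin η α) x y 1 0)

theorem kOp_eq_kNum {η α v : ℂ} (h₁ : 1 - Complex.exp η ^ 2 * Complex.exp v ^ 2 ≠ 0)
    (h₂ : Complex.exp η ^ 2 - Complex.exp v ^ 2 ≠ 0) (h₃ : 1 - Complex.exp v ^ 2 ≠ 0) {s : ℤ}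
    {X : Op n} (hX : HasSpin s X) : kOp η α v X =
      (((1 - Complex.exp η ^ 2 * Complex.exp v ^ 2) *
        (Complex.exp η ^ 2 - Complex.exp v ^ 2))⁻¹) ^ n • kNum η α s v X := by
  ext x y
  rw [kOp_apply h₁ h₂ h₃, kArg_eq hX, spinOscMonodromy_smul, spinOscMonodromy_eq_spinOscNum]
  simp only [Matrix.smul_apply, map_smul, smul_eq_mul, kNum, Matrix.of_apply]
  ring

/-! ### The leading part of `t* k` -/

theorem eventually_one_sub_exp_sq_ne : ∀ᶠ u in 𝓝[≠] (0 : ℂ), 1 - Complex.exp u ^ 2 ≠ 0 := by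
  have h : HasDerivAt (fun u => Complex.exp u ^ 2) (2 * Complex.exp 0 ^ 1 * Complex.exp 0) 0 := by
    simpa only [Nat.cast_ofNat] using (Complex.hasDerivAt_exp 0).fun_pow 2
  filter_upwards [h.eventually_ne (c := 1) (by simp)] with u hu h'
  exact hu (sub_eq_zero.1 h').symm

section Difference

variable {O : Type*} [Ring O] [Algebra ℂ O] {q : ℂ} (R : OscAlg O q)

/-- The function `G` collects the triplet entries. They are analytic at `u = 0` because the triplet
operator and `L` at `q ζ` stay invertible at `ζ² = 1` when `q⁴ ≠ 1`. -/
theorem exists_analyticAt_trace_plus (hq : q ^ 4 ≠ 1) (t : O) (D : Fin 2 → ℂ)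
    (ht : D 0 • (t * R.A) = D 1 • (R.A * t)) {σ : ℂ} {X : Op n}
    (hX : ∀ x y, ((∏ j, ![q, 1] (x j)) * ∏ j, ![q⁻¹, 1] (y j)) * X x y = σ * X x y)
    (φ : O →ₗ[ℂ] ℂ) (x y : Conf n) :
    ∃ G : ℂ → ℂ, AnalyticAt ℂ G 0 ∧ ∀ᶠ u in 𝓝[≠] (0 : ℂ),
      ∑ b, φ (spinSpinOscMonodromy R t D (Complex.exp u) (q * Complex.exp u) X x y b b 1 0) =
      G u - D 1 * σ * φ (spinOscMonodromy' R t D (Complex.exp u) X x y 1 0 0 0) := by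
  have hq2 : q ^ 2 ≠ 1 := fun h => hq (by rw [show q ^ 4 = (q ^ 2) ^ 2 by ring, h, one_pow])
  have c₁ : ∀ᶠ u in 𝓝 (0 : ℂ), 1 - q ^ 2 * Complex.exp u ^ 2 ≠ 0 :=
    ContinuousAt.eventually_ne (by fun_prop) (by simpa [sub_eq_zero] using hq2.symm)
  have c₂ : ∀ᶠ u in 𝓝 (0 : ℂ), q ^ 2 - Complex.exp u ^ 2 ≠ 0 :=
    ContinuousAt.eventually_ne (by fun_prop) (by simpa [sub_eq_zero] using hq2)
  have c₃ : ∀ᶠ u in 𝓝 (0 : ℂ), 1 - q ^ 2 * (q * Complex.exp u) ^ 2 ≠ 0 :=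
    ContinuousAt.eventually_ne (by fun_prop) (by
      simp only [Complex.exp_zero, mul_one, ← pow_add, ne_eq, sub_eq_zero]
      exact hq.symm)
  have hN := locFold_mem_regular (n := n)
    (tripletL_mem_regular R (u₀ := 0) (e := fun u => 1 - q ^ 4 * Complex.exp u ^ 2)
      (d₁ := fun u => q ^ 2 * (1 - Complex.exp u ^ 2))
      (d₀ := fun u => q * (1 - q ^ 2 * Complex.exp u ^ 2))
      (x := fun u => (1 - q ^ 2) * q * Complex.exp u) (y := fun u => (1 - q ^ 4) * Complex.exp u)
      (ζ := fun u => q * Complex.exp u)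
      (by fun_prop) (by fun_prop) (by fun_prop) (by fun_prop) (by fun_prop) (by fun_prop))
    (tripletLinv_mem_regular R (u₀ := 0) (e := fun u => 1 - q ^ 4 * Complex.exp u ^ 2)
      (d₁ := fun u => q ^ 2 * (1 - Complex.exp u ^ 2))
      (d₀ := fun u => q * (1 - q ^ 2 * Complex.exp u ^ 2))
      (x := fun u => (1 - q ^ 2) * q * Complex.exp u) (y := fun u => (1 - q ^ 4) * Complex.exp u)
      (ζ := fun u => q * Complex.exp u)
      (by fun_prop) (by fun_prop) (by fun_prop) (by fun_prop) (by fun_prop) (by fun_prop)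
      (by simpa [sub_eq_zero] using hq.symm)
      (by
        rw [Complex.exp_zero, show q ^ 2 * (1 - 1 ^ 2) * (q * (1 - q ^ 2 * 1 ^ 2)) -
          (1 - q ^ 2) * q * 1 * ((1 - q ^ 4) * 1) = (1 - q ^ 2) * q * (q ^ 4 - 1) by ring]
        exact mul_ne_zero (mul_ne_zero (sub_ne_zero.2 hq2.symm) R.q_ne_zero) (sub_ne_zero.2 hq))
      (by simpa [sub_eq_zero] using hq2.symm))
    (const_mem_regular (dress D (dress D (oscInit t X))))
  have entry := fun b b' a a' => apply_mem_regular (apply_mem_regular (apply_mem_regular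
    hN x y) b b') a a'
  refine ⟨_, ((analyticAt_of_mem_regular (map_mem_regular φ (entry 1 0 0 0))).add
    (analyticAt_of_mem_regular (map_mem_regular φ (entry 1 1 1 0)))).sub
    (analyticAt_of_mem_regular (map_mem_regular (φ ∘ₗ LinearMap.mulRight ℂ R.A) (entry 1 0 1 0))), ?_⟩
  filter_upwards [nhdsWithin_le_nhds c₁, nhdsWithin_le_nhds c₂, nhdsWithin_le_nhds c₃,
    eventually_one_sub_exp_sq_ne] with u h₁ h₂ h₃ h₄
  exact trace_plus R h₁ h₂ h₃ h₄ t D ht hX φ x y _ rfl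

theorem exists_analyticAt_trace_minus (hq : q ^ 4 ≠ 1) (t : O) (D : Fin 2 → ℂ)
    (ht : D 0 • (t * R.A) = D 1 • (R.A * t)) {σ : ℂ} {X : Op n}
    (hX : ∀ x y, ((∏ j, ![1, q] (x j)) * ∏ j, ![1, q⁻¹] (y j)) * X x y = σ * X x y)
    (φ : O →ₗ[ℂ] ℂ) (x y : Conf n) :
    ∃ G : ℂ → ℂ, AnalyticAt ℂ G 0 ∧ ∀ᶠ u in 𝓝[≠] (0 : ℂ),
      ∑ b, φ (spinSpinOscMonodromy R t D (Complex.exp u) (q⁻¹ * Complex.exp u) X x y b b 1 0) =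
      G u - D 0 * σ * φ (spinOscMonodromy' R t D (Complex.exp u) X x y 1 0 0 0) := by
  have hq0 := R.q_ne_zero
  have hq2 : q ^ 2 ≠ 1 := fun h => hq (by rw [show q ^ 4 = (q ^ 2) ^ 2 by ring, h, one_pow])
  have c₁ : ∀ᶠ u in 𝓝 (0 : ℂ), 1 - q ^ 2 * Complex.exp u ^ 2 ≠ 0 :=
    ContinuousAt.eventually_ne (by fun_prop) (by simpa [sub_eq_zero] using hq2.symm)
  have c₂ : ∀ᶠ u in 𝓝 (0 : ℂ), q ^ 2 - Complex.exp u ^ 2 ≠ 0 :=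
    ContinuousAt.eventually_ne (by fun_prop) (by simpa [sub_eq_zero] using hq2)
  have c₃ : ∀ᶠ u in 𝓝 (0 : ℂ), q ^ 2 - (q⁻¹ * Complex.exp u) ^ 2 ≠ 0 :=
    ContinuousAt.eventually_ne (by fun_prop) (by
      intro h
      refine hq (sub_eq_zero.1 ?_)
      rw [Complex.exp_zero] at h
      have : q ^ 4 - 1 = q ^ 2 * (q ^ 2 - (q⁻¹ * 1) ^ 2) := by field_simp
      rw [this, h, mul_zero])
  have hN := locFold_mem_regular (n := n)
    (tripletL_mem_regular R (u₀ := 0) (e := fun u => 1 - q ^ 2 * Complex.exp u ^ 2)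
      (d₁ := fun u => q ^ 2 - Complex.exp u ^ 2)
      (d₀ := fun u => q * (1 - Complex.exp u ^ 2))
      (x := fun u => q⁻¹ * (1 - q ^ 4) * Complex.exp u) (y := fun u => (1 - q ^ 2) * Complex.exp u)
      (ζ := fun u => q⁻¹ * Complex.exp u)
      (by fun_prop) (by fun_prop) (by fun_prop) (by fun_prop) (by fun_prop) (by fun_prop))
    (tripletLinv_mem_regular R (u₀ := 0) (e := fun u => 1 - q ^ 2 * Complex.exp u ^ 2)
      (d₁ := fun u => q ^ 2 - Complex.exp u ^ 2)
      (d₀ := fun u => q * (1 - Complex.exp u ^ 2))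
      (x := fun u => q⁻¹ * (1 - q ^ 4) * Complex.exp u) (y := fun u => (1 - q ^ 2) * Complex.exp u)
      (ζ := fun u => q⁻¹ * Complex.exp u)
      (by fun_prop) (by fun_prop) (by fun_prop) (by fun_prop) (by fun_prop) (by fun_prop)
      (by simpa [sub_eq_zero] using hq2.symm)
      (by
        rw [Complex.exp_zero, show (q ^ 2 - 1 ^ 2) * (q * (1 - 1 ^ 2)) -
          q⁻¹ * (1 - q ^ 4) * 1 * ((1 - q ^ 2) * 1) = q⁻¹ * (1 - q ^ 2) * (q ^ 4 - 1) by ring]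
        exact mul_ne_zero (mul_ne_zero (inv_ne_zero hq0) (sub_ne_zero.2 hq2.symm)) (sub_ne_zero.2 hq))
      (by
        rw [Complex.exp_zero, show 1 - (q⁻¹ * 1) ^ 2 = (q ^ 2)⁻¹ * (q ^ 2 - 1) by field_simp]
        exact mul_ne_zero (inv_ne_zero (pow_ne_zero 2 hq0)) (sub_ne_zero.2 hq2)))
    (const_mem_regular (dress D (dress D (oscInit t X))))
  have entry := fun b b' a a' => apply_mem_regular (apply_mem_regular (apply_mem_regular
    hN x y) b b') a a'
  refine ⟨_, ((analyticAt_of_mem_regular (map_mem_regular φ (entry 1 0 0 0))).add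
    (analyticAt_of_mem_regular (map_mem_regular φ (entry 1 1 1 0)))).add
    (analyticAt_of_mem_regular (map_mem_regular (φ ∘ₗ LinearMap.mulLeft ℂ R.A) (entry 1 0 1 0))), ?_⟩
  filter_upwards [nhdsWithin_le_nhds c₁, nhdsWithin_le_nhds c₂, nhdsWithin_le_nhds c₃,
    eventually_one_sub_exp_sq_ne] with u h₁ h₂ h₃ h₄
  exact trace_minus R h₁ h₂ h₃ h₄ t D ht hX φ x y _ rfl

end Difference

theorem oscTwist_smul_mul_oscA (η α : ℂ) :
    (![qpow η α, qpow η (-α)] 0) • (oscTwist η α * (oscAlg η).A) =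
      (![qpow η α, qpow η (-α)] 1) • ((oscAlg η).A * oscTwist η α) := by
  change qpow η α • (oscTwist η α * oscA η) = qpow η (-α) • (oscA η * oscTwist η α)
  rw [oscTwist_mul_oscA, smul_smul, ← qpow_add]
  congr 2
  ring

theorem exists_analyticAt_tStar_kOp_add {η : ℂ} (hq : Complex.exp η ^ 4 ≠ 1) (α : ℂ) {s : ℤ}
    {X : Op n} (hX : HasSpin s X) (x y : Conf n) :
    ∃ G : ℂ → ℂ, AnalyticAt ℂ G 0 ∧ ∀ᶠ u in 𝓝[≠] (0 : ℂ),
      tStar η α u (kOp η α (u + η) X) x y = G u - Complex.exp (u * (α - s)) *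
        oscTraceLin η α (spinOscMonodromy' (oscAlg η) (oscTwist η α) ![qpow η α, qpow η (-α)]
          (Complex.exp u) (qPowNegTwoSpin n η * X) x y 1 0 0 0) := by
  obtain ⟨G, hG, h⟩ := exists_analyticAt_trace_plus (oscAlg η) hq (oscTwist η α)
    ![qpow η α, qpow η (-α)] (oscTwist_smul_mul_oscA η α) ((hX.qPowNegTwoSpin_mul η).up η)
    (oscTraceLin η α) x y
  set q := Complex.exp η with hqdef
  have hq2 : q ^ 2 ≠ 1 := fun h => hq (by rw [show q ^ 4 = (q ^ 2) ^ 2 by ring, h, one_pow])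
  have c₁ : ∀ᶠ u in 𝓝 (0 : ℂ), 1 - q ^ 2 * Complex.exp u ^ 2 ≠ 0 :=
    ContinuousAt.eventually_ne (by fun_prop) (by simpa [sub_eq_zero] using hq2.symm)
  have c₂ : ∀ᶠ u in 𝓝 (0 : ℂ), q ^ 2 - Complex.exp u ^ 2 ≠ 0 :=
    ContinuousAt.eventually_ne (by fun_prop) (by simpa [sub_eq_zero] using hq2)
  have c₃ : ∀ᶠ u in 𝓝 (0 : ℂ), 1 - q ^ 2 * (Complex.exp u * q) ^ 2 ≠ 0 :=
    ContinuousAt.eventually_ne (by fun_prop) (by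
      simp only [Complex.exp_zero, one_mul, ← pow_add, ne_eq, sub_eq_zero]
      exact hq.symm)
  refine ⟨fun u => Complex.exp ((u + η) * (α - s)) * G u, AnalyticAt.mul (by fun_prop) hG, ?_⟩
  filter_upwards [nhdsWithin_le_nhds c₁, nhdsWithin_le_nhds c₂, nhdsWithin_le_nhds c₃,
    eventually_one_sub_exp_sq_ne, h] with u h₁ h₂ h₃ h₄ h
  have e : Complex.exp (u + η) = Complex.exp u * q := Complex.exp_add u η
  have h₅ : q ^ 2 - Complex.exp (u + η) ^ 2 ≠ 0 := by
    rw [e, show q ^ 2 - (Complex.exp u * q) ^ 2 = q ^ 2 * (1 - Complex.exp u ^ 2) by ring]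
    exact mul_ne_zero (pow_ne_zero 2 (Complex.exp_ne_zero η)) h₄
  have h₆ : 1 - Complex.exp (u + η) ^ 2 ≠ 0 := by rw [e, mul_pow, mul_comm]; exact h₁
  rw [tStar_kOp_apply h₁ h₂ (by rw [e]; exact h₃) h₅ h₆, kArg_eq hX, spinSpinOscMonodromy_smul, e,
    mul_comm (Complex.exp u) q]
  simp only [Matrix.smul_apply, map_smul]
  rw [← Finset.smul_sum, h, smul_eq_mul, mul_sub]
  congr 1
  rw [← mul_assoc]
  congr 1
  -- The shift in `ζ^{α-s}` gives `q^{α-s}`, the twist `q^{-α}` and the spin of `X` gives `q^s`;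
  -- their product is `1`.
  simp only [Matrix.cons_val_one, Matrix.cons_val_fin_one, qpow]
  rw [← Complex.exp_add, ← Complex.exp_add]
  ring_nf

theorem exists_analyticAt_tStar_kOp_sub {η : ℂ} (hq : Complex.exp η ^ 4 ≠ 1) (α : ℂ) {s : ℤ}
    {X : Op n} (hX : HasSpin s X) (x y : Conf n) :
    ∃ G : ℂ → ℂ, AnalyticAt ℂ G 0 ∧ ∀ᶠ u in 𝓝[≠] (0 : ℂ),
      tStar η α u (kOp η α (u - η) X) x y = G u - Complex.exp (u * (α - s)) *
        oscTraceLin η α (spinOscMonodromy' (oscAlg η) (oscTwist η α) ![qpow η α, qpow η (-α)]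
          (Complex.exp u) (qPowNegTwoSpin n η * X) x y 1 0 0 0) := by
  obtain ⟨G, hG, h⟩ := exists_analyticAt_trace_minus (oscAlg η) hq (oscTwist η α)
    ![qpow η α, qpow η (-α)] (oscTwist_smul_mul_oscA η α) ((hX.qPowNegTwoSpin_mul η).down η)
    (oscTraceLin η α) x y
  set q := Complex.exp η with hqdef
  have hq0 : q ≠ 0 := Complex.exp_ne_zero η
  have hq2 : q ^ 2 ≠ 1 := fun h => hq (by rw [show q ^ 4 = (q ^ 2) ^ 2 by ring, h, one_pow])
  have c₁ : ∀ᶠ u in 𝓝 (0 : ℂ), 1 - q ^ 2 * Complex.exp u ^ 2 ≠ 0 :=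
    ContinuousAt.eventually_ne (by fun_prop) (by simpa [sub_eq_zero] using hq2.symm)
  have c₂ : ∀ᶠ u in 𝓝 (0 : ℂ), q ^ 2 - Complex.exp u ^ 2 ≠ 0 :=
    ContinuousAt.eventually_ne (by fun_prop) (by simpa [sub_eq_zero] using hq2)
  have c₃ : ∀ᶠ u in 𝓝 (0 : ℂ), q ^ 2 - (q⁻¹ * Complex.exp u) ^ 2 ≠ 0 :=
    ContinuousAt.eventually_ne (by fun_prop) (by
      intro h
      refine hq (sub_eq_zero.1 ?_)
      rw [Complex.exp_zero] at h
      have : q ^ 4 - 1 = q ^ 2 * (q ^ 2 - (q⁻¹ * 1) ^ 2) := by field_simp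
      rw [this, h, mul_zero])
  refine ⟨fun u => Complex.exp ((u - η) * (α - s)) * G u, AnalyticAt.mul (by fun_prop) hG, ?_⟩
  filter_upwards [nhdsWithin_le_nhds c₁, nhdsWithin_le_nhds c₂, nhdsWithin_le_nhds c₃,
    eventually_one_sub_exp_sq_ne, h] with u h₁ h₂ h₃ h₄ h
  have e : Complex.exp (u - η) = q⁻¹ * Complex.exp u := by
    rw [Complex.exp_sub, div_eq_inv_mul]
  have h₅ : 1 - q ^ 2 * Complex.exp (u - η) ^ 2 ≠ 0 := by
    rw [e, show 1 - q ^ 2 * (q⁻¹ * Complex.exp u) ^ 2 = 1 - Complex.exp u ^ 2 by field_simp]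
    exact h₄
  have h₆ : 1 - Complex.exp (u - η) ^ 2 ≠ 0 := by
    rw [e, show 1 - (q⁻¹ * Complex.exp u) ^ 2 = (q ^ 2)⁻¹ * (q ^ 2 - Complex.exp u ^ 2) by field_simp]
    exact mul_ne_zero (inv_ne_zero (pow_ne_zero 2 hq0)) h₂
  rw [tStar_kOp_apply h₁ h₂ h₅ (by rw [e]; exact h₃) h₆, kArg_eq hX, spinSpinOscMonodromy_smul, e]
  simp only [Matrix.smul_apply, map_smul]
  rw [← Finset.smul_sum, h, smul_eq_mul, mul_sub]
  congr 1
  rw [← mul_assoc]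
  congr 1
  -- Here the factors are `q^{s-α}`, `q^α` and `q^{-s}`, again with product `1`.
  simp only [Matrix.cons_val_zero, qpow]
  rw [← Complex.exp_add, ← Complex.exp_add]
  ring_nf

theorem exists_analyticAt_tStar_kOp {η : ℂ} (hq : Complex.exp η ^ 4 ≠ 1) (α : ℂ) {s : ℤ}
    {X : Op n} (hX : HasSpin s X) (x y : Conf n) :
    ∃ G : ℂ → ℂ, AnalyticAt ℂ G 0 ∧ ∀ᶠ u in 𝓝[≠] (0 : ℂ),
      tStar η α u (kOp η α (u - η) X - kOp η α (u + η) X) x y = G u := by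
  obtain ⟨G, hG, h⟩ := exists_analyticAt_tStar_kOp_add hq α hX x y
  obtain ⟨G', hG', h'⟩ := exists_analyticAt_tStar_kOp_sub hq α hX x y
  refine ⟨fun u => G' u - G u, hG'.sub hG, ?_⟩
  filter_upwards [h, h'] with u h h'
  rw [tStar_sub, Matrix.sub_apply, h, h', sub_sub_sub_cancel_right]

/-! ### The poles of `k` -/

/-- At `q^{±1}ζ` one factor of the denominator is `1 - ζ²` up to a unit, and the other does not
vanish at `ζ² = 1` since `q⁴ ≠ 1`. -/
theorem exists_analyticAt_kOp {η : ℂ} (hq : Complex.exp η ^ 4 ≠ 1) (α : ℂ) {s : ℤ} {X : Op n}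
    (hX : HasSpin s X) (x y : Conf n) {v : ℂ} (hv : v = η ∨ v = -η) :
    ∃ G : ℂ → ℂ, AnalyticAt ℂ G 0 ∧ ∀ᶠ u in 𝓝[≠] (0 : ℂ),
      (Complex.exp (2 * u) - 1) ^ n * kOp η α (u + v) X x y = G u := by
  set q := Complex.exp η with hqdef
  have hq0 : q ≠ 0 := Complex.exp_ne_zero η
  have hq2 : q ^ 2 ≠ 1 := fun h => hq (by rw [show q ^ 4 = (q ^ 2) ^ 2 by ring, h, one_pow])
  have c₁ : ∀ᶠ u in 𝓝 (0 : ℂ), 1 - q ^ 2 * Complex.exp u ^ 2 ≠ 0 :=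
    ContinuousAt.eventually_ne (by fun_prop) (by simpa [sub_eq_zero] using hq2.symm)
  have c₂ : ∀ᶠ u in 𝓝 (0 : ℂ), q ^ 2 - Complex.exp u ^ 2 ≠ 0 :=
    ContinuousAt.eventually_ne (by fun_prop) (by simpa [sub_eq_zero] using hq2)
  have e₂ : ∀ u, Complex.exp (2 * u) = Complex.exp u ^ 2 := fun u => by
    rw [← Complex.exp_nat_mul]; norm_num
  have hK : 1 - Complex.exp (0 + v) ^ 2 ≠ 0 := by
    rcases hv with rfl | rfl
    · rw [zero_add]; exact sub_ne_zero.2 hq2.symm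
    · rw [zero_add, Complex.exp_neg, inv_pow, sub_ne_zero]
      exact fun h => hq2 (inv_eq_one.1 h.symm)
  have hK' : AnalyticAt ℂ (fun u => kNum η α s (u + v) X x y) 0 :=
    AnalyticAt.fun_comp (f := fun u => u + v) (analyticAt_kNum η α s hK X x y) (by fun_prop)
  rcases hv with rfl | rfl
  · have c₃ : 1 - q ^ 4 * Complex.exp 0 ^ 2 ≠ 0 := by simpa [sub_eq_zero] using hq.symm
    have c₃' : ∀ᶠ u in 𝓝 (0 : ℂ), 1 - q ^ 4 * Complex.exp u ^ 2 ≠ 0 :=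
      ContinuousAt.eventually_ne (by fun_prop) c₃
    have hi : AnalyticAt ℂ (fun u => ((1 - q ^ 4 * Complex.exp u ^ 2) * q ^ 2)⁻¹) 0 :=
      AnalyticAt.fun_inv (by fun_prop) (mul_ne_zero c₃ (pow_ne_zero 2 hq0))
    refine ⟨fun u => (-((1 - q ^ 4 * Complex.exp u ^ 2) * q ^ 2)⁻¹) ^ n *
      kNum v α s (u + v) X x y, (hi.fun_neg.fun_pow n).fun_mul hK', ?_⟩
    filter_upwards [nhdsWithin_le_nhds c₁, nhdsWithin_le_nhds c₃',
      eventually_one_sub_exp_sq_ne] with u h₁ h₃ h₄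
    have e : Complex.exp (u + v) = q * Complex.exp u := by rw [Complex.exp_add, mul_comm]
    have h₅ : 1 - q ^ 2 * Complex.exp (u + v) ^ 2 = 1 - q ^ 4 * Complex.exp u ^ 2 := by
      rw [e]; ring
    have h₆ : q ^ 2 - Complex.exp (u + v) ^ 2 = q ^ 2 * (1 - Complex.exp u ^ 2) := by
      rw [e]; ring
    have h₇ : 1 - Complex.exp (u + v) ^ 2 ≠ 0 := by rw [e, mul_pow]; exact h₁
    rw [kOp_eq_kNum (h₅ ▸ h₃) (h₆ ▸ mul_ne_zero (pow_ne_zero 2 hq0) h₄) h₇ hX, Matrix.smul_apply,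
      smul_eq_mul, ← mul_assoc, ← mul_pow, ← hqdef, h₅, h₆, e₂]
    congr 2
    field_simp
    ring
  · have c₃ : q ^ 2 - q⁻¹ ^ 2 * Complex.exp 0 ^ 2 ≠ 0 := by
      intro h
      refine hq (sub_eq_zero.1 ?_)
      rw [Complex.exp_zero] at h
      have : q ^ 4 - 1 = q ^ 2 * (q ^ 2 - q⁻¹ ^ 2 * 1 ^ 2) := by field_simp
      rw [this, h, mul_zero]
    have c₃' : ∀ᶠ u in 𝓝 (0 : ℂ), q ^ 2 - q⁻¹ ^ 2 * Complex.exp u ^ 2 ≠ 0 :=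
      ContinuousAt.eventually_ne (by fun_prop) c₃
    have hi : AnalyticAt ℂ (fun u => (q ^ 2 - q⁻¹ ^ 2 * Complex.exp u ^ 2)⁻¹) 0 :=
      AnalyticAt.fun_inv (by fun_prop) c₃
    refine ⟨fun u => (-(q ^ 2 - q⁻¹ ^ 2 * Complex.exp u ^ 2)⁻¹) ^ n *
      kNum η α s (u + -η) X x y, (hi.fun_neg.fun_pow n).fun_mul hK', ?_⟩
    filter_upwards [nhdsWithin_le_nhds c₂, nhdsWithin_le_nhds c₃',
      eventually_one_sub_exp_sq_ne] with u h₂ h₃ h₄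
    have e : Complex.exp (u + -η) = q⁻¹ * Complex.exp u := by
      rw [Complex.exp_add, Complex.exp_neg, mul_comm]
    have h₅ : 1 - q ^ 2 * Complex.exp (u + -η) ^ 2 = 1 - Complex.exp u ^ 2 := by
      rw [e]; field_simp
    have h₆ : q ^ 2 - Complex.exp (u + -η) ^ 2 = q ^ 2 - q⁻¹ ^ 2 * Complex.exp u ^ 2 := by
      rw [e]; ring
    have h₇ : 1 - Complex.exp (u + -η) ^ 2 ≠ 0 := by
      rw [e, show 1 - (q⁻¹ * Complex.exp u) ^ 2 = (q ^ 2)⁻¹ * (q ^ 2 - Complex.exp u ^ 2) by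
        field_simp]
      exact mul_ne_zero (inv_ne_zero (pow_ne_zero 2 hq0)) h₂
    rw [kOp_eq_kNum (h₅ ▸ h₄) (h₆ ▸ h₃) h₇ hX, Matrix.smul_apply,
      smul_eq_mul, ← mul_assoc, ← mul_pow, ← hqdef, h₅, h₆, e₂]
    congr 2
    rw [mul_inv, ← neg_sub 1, neg_mul, mul_inv_cancel_left₀ h₄]

end

section

variable {n : ℕ}

/-! ### Parity in the spectral parameter -/

section Parity

variable {O : Type*} [Ring O] [Algebra ℂ O]

/-- Conjugation by `σᶻ` of the auxiliary spin changes the sign of the weight `c`, the only one odd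
in `ζ`. The factor `P` leaves room for `(-1)^D` on the oscillator. -/
theorem Rsc_neg_mul (q ζ : ℂ) (P : O) :
    auxLift O (Rsc q (-ζ)) * Matrix.scalar (Fin 2) !![P, 0; 0, -P] =
      Matrix.scalar (Fin 2) !![P, 0; 0, -P] * auxLift O (Rsc q ζ) := by
  rw [Rsc, Rsc, auxLift_sixVertex, auxLift_sixVertex]
  ext s t i k
  fin_cases s <;> fin_cases t <;> fin_cases i <;> fin_cases k <;>
    simp [Matrix.mul_apply, Fin.sum_univ_two]

theorem locFold_Rsc_neg {q ζ : ℂ} (h₁ : 1 - q ^ 2 * ζ ^ 2 ≠ 0) (h₂ : q ^ 2 - ζ ^ 2 ≠ 0) {P : O}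
    {D : Fin 2 → ℂ} {Y Z : Matrix (Conf n) (Conf n) O} (h : ∀ x y, Y x y * P = P * Z x y)
    (x y : Conf n) :
    locFold (auxLift O (Rsc q (-ζ))) (auxLift O (Rinv q (-ζ))) (dress D Y) x y * !![P, 0; 0, -P] =
      !![P, 0; 0, -P] * locFold (auxLift O (Rsc q ζ)) (auxLift O (Rinv q ζ)) (dress D Z) x y := by
  have key := locFold_mul_right (n := n) (Y := dress D Y) (Z := dress D Z)
    (a' := auxLift O (Rinv q (-ζ))) (b' := auxLift O (Rinv q ζ)) (Rsc_neg_mul q ζ P)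
    (by rw [← map_mul, Rinv_mul_Rsc (by rw [neg_sq]; exact h₁) (by rw [neg_sq]; exact h₂), map_one])
    (by rw [← map_mul, Rsc_mul_Rinv h₁ h₂, map_one]) (by
      refine Matrix.ext fun x y => ?_
      rw [Matrix.scalar_apply, Matrix.mul_diagonal, Matrix.diagonal_mul]
      ext i k
      fin_cases i <;> fin_cases k <;>
        simp [dress, Matrix.mul_apply, Fin.sum_univ_two, Matrix.diagonal_apply, h])
  have := congrFun (congrFun key x) y
  rwa [Matrix.scalar_apply, Matrix.mul_diagonal, Matrix.diagonal_mul] at this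

variable {q : ℂ} (R : OscAlg O q)

theorem spinOscMonodromy_neg {ζ : ℂ} (h₁ : 1 - q ^ 2 * ζ ^ 2 ≠ 0) (h₂ : q ^ 2 - ζ ^ 2 ≠ 0)
    (h₃ : 1 - ζ ^ 2 ≠ 0) {P t : O} (hP : P * P = 1) (hA : P * R.A = -(R.A * P))
    (hC : P * R.C = -(R.C * P)) (hd : P * R.d = R.d * P) (hd' : P * R.d' = R.d' * P)
    (ht : P * t = t * P) (D : Fin 2 → ℂ) (X : Op n) (x y : Conf n) :
    spinOscMonodromy R t D (-ζ) X x y 1 0 = -(P * spinOscMonodromy R t D ζ X x y 1 0 * P) := by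
  have hAd : P * (R.A * R.d) = -(R.A * R.d * P) := by
    rw [← mul_assoc, hA, neg_mul, mul_assoc, hd, mul_assoc]
  have hCd : P * (R.C * R.d') = -(R.C * R.d' * P) := by
    rw [← mul_assoc, hC, neg_mul, mul_assoc, hd', mul_assoc]
  have hL : R.L (-ζ) * Matrix.scalar (Fin 2) P = Matrix.scalar (Fin 2) P * R.L ζ := by
    ext i k
    rw [Matrix.scalar_apply, Matrix.mul_diagonal, Matrix.diagonal_mul]
    fin_cases i <;> fin_cases k <;>
      simp [OscAlg.L, sub_mul, mul_sub, hd, hd', hAd, hCd]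
  have key := locFold_mul_right (n := n) (Y := oscInit t X) (Z := oscInit t X)
    (a' := R.Linv (-ζ)) (b' := R.Linv ζ) hL (R.Linv_mul_L (by rw [neg_sq]; exact h₃))
    (R.L_mul_Linv h₃) (by
      refine Matrix.ext fun x y => ?_
      rw [Matrix.scalar_apply, Matrix.mul_diagonal, Matrix.diagonal_mul, oscInit, Matrix.of_apply,
        smul_mul_assoc, mul_smul_comm, ht])
  have e := congrFun (congrFun (locFold_Rsc_neg h₁ h₂ (D := D) (P := P)
    (Y := locFold (R.L (-ζ)) (R.Linv (-ζ)) (oscInit t X))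
    (Z := locFold (R.L ζ) (R.Linv ζ) (oscInit t X)) (fun x y => by
      have := congrFun (congrFun key x) y
      rwa [Matrix.scalar_apply, Matrix.mul_diagonal, Matrix.diagonal_mul] at this) x y) 1) 0
  rw [← spinOscMonodromy, ← spinOscMonodromy] at e
  simp only [Matrix.mul_apply, Fin.sum_univ_two, Matrix.of_apply, Matrix.cons_val_zero,
    Matrix.cons_val_one, Matrix.cons_val_fin_one, mul_zero, zero_mul, add_zero, zero_add] at e
  calc spinOscMonodromy R t D (-ζ) X x y 1 0 =
      spinOscMonodromy R t D (-ζ) X x y 1 0 * P * P := by rw [mul_assoc, hP, mul_one]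
    _ = _ := by rw [e, neg_mul, neg_mul]

end Parity

/-- `(-1)^D` -/
def oscSign : OscEnd := oscTwist (Real.pi * Complex.I) (1 / 2)

theorem oscSign_mul_self : oscSign * oscSign = 1 := by
  refine osc_ext fun j => ?_
  rw [Module.End.mul_apply, oscSign, oscTwist_single, oscTwist_single, Module.End.one_apply,
    mul_assoc, ← map_mul, ← qpow_add, one_mul]
  have : qpow (Real.pi * Complex.I) (2 * (1 / 2) * j + 2 * (1 / 2) * j) = 1 := by
    rw [qpow, Complex.exp_eq_one_iff]
    exact ⟨j, by ring⟩
  rw [this, map_one]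

theorem oscSign_mul_oscA (η : ℂ) : oscSign * oscA η = -(oscA η * oscSign) := by
  have : qpow (Real.pi * Complex.I) (-2 * (1 / 2)) = -1 := by
    rw [qpow, show (Real.pi * Complex.I) * (-2 * (1 / 2) : ℂ) = -(Real.pi * Complex.I) by ring,
      Complex.exp_neg, Complex.exp_pi_mul_I]
    norm_num
  rw [oscSign, oscTwist_mul_oscA, this]
  exact neg_one_smul ℂ (M := OscEnd) _

theorem oscSign_mul_oscAstar : oscSign * oscAstar = -(oscAstar * oscSign) := by
  have : qpow (Real.pi * Complex.I) (2 * (1 / 2)) = -1 := by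
    rw [qpow, show (Real.pi * Complex.I) * (2 * (1 / 2) : ℂ) = Real.pi * Complex.I by ring,
      Complex.exp_pi_mul_I]
  rw [oscSign, oscTwist_mul_oscAstar, this]
  exact neg_one_smul ℂ (M := OscEnd) _

/-- The trace reads only the diagonal element at the base vector, on which `(-1)^D`, normalised
without its value at `q^k`, acts as `1`. -/
theorem oscTrace_sign (η α : ℂ) (x : OscEnd) :
    oscTraceLin η α (oscSign * x * oscSign) = oscTraceLin η α x := by
  have h₁ : oscSign (Finsupp.single 0 1) = Finsupp.single 0 1 := by
    rw [oscSign, oscTwist_single, Int.cast_zero, mul_zero, qpow_zero, map_one, mul_one]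
  have h₂ : ∀ v : ℤ →₀ ℂ[T;T⁻¹], (oscSign v) 0 = v 0 := by
    intro v
    induction v using Finsupp.induction_linear with
    | zero => simp
    | add v w hv hw => rw [map_add, Finsupp.add_apply, hv, hw, Finsupp.add_apply]
    | single j p =>
      rw [oscSign, oscTwist_single]
      by_cases hj : j = 0
      · subst hj
        rw [Int.cast_zero, mul_zero, qpow_zero, map_one, mul_one]
      · rw [Finsupp.single_eq_of_ne (Ne.symm hj), Finsupp.single_eq_of_ne (Ne.symm hj)]
  change oscTrace η α _ = oscTrace η α _
  rw [oscTrace, oscTrace, Module.End.mul_apply, Module.End.mul_apply, h₁, h₂]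

theorem exp_eq_or_eq_neg {u v : ℂ} (h : Complex.exp (2 * u) = Complex.exp (2 * v)) :
    Complex.exp u = Complex.exp v ∨ Complex.exp u = -Complex.exp v := by
  rw [show 2 * u = u + u by ring, show 2 * v = v + v by ring, Complex.exp_add, Complex.exp_add] at h
  exact mul_self_eq_mul_self_iff.1 h

theorem tStar_eq_of_exp_eq {η α u v : ℂ} (h : Complex.exp (2 * u) = Complex.exp (2 * v))
    (h₁ : 1 - Complex.exp η ^ 2 * Complex.exp v ^ 2 ≠ 0)
    (h₂ : Complex.exp η ^ 2 - Complex.exp v ^ 2 ≠ 0) (X : Op n) :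
    tStar η α u X = tStar η α v X := by
  rcases exp_eq_or_eq_neg h with e | e
  · rw [tStar, tStar, Ta, Ta, e]
  · ext x y
    rw [tStar_apply h₁ h₂, tStar_apply (by rw [e, neg_sq]; exact h₁) (by rw [e, neg_sq]; exact h₂), e]
    have key := locFold_Rsc_neg (O := ℂ) (P := 1) (D := ![qpow η α, qpow η (-α)]) h₁ h₂ (Y := X)
      (Z := X) (fun x y => by rw [mul_one, one_mul]) x y
    have k₀ := congrFun (congrFun key 0) 0
    have k₁ := congrFun (congrFun key 1) 1
    simp only [Matrix.mul_apply, Fin.sum_univ_two, Matrix.of_apply, Matrix.cons_val_zero,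
      Matrix.cons_val_one, Matrix.cons_val_fin_one, mul_zero, zero_mul, add_zero, zero_add, mul_one,
      one_mul, mul_neg, neg_mul, neg_inj] at k₀ k₁
    rw [Fin.sum_univ_two, Fin.sum_univ_two, k₀, k₁]

/-- The scalar prefactor is `ζ^{-(2s+1)}`, an odd power, and the element `(1, 0)` of the monodromy
is odd under `ζ ↦ -ζ` as well. So `kSkal` may be computed with any logarithm. -/
theorem smul_kOp_eq_of_exp_eq {η u v : ℂ} (α : ℂ) {s : ℤ} {X : Op n} (hX : HasSpin s X)
    (h : Complex.exp (2 * u) = Complex.exp (2 * v))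
    (h₁ : 1 - Complex.exp η ^ 2 * Complex.exp v ^ 2 ≠ 0)
    (h₂ : Complex.exp η ^ 2 - Complex.exp v ^ 2 ≠ 0) (h₃ : 1 - Complex.exp v ^ 2 ≠ 0) :
    Complex.exp ((-α - s - 1) * u) • kOp η α u X = Complex.exp ((-α - s - 1) * v) • kOp η α v X := by
  have key : ∀ w, Complex.exp ((-α - s - 1) * w) * Complex.exp (w * (α - s)) =
      Complex.exp w ^ (-(2 * s + 1)) := fun w => by
    rw [← Complex.exp_add, ← Complex.exp_int_mul]
    congr 1
    push_cast
    ring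
  have e : Complex.exp u ^ 2 = Complex.exp v ^ 2 := by
    rcases exp_eq_or_eq_neg h with e | e <;> rw [e]
    rw [neg_sq]
  ext x y
  rw [Matrix.smul_apply, Matrix.smul_apply, kOp_apply h₁ h₂ h₃,
    kOp_apply (by rw [e]; exact h₁) (by rw [e]; exact h₂) (by rw [e]; exact h₃), kArg_eq hX,
    kArg_eq hX, spinOscMonodromy_smul, spinOscMonodromy_smul]
  simp only [Matrix.smul_apply, map_smul, smul_eq_mul]
  rw [← mul_assoc, ← mul_assoc, key, key]
  rcases exp_eq_or_eq_neg h with e | e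
  · rw [e]
  · rw [e, spinOscMonodromy_neg (oscAlg η) h₁ h₂ h₃ oscSign_mul_self (oscSign_mul_oscA η)
      oscSign_mul_oscAstar (oscTwist_mul_oscQD _ _ _ _) (oscTwist_mul_oscQD _ _ _ _)
      (oscTwist_mul_oscTwist _ _ _ _), map_neg, oscTrace_sign,
      Odd.neg_zpow ⟨-s - 1, by ring⟩, neg_mul_neg]

end

section

/-! ### One complex variable -/

theorem limUnder_iteratedDeriv {f h : ℂ → ℂ} {z₀ : ℂ} (hh : AnalyticAt ℂ h z₀)
    (e : f =ᶠ[𝓝[≠] z₀] h) (k : ℕ) (c : ℂ) :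
    (limUnder (𝓝[≠] z₀) fun z => c * iteratedDeriv k f z) = c * iteratedDeriv k h z₀ := by
  refine Tendsto.limUnder_eq ?_
  have hk : AnalyticAt ℂ (iteratedDeriv k h) z₀ := by
    rw [iteratedDeriv_eq_iterate]
    exact AnalyticAt.iterated_deriv hh k
  have h₁ : Tendsto (fun z => c * iteratedDeriv k h z) (𝓝[≠] z₀) (𝓝 (c * iteratedDeriv k h z₀)) :=
    (hk.continuousAt.tendsto.mono_left nhdsWithin_le_nhds).const_mul c
  refine h₁.congr' ?_
  filter_upwards [eventually_eventually_nhdsWithin.2 e, self_mem_nhdsWithin] with z hz hne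
  have hz' : f =ᶠ[𝓝 z] h := by rwa [IsOpen.nhdsWithin_eq isOpen_compl_singleton hne] at hz
  rw [hz'.iteratedDeriv_eq k]

theorem exists_taylor {h : ℂ → ℂ} {z₀ : ℂ} (hh : AnalyticAt ℂ h z₀) (m : ℕ) :
    ∃ r : ℂ → ℂ, AnalyticAt ℂ r z₀ ∧ ∀ z, h z =
      ∑ k ∈ Finset.range m, (1 / (k.factorial : ℂ) * iteratedDeriv k h z₀) * (z - z₀) ^ k +
        (z - z₀) ^ m * r z := by
  have hp := hh.hasFPowerSeriesAt
  have hs := fun k => hp.has_fpower_series_iterate_dslope_fslope k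
  refine ⟨_, ⟨_, hs m⟩, fun z => ?_⟩
  induction m with
  | zero => simp
  | succ m ih =>
    -- The remainder is the iterated divided difference `dslope`; its value at `z₀` is the next
    -- Taylor coefficient.
    have hc : (Function.swap dslope z₀)^[m] h z₀ = 1 / (m.factorial : ℂ) * iteratedDeriv m h z₀ := by
      rw [← (hs m).coeff_zero 1]
      have := FormalMultilinearSeries.coeff_iterate_fslope
        (p := FormalMultilinearSeries.ofScalars ℂ fun n => iteratedDeriv n h z₀ / n.factorial) m 0
      rw [FormalMultilinearSeries.coeff, zero_add, FormalMultilinearSeries.coeff_ofScalars] at this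
      rw [this]; ring
    rw [ih, Finset.sum_range_succ, Function.iterate_succ_apply', ← hc, pow_succ]
    have := sub_smul_dslope ((Function.swap dslope z₀)^[m] h) z₀ z
    rw [smul_eq_mul] at this
    change _ = _ + (z - z₀) ^ m * (z - z₀) * dslope ((Function.swap dslope z₀)^[m] h) z₀ z
    rw [mul_assoc, this]
    ring

theorem eq_zero_of_eval_inv {R : Polynomial ℂ} (h₀ : R.coeff 0 = 0) {z₀ : ℂ} {g : ℂ → ℂ}
    (hg : ContinuousAt g z₀) (h : ∀ᶠ z in 𝓝[≠] z₀, R.eval (z - z₀)⁻¹ = g z) : R = 0 := by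
  by_contra hR
  have hd : 0 < R.degree := by
    by_contra hd
    rw [Polynomial.eq_C_of_degree_le_zero (not_lt.1 hd), h₀, map_zero] at hR
    exact hR rfl
  have h₁ : Tendsto (fun z => ‖(z - z₀)⁻¹‖) (𝓝[≠] z₀) atTop := by
    have := (tendsto_norm_inv_nhdsNE_zero_atTop (α := ℂ)).comp (f := fun z => z - z₀) (x := 𝓝[≠] z₀) ?_
    · exact this
    · refine tendsto_nhdsWithin_iff.2 ⟨?_, ?_⟩
      · have : ContinuousAt (fun z => z - z₀) z₀ := by fun_prop
        simpa using this.tendsto.mono_left (nhdsWithin_le_nhds (s := {z₀}ᶜ))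
      · filter_upwards [self_mem_nhdsWithin] with z hz
        exact sub_ne_zero.2 hz
  have h₂ := R.tendsto_norm_atTop hd h₁
  have h₃ : Tendsto (fun z => ‖R.eval (z - z₀)⁻¹‖) (𝓝[≠] z₀) (𝓝 ‖g z₀‖) :=
    (hg.norm.tendsto.mono_left nhdsWithin_le_nhds).congr' (h.mono fun z hz => congrArg norm hz.symm)
  exact not_tendsto_nhds_of_tendsto_atTop h₂ _ h₃

theorem hasSum_negChoose (j : ℕ) {x : ℂ} (hx : ‖x‖ < 1) :
    HasSum (fun p => negChoose j p * x ^ p) ((1 + x) ^ j)⁻¹ := by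
  cases j with
  | zero =>
    have : ∀ p, p ≠ 0 → negChoose 0 p * x ^ p = 0 := fun p hp => by
      simp [negChoose, Ring.choose_zero_ite, hp]
    convert hasSum_single 0 this using 1
    simp [negChoose]
  | succ k =>
    have h := hasSum_choose_mul_geometric_of_norm_lt_one k (r := -x) (by rwa [norm_neg])
    rw [sub_neg_eq_add, one_div] at h
    have e : (fun p => negChoose (k + 1) p * x ^ p) =
        fun p : ℕ => (((p + k).choose k : ℕ) : ℂ) * (-x) ^ p := by
      funext p
      rw [negChoose, Ring.choose_neg, show ((k + 1 : ℕ) : ℤ) + p - 1 = ((p + k : ℕ) : ℤ) by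
        push_cast; ring, Ring.choose_natCast, Nat.choose_symm_add, neg_pow x, Int.negOnePow_def,
        Units.smul_def]
      simp
      ring
    rw [e]
    exact h

variable {n : ℕ}

theorem exp_two_mul_log_div_two {z : ℂ} (hz : z ≠ 0) :
    Complex.exp (2 * (Complex.log z / 2)) = z := by
  rw [mul_div_cancel₀ _ (two_ne_zero : (2 : ℂ) ≠ 0), Complex.exp_log hz]

theorem exp_log_div_two_sq {z : ℂ} (hz : z ≠ 0) : Complex.exp (Complex.log z / 2) ^ 2 = z := by
  rw [← Complex.exp_nat_mul, Nat.cast_ofNat, exp_two_mul_log_div_two hz]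

theorem analyticAt_log_div_two {z : ℂ} (hz : z ∈ Complex.slitPlane) :
    AnalyticAt ℂ (fun z => Complex.log z / 2) z :=
  (analyticAt_clog hz).fun_div analyticAt_const two_ne_zero

theorem tendsto_log_div_two :
    Tendsto (fun z => Complex.log z / 2) (𝓝[≠] 1) (𝓝[≠] (0 : ℂ)) := by
  refine tendsto_nhdsWithin_iff.2 ⟨?_, ?_⟩
  · have := (analyticAt_log_div_two Complex.one_mem_slitPlane).continuousAt.tendsto
    rw [Complex.log_one, zero_div] at this
    exact this.mono_left nhdsWithin_le_nhds
  · have h0 : ∀ᶠ z in 𝓝[≠] (1 : ℂ), z ≠ 0 :=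
      nhdsWithin_le_nhds (ContinuousAt.eventually_ne continuousAt_id one_ne_zero)
    filter_upwards [self_mem_nhdsWithin, h0] with z hz h0 h
    refine hz ?_
    rw [Set.mem_singleton_iff] at h ⊢
    rw [← exp_log_div_two_sq h0, h, Complex.exp_zero, one_pow]

theorem eventually_exp_sq_ne (v c : ℂ) : ∀ᶠ u in 𝓝[≠] (0 : ℂ), Complex.exp (u + v) ^ 2 ≠ c := by
  have h : HasDerivAt (fun u => Complex.exp (u + v) ^ 2)
      (2 * Complex.exp (0 + v) ^ 1 * Complex.exp (0 + v)) 0 := by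
    simpa only [Nat.cast_ofNat, mul_one] using
      (((hasDerivAt_id' (0 : ℂ)).add_const v).cexp).fun_pow 2
  exact h.eventually_ne (by simp)

theorem analyticAt_tStar_log {η z : ℂ} (α : ℂ) (hz : z ∈ Complex.slitPlane)
    (h₁ : 1 - Complex.exp η ^ 2 * z ≠ 0) (h₂ : Complex.exp η ^ 2 - z ≠ 0) (X : Op n)
    (x y : Conf n) : AnalyticAt ℂ (fun z => tStar η α (Complex.log z / 2) X x y) z := by
  have e := exp_log_div_two_sq (Complex.slitPlane_ne_zero hz)
  exact AnalyticAt.fun_comp (f := fun z => Complex.log z / 2)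
    (analyticAt_tStar α (by rwa [e]) (by rwa [e]) X x y) (analyticAt_log_div_two hz)

/-! ### Laurent expansions at `ζ² = 1` -/

/-- Taylor's formula for `(w - z₀)^n` times `kSkal` at `z₀ = e^{2v}`, transported to `z = 1` by `w =
z₀ z`; the rescaling accounts for the exponentials in front of the coefficients. -/
theorem exists_kOp_expansion {η : ℂ} (hq : Complex.exp η ^ 4 ≠ 1) (α : ℂ) {s : ℤ} {X : Op n}
    (hX : HasSpin s X) (x y : Conf n) {v : ℂ} (hv : v = η ∨ v = -η) :
    ∃ r : ℂ → ℂ, AnalyticAt ℂ r 1 ∧ ∀ᶠ z in 𝓝[≠] (1 : ℂ),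
      Complex.exp ((-α - s - 1) * (Complex.log z / 2)) * kOp η α (Complex.log z / 2 + v) X x y =
      ∑ j ∈ Finset.Icc 1 n, Complex.exp (v * (α + s + 1 - 2 * j)) *
        laurentCoeff η α s (Complex.exp (2 * v)) n (n - j) X x y * ((z - 1) ^ j)⁻¹ + r z := by
  obtain ⟨G, hG, hGk⟩ := exists_analyticAt_kOp hq α hX x y hv
  set z₀ := Complex.exp (2 * v) with hz₀
  set c := -α - s - 1 with hc
  have hz₀' : z₀ ≠ 0 := Complex.exp_ne_zero _
  -- The principal logarithm may jump at `z₀`; `log (z / z₀) / 2 + v` is a branch analytic there,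
  -- and by parity `kSkal` cannot tell the two apart.
  set h : ℂ → ℂ := fun z => z₀ ^ n * Complex.exp (c * (Complex.log (z / z₀) / 2 + v)) *
    G (Complex.log (z / z₀) / 2) with hh
  have hl : AnalyticAt ℂ (fun z => Complex.log (z / z₀) / 2) z₀ := by
    refine AnalyticAt.fun_comp (g := fun z => Complex.log z / 2) (f := fun z => z / z₀)
      (analyticAt_log_div_two ?_) (by fun_prop (disch := exact hz₀'))
    rw [div_self hz₀']
    exact Complex.one_mem_slitPlane
  have hhA : AnalyticAt ℂ h z₀ := by
    refine AnalyticAt.fun_mul (AnalyticAt.fun_mul analyticAt_const ?_) ?_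
    · exact (analyticAt_const.fun_mul (hl.fun_add analyticAt_const)).cexp'
    · refine AnalyticAt.fun_comp (f := fun z => Complex.log (z / z₀) / 2) ?_ hl
      rwa [div_self hz₀', Complex.log_one, zero_div]
  have ht : Tendsto (fun z => z / z₀) (𝓝[≠] z₀) (𝓝[≠] 1) := by
    refine tendsto_nhdsWithin_iff.2 ⟨?_, ?_⟩
    · have : ContinuousAt (fun z => z / z₀) z₀ := by fun_prop (disch := exact hz₀')
      have := this.tendsto
      rw [div_self hz₀'] at this
      exact this.mono_left nhdsWithin_le_nhds
    · filter_upwards [self_mem_nhdsWithin] with z hz h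
      exact hz ((div_eq_one_iff_eq hz₀').1 h)
  have he : (fun w => (w - z₀) ^ n * kSkal η α s w X x y) =ᶠ[𝓝[≠] z₀] h := by
    have h0 : ∀ᶠ z in 𝓝[≠] z₀, z ≠ 0 :=
      nhdsWithin_le_nhds (ContinuousAt.eventually_ne continuousAt_id hz₀')
    filter_upwards [h0, (tendsto_log_div_two.comp ht).eventually hGk,
      (tendsto_log_div_two.comp ht).eventually (eventually_exp_sq_ne v (Complex.exp η ^ 2)⁻¹),
      (tendsto_log_div_two.comp ht).eventually (eventually_exp_sq_ne v (Complex.exp η ^ 2)),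
      (tendsto_log_div_two.comp ht).eventually (eventually_exp_sq_ne v 1)] with z h0 hz n₁ n₂ n₃
    simp only [Function.comp_apply] at hz n₁ n₂ n₃
    have hz' : z / z₀ ≠ 0 := div_ne_zero h0 hz₀'
    have e : Complex.exp (2 * (Complex.log z / 2)) =
        Complex.exp (2 * (Complex.log (z / z₀) / 2 + v)) := by
      rw [mul_add, Complex.exp_add, exp_two_mul_log_div_two h0, exp_two_mul_log_div_two hz', ← hz₀,
        div_mul_cancel₀ _ hz₀']
    rw [kSkal, smul_kOp_eq_of_exp_eq α hX e
      (fun h => n₁ (eq_inv_of_mul_eq_one_right (sub_eq_zero.1 h).symm))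
      (fun h => n₂ (sub_eq_zero.1 h).symm) (fun h => n₃ (sub_eq_zero.1 h).symm),
      Matrix.smul_apply, smul_eq_mul, hh]
    simp only
    rw [← hz, exp_two_mul_log_div_two hz', show z - z₀ = z₀ * (z / z₀ - 1) by field_simp, mul_pow]
    ring
  obtain ⟨r, hr, hrh⟩ := exists_taylor hhA n
  have hL : ∀ k, 1 / (k.factorial : ℂ) * iteratedDeriv k h z₀ =
      laurentCoeff η α s z₀ n k X x y := fun k =>
    (limUnder_iteratedDeriv hhA he k _).symm
  refine ⟨fun z => Complex.exp (-(c * v)) * r (z₀ * z), AnalyticAt.fun_mul analyticAt_const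
    (AnalyticAt.fun_comp (f := fun z => z₀ * z) (by rwa [mul_one]) (by fun_prop)), ?_⟩
  have h0 : ∀ᶠ z in 𝓝[≠] (1 : ℂ), z ≠ 0 :=
    nhdsWithin_le_nhds (ContinuousAt.eventually_ne continuousAt_id one_ne_zero)
  filter_upwards [self_mem_nhdsWithin, h0, tendsto_log_div_two.eventually hGk] with z hz h0 hzG
  rw [exp_two_mul_log_div_two h0] at hzG
  have hw : z - 1 ≠ 0 := sub_ne_zero.2 hz
  have hval : h (z₀ * z) = z₀ ^ n * (Complex.exp (c * (Complex.log z / 2)) * Complex.exp (c * v)) *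
      ((z - 1) ^ n * kOp η α (Complex.log z / 2 + v) X x y) := by
    rw [hzG, ← Complex.exp_add, ← mul_add, hh]
    simp only
    rw [mul_div_cancel_left₀ _ hz₀']
  have key := hrh (z₀ * z)
  rw [hval] at key
  have e1 : z₀ * z - z₀ = z₀ * (z - 1) := by ring
  have e2 : Complex.exp (c * v) ≠ 0 := Complex.exp_ne_zero _
  have e3 : Complex.exp (c * (Complex.log z / 2)) * kOp η α (Complex.log z / 2 + v) X x y =
      Complex.exp (-(c * v)) * ((z₀ * (z - 1)) ^ n)⁻¹ * (z₀ ^ n * (Complex.exp (c * (Complex.log z / 2))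
        * Complex.exp (c * v)) * ((z - 1) ^ n * kOp η α (Complex.log z / 2 + v) X x y)) := by
    rw [Complex.exp_neg, mul_pow]
    field_simp
  rw [e3, key, e1, mul_add, Finset.mul_sum]
  congr 1
  -- The Taylor term of order `k` becomes the pole of order `j = n - k`.
  · refine Finset.sum_bij' (fun k _ => n - k) (fun j _ => n - j) ?_ ?_ ?_ ?_ ?_
    · intro k hk; rw [Finset.mem_range] at hk; rw [Finset.mem_Icc]; omega
    · intro j hj; rw [Finset.mem_Icc] at hj; rw [Finset.mem_range]; omega
    · intro k hk; rw [Finset.mem_range] at hk; exact Nat.sub_sub_self (by omega)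
    · intro j hj; rw [Finset.mem_Icc] at hj; exact Nat.sub_sub_self (by omega)
    · intro k hk
      rw [Finset.mem_range] at hk
      rw [Nat.sub_sub_self hk.le, hL]
      have e4 : (z₀ * (z - 1)) ^ n = (z₀ * (z - 1)) ^ (n - k) * (z₀ * (z - 1)) ^ k := by
        rw [← pow_add, Nat.sub_add_cancel hk.le]
      have e5 : Complex.exp (v * (α + s + 1 - 2 * (n - k : ℕ))) =
          Complex.exp (-(c * v)) * (z₀ ^ (n - k))⁻¹ := by
        rw [hz₀, ← Complex.exp_nat_mul, ← Complex.exp_neg, ← Complex.exp_add, hc]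
        congr 1
        ring
      rw [e4, e5, mul_pow z₀ _ (n - k)]
      have e6 : (z₀ * (z - 1)) ^ k ≠ 0 := pow_ne_zero k (mul_ne_zero hz₀' hw)
      field_simp
  · have e6 : (z₀ * (z - 1)) ^ n ≠ 0 := pow_ne_zero n (mul_ne_zero hz₀' hw)
    field_simp

end

/-! ### Cancellation of the pole of `t* f` at `ζ² = 1` -/

section

variable {n : ℕ}

theorem exists_fCoeffPos_expansion {η : ℂ} (hq : Complex.exp η ^ 4 ≠ 1) (α : ℂ) {s : ℤ} {X : Op n}
    (hX : HasSpin s X) (x y : Conf n) :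
    ∃ r : ℂ → ℂ, AnalyticAt ℂ r 1 ∧ ∀ᶠ z in 𝓝[≠] (1 : ℂ),
      ∑ j ∈ Finset.Icc 1 n, ((z - 1) ^ j)⁻¹ * fCoeffPos η α s j X x y =
      1 / 2 * Complex.exp ((-α - s - 1) * (Complex.log z / 2)) *
        (kOp η α (Complex.log z / 2 - η) X - kOp η α (Complex.log z / 2 + η) X) x y + r z := by
  obtain ⟨r, hr, h⟩ := exists_kOp_expansion hq α hX x y (Or.inl rfl)
  obtain ⟨r', hr', h'⟩ := exists_kOp_expansion hq α hX x y (Or.inr rfl)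
  refine ⟨fun z => 1 / 2 * (r z - r' z), analyticAt_const.fun_mul (hr.fun_sub hr'), ?_⟩
  filter_upwards [h, h'] with z h h'
  rw [← sub_eq_add_neg] at h'
  rw [Matrix.sub_apply, mul_assoc, mul_sub, h, h', ← mul_add]
  have e : ∀ a b c d : ℂ, a + b - (c + d) + (d - b) = a - c := fun a b c d => by ring
  rw [e, ← Finset.sum_sub_distrib, Finset.mul_sum]
  refine Finset.sum_congr rfl fun j _ => ?_
  rw [fCoeffPos, rho, rho]
  simp only [Matrix.smul_apply, Matrix.sub_apply, smul_eq_mul, qpow]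
  have e₁ : η * (2 * ((-1 : ℤ) : ℂ)) = 2 * -η := by push_cast; ring
  have e₂ : η * (2 * ((1 : ℤ) : ℂ)) = 2 * η := by push_cast; ring
  have e₃ : η * (2 * j - α - s - 1) = -η * (α + s + 1 - 2 * j) := by ring
  rw [e₁, e₂, e₃]
  ring

/-- The operator `t*`, applied to the polar part of `f`, has no pole at `ζ² = 1`. -/
theorem exists_analyticAt_tStar_fCoeffPos {η : ℂ} (hq : Complex.exp η ^ 4 ≠ 1) (α : ℂ) {s : ℤ}
    {X : Op n} (hX : HasSpin s X) (x y : Conf n) :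
    ∃ G : ℂ → ℂ, AnalyticAt ℂ G 1 ∧ ∀ᶠ z in 𝓝[≠] (1 : ℂ),
      ∑ j ∈ Finset.Icc 1 n, ((z - 1) ^ j)⁻¹ *
        tStar η α (Complex.log z / 2) (fCoeffPos η α s j X) x y = G z := by
  choose r hr h using fun a b => exists_fCoeffPos_expansion hq α hX a b
  obtain ⟨K, hK, hKe⟩ := exists_analyticAt_tStar_kOp hq α hX x y
  have hq2 : Complex.exp η ^ 2 ≠ 1 := fun h => hq (by
    rw [show Complex.exp η ^ 4 = (Complex.exp η ^ 2) ^ 2 by ring, h, one_pow])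
  have ht : ∀ Y : Op n, AnalyticAt ℂ (fun z => tStar η α (Complex.log z / 2) Y x y) 1 := fun Y =>
    analyticAt_tStar_log α Complex.one_mem_slitPlane (by rw [mul_one]; exact sub_ne_zero.2 hq2.symm)
      (sub_ne_zero.2 hq2) Y x y
  have hl : AnalyticAt ℂ (fun z => Complex.log z / 2) 1 :=
    analyticAt_log_div_two Complex.one_mem_slitPlane
  -- `t*` mixes the entries of its argument, so the analytic remainder is decomposed into matrix
  -- units before `t*` is applied to it.
  refine ⟨fun z => 1 / 2 * Complex.exp ((-α - s - 1) * (Complex.log z / 2)) * K (Complex.log z / 2) +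
    ∑ a, ∑ b, r a b z * tStar η α (Complex.log z / 2) (Matrix.single a b 1) x y, ?_, ?_⟩
  · refine AnalyticAt.fun_add (AnalyticAt.fun_mul (analyticAt_const.fun_mul
      (analyticAt_const.fun_mul hl).cexp') (AnalyticAt.fun_comp (f := fun z => Complex.log z / 2)
        (by rwa [Complex.log_one, zero_div]) hl)) ?_
    exact Finset.analyticAt_fun_sum _ fun a _ => Finset.analyticAt_fun_sum _ fun b _ =>
      (hr a b).fun_mul (ht _)
  filter_upwards [eventually_all.2 fun a => eventually_all.2 fun b => h a b,
    tendsto_log_div_two.eventually hKe] with z hz hKz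
  have hsum : ∑ j ∈ Finset.Icc 1 n, ((z - 1) ^ j)⁻¹ • fCoeffPos η α s j X =
      (1 / 2 * Complex.exp ((-α - s - 1) * (Complex.log z / 2))) •
        (kOp η α (Complex.log z / 2 - η) X - kOp η α (Complex.log z / 2 + η) X) +
      ∑ a, ∑ b, r a b z • Matrix.single a b (1 : ℂ) := by
    have : (Matrix.of fun a b => r a b z) = ∑ a, ∑ b, r a b z • Matrix.single a b (1 : ℂ) := by
      simp only [Matrix.smul_single, smul_eq_mul, mul_one]
      exact Matrix.matrix_eq_sum_single _
    rw [← this]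
    ext a b
    rw [Matrix.add_apply, Matrix.smul_apply, smul_eq_mul, Matrix.of_apply, ← hz a b,
      Matrix.sum_apply]
    rfl
  have := congrFun (congrFun (congrArg (tStar η α (Complex.log z / 2)) hsum) x) y
  rw [tStar_add, tStar_smul, tStar_sum, tStar_sum] at this
  simp only [tStar_sum, tStar_smul, Matrix.add_apply, Matrix.smul_apply, smul_eq_mul,
    Matrix.sum_apply, hKz] at this
  exact this

/-! ### Series in powers of `ζ² - 1` -/

theorem hasSum_tStar {η : ℂ} (α : ℂ) {u : ℂ} (h₁ : ‖Complex.exp (2 * u) - 1‖ < 1)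
    (h₂ : ‖Complex.exp (2 * u) - 1‖ < ‖Complex.exp (2 * η) - 1‖)
    (h₃ : ‖Complex.exp (2 * u) - 1‖ < ‖Complex.exp (-2 * η) - 1‖) (X : Op n) (x y : Conf n) :
    HasSum (fun p => (Complex.exp (2 * u) - 1) ^ p * tStarMode η α (p + 1) X x y)
      (tStar η α u X x y) := by
  set z := Complex.exp (2 * u) with hz
  have e₂ : Complex.exp (2 * η) = Complex.exp η ^ 2 := by rw [← Complex.exp_nat_mul]; norm_num
  have e₃ : Complex.exp (-2 * η) = (Complex.exp η ^ 2)⁻¹ := by rw [neg_mul, Complex.exp_neg, e₂]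
  rw [e₂] at h₂
  rw [e₃] at h₃
  obtain ⟨r, hr, hr'⟩ := exists_between (lt_min h₁ (lt_min h₂ h₃))
  rw [lt_min_iff, lt_min_iff] at hr'
  -- The disc stays off the branch cut of `log` (radius below `1`) and off the possible poles
  -- `q^{±2}` of `t*`.
  have hball : ∀ w ∈ Metric.ball (1 : ℂ) r, w ∈ Complex.slitPlane ∧
      1 - Complex.exp η ^ 2 * w ≠ 0 ∧ Complex.exp η ^ 2 - w ≠ 0 := by
    intro w hw
    rw [mem_ball_iff_norm] at hw
    refine ⟨?_, fun h => ?_, fun h => ?_⟩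
    · exact Complex.ball_one_subset_slitPlane (mem_ball_iff_norm.2 (hw.trans hr'.1))
    · rw [eq_inv_of_mul_eq_one_right (sub_eq_zero.1 h).symm] at hw
      exact lt_asymm hw hr'.2.2
    · rw [← sub_eq_zero.1 h] at hw
      exact lt_asymm hw hr'.2.1
  have hd : DifferentiableOn ℂ (fun z => tStar η α (Complex.log z / 2) X x y)
      (Metric.ball 1 r) := fun w hw =>
    (analyticAt_tStar_log α (hball w hw).1 (hball w hw).2.1 (hball w hw).2.2 X x
      y).differentiableAt.differentiableWithinAt
  have hzr : z ∈ Metric.ball (1 : ℂ) r := mem_ball_iff_norm.2 hr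
  have hz0 : z ≠ 0 := Complex.exp_ne_zero _
  have key := Complex.hasSum_taylorSeries_on_ball hd hzr
  have hu : tStar η α u X = tStar η α (Complex.log z / 2) X :=
    tStar_eq_of_exp_eq (by rw [exp_two_mul_log_div_two hz0])
      (by rw [exp_log_div_two_sq hz0]; exact (hball z hzr).2.1)
      (by rw [exp_log_div_two_sq hz0]; exact (hball z hzr).2.2) X
  rw [hu]
  have e : (fun p => (z - 1) ^ p * tStarMode η α (p + 1) X x y) = fun p => (p.factorial : ℂ)⁻¹ •
      (z - 1) ^ p • iteratedDeriv p (fun z => tStar η α (Complex.log z / 2) X x y) 1 := by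
    funext p
    rw [tStarMode, Matrix.of_apply, Nat.add_sub_cancel, smul_eq_mul, smul_eq_mul]
    ring
  rw [e]
  exact key

/-- The negative powers in the expansion of `t*` applied to the polar part of `f` cancel. -/
theorem sum_tStarMode_eq_zero {η : ℂ} (hq : Complex.exp η ^ 4 ≠ 1) (α : ℂ) {s : ℤ}
    {X : Op n} (hX : HasSpin s X) (x y : Conf n) {w : ℂ} (hw : w ≠ 0) :
    ∑ j ∈ Finset.Icc 1 n, ∑ i ∈ Finset.range j,
      w ^ i * tStarMode η α (i + 1) (fCoeffPos η α s j X) x y * (w ^ j)⁻¹ = 0 := by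
  obtain ⟨G, hG, hGe⟩ := exists_analyticAt_tStar_fCoeffPos hq α hX x y
  have hq2 : Complex.exp η ^ 2 ≠ 1 := fun h => hq (by
    rw [show Complex.exp η ^ 4 = (Complex.exp η ^ 2) ^ 2 by ring, h, one_pow])
  have ht : ∀ Y : Op n, AnalyticAt ℂ (fun z => tStar η α (Complex.log z / 2) Y x y) 1 := fun Y =>
    analyticAt_tStar_log α Complex.one_mem_slitPlane (by rw [mul_one]; exact sub_ne_zero.2 hq2.symm)
      (sub_ne_zero.2 hq2) Y x y
  choose r hr hre using fun j => exists_taylor (ht (fCoeffPos η α s j X)) j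
  set a : ℕ → ℕ → ℂ := fun j i => tStarMode η α (i + 1) (fCoeffPos η α s j X) x y with ha
  -- The principal part as a polynomial in `1/(z - 1)`. As `i < j` it has no constant term, so
  -- boundedness near `z = 1` forces it to vanish.
  set R : Polynomial ℂ := ∑ j ∈ Finset.Icc 1 n, ∑ i ∈ Finset.range j,
    Polynomial.C (a j i) * Polynomial.X ^ (j - i) with hR
  have hRe : ∀ w : ℂ, w ≠ 0 → R.eval w⁻¹ = ∑ j ∈ Finset.Icc 1 n, ∑ i ∈ Finset.range j,
      w ^ i * a j i * (w ^ j)⁻¹ := by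
    intro w hw
    simp only [hR, Polynomial.eval_finsetSum, Polynomial.eval_mul, Polynomial.eval_C,
      Polynomial.eval_pow, Polynomial.eval_X]
    refine Finset.sum_congr rfl fun j _ => Finset.sum_congr rfl fun i hi => ?_
    have : w ^ j = w ^ (j - i) * w ^ i := by
      rw [← pow_add, Nat.sub_add_cancel (Finset.mem_range.1 hi).le]
    rw [this, inv_pow]
    field_simp
  have h₀ : R.coeff 0 = 0 := by
    rw [hR, Polynomial.finsetSum_coeff]
    refine Finset.sum_eq_zero fun j _ => ?_
    rw [Polynomial.finsetSum_coeff]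
    refine Finset.sum_eq_zero fun i hi => ?_
    rw [Polynomial.coeff_C_mul, Polynomial.coeff_X_pow, if_neg, mul_zero]
    have := Finset.mem_range.1 hi
    omega
  have hzero : R = 0 := by
    refine eq_zero_of_eval_inv (z₀ := 1) (g := fun z => G z - ∑ j ∈ Finset.Icc 1 n, r j z) h₀
      ((hG.fun_sub (Finset.analyticAt_fun_sum _ fun j _ => hr j)).continuousAt) ?_
    filter_upwards [hGe, self_mem_nhdsWithin] with z hz hne
    have hw : z - 1 ≠ 0 := sub_ne_zero.2 hne
    rw [hRe _ hw, ← hz, ← Finset.sum_sub_distrib]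
    refine Finset.sum_congr rfl fun j _ => ?_
    rw [hre j z, mul_add, inv_mul_cancel_left₀ (pow_ne_zero j hw), add_sub_cancel_right,
      Finset.mul_sum]
    refine Finset.sum_congr rfl fun i _ => ?_
    rw [ha]
    simp only [tStarMode, Matrix.of_apply, Nat.add_sub_cancel]
    ring
  rw [← hRe w hw, hzero, Polynomial.eval_zero]

end

/-! ### The power series of `b*` in `ζ² - 1` -/

section

variable {n : ℕ}

theorem hasSum_tStar_fCoeff {η : ℂ} (hq : Complex.exp η ^ 4 ≠ 1) (α : ℂ) {s : ℤ}
    {X : Op n} (hX : HasSpin s X) {u : ℂ} (h₀ : Complex.exp (2 * u) ≠ 1)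
    (h₁ : ‖Complex.exp (2 * u) - 1‖ < 1)
    (h₂ : ‖Complex.exp (2 * u) - 1‖ < ‖Complex.exp (2 * η) - 1‖)
    (h₃ : ‖Complex.exp (2 * u) - 1‖ < ‖Complex.exp (-2 * η) - 1‖) (x y : Conf n) :
    HasSum (fun p => ∑ j ∈ Finset.range (n + 1), (Complex.exp (2 * u) - 1) ^ p *
        tStarMode η α (p + 1 + j) (fCoeff η α s j X) x y)
      (∑ j ∈ Finset.range (n + 1), ((Complex.exp (2 * u) - 1) ^ j)⁻¹ *
        tStar η α u (fCoeff η α s j X) x y) := by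
  set w := Complex.exp (2 * u) - 1 with hw
  have hw0 : w ≠ 0 := sub_ne_zero.2 h₀
  set a : ℕ → ℕ → ℂ := fun j i => tStarMode η α (i + 1) (fCoeff η α s j X) x y with ha
  have hj : ∀ j, HasSum (fun p => w ^ p * a j (p + j))
      ((w ^ j)⁻¹ * tStar η α u (fCoeff η α s j X) x y -
        ∑ i ∈ Finset.range j, w ^ i * a j i * (w ^ j)⁻¹) := by
    intro j
    have h := ((hasSum_nat_add_iff' j).2 (hasSum_tStar α h₁ h₂ h₃ (fCoeff η α s j X) x y)).mul_left
      (w ^ j)⁻¹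
    rw [mul_sub, Finset.mul_sum] at h
    have e : (fun p => w ^ p * a j (p + j)) = fun p => (w ^ j)⁻¹ *
        (w ^ (p + j) * tStarMode η α (p + j + 1) (fCoeff η α s j X) x y) := by
      funext p
      rw [ha, pow_add]
      field_simp
    rw [e]
    simpa only [mul_comm ((w ^ j)⁻¹) (_ * _)] using h
  have hsum := hasSum_sum fun j (_ : j ∈ Finset.range (n + 1)) => hj j
  rw [Finset.sum_sub_distrib] at hsum
  -- The summand `j = 0` has an empty inner sum, so `f_0` plays no part in the cancellation.
  have hz : ∑ j ∈ Finset.range (n + 1), ∑ i ∈ Finset.range j, w ^ i * a j i * (w ^ j)⁻¹ = 0 := by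
    rw [Finset.range_eq_Ico, Finset.sum_eq_sum_Ico_succ_bot (Nat.succ_pos n), Finset.range_zero,
      Finset.sum_empty, zero_add, ← sum_tStarMode_eq_zero hq α hX x y hw0]
    refine Finset.sum_congr rfl fun j hj => Finset.sum_congr rfl fun i _ => ?_
    have : j ≠ 0 := by have := (Finset.mem_Ico.1 hj).1; omega
    rw [ha]
    simp only [fCoeff, if_neg this]
  rw [hz, sub_zero] at hsum
  simpa only [ha, add_right_comm] using hsum

/-- The binomial series after writing `Z (w + 1) - 1 = (Z - 1) (1 + w Z / (Z - 1))`; it is used with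
`Z = q^{±2}`. -/
theorem hasSum_inv_sub_one_pow {Z w : ℂ} (hZ : Z ≠ 1) (h : ‖w‖ * ‖Z‖ < ‖Z - 1‖) (j : ℕ) :
    HasSum (fun p => w ^ p * (negChoose j p * (Z ^ p / (Z - 1) ^ (p + j))))
      ((Z * (w + 1) - 1) ^ j)⁻¹ := by
  have hZ' : Z - 1 ≠ 0 := sub_ne_zero.2 hZ
  have hx : ‖w * Z / (Z - 1)‖ < 1 := by
    rw [norm_div, norm_mul, div_lt_one (norm_pos_iff.2 hZ')]
    exact h
  have key := (hasSum_negChoose j hx).mul_left ((Z - 1) ^ j)⁻¹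
  have e₁ : ((Z - 1) ^ j)⁻¹ * ((1 + w * Z / (Z - 1)) ^ j)⁻¹ = ((Z * (w + 1) - 1) ^ j)⁻¹ := by
    rw [← mul_inv, ← mul_pow, mul_add, mul_div_cancel₀ _ hZ']
    congr 2
    ring
  have e₂ : (fun p => w ^ p * (negChoose j p * (Z ^ p / (Z - 1) ^ (p + j)))) =
      fun p => ((Z - 1) ^ j)⁻¹ * (negChoose j p * (w * Z / (Z - 1)) ^ p) := by
    funext p
    rw [div_pow, mul_pow, pow_add]
    field_simp
  rw [← e₁, e₂]
  exact key

theorem hasSum_fOp_add {η : ℂ} (hq : Complex.exp (2 * η) ≠ 1) (c u : ℂ)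
    (h₃ : ‖Complex.exp (2 * u) - 1‖ < ‖Complex.exp (-2 * η) - 1‖) (j : ℕ) :
    HasSum (fun p : ℕ => (Complex.exp (2 * u) - 1) ^ p * (negChoose j p *
        (qpow η (c + p - j) / (qpow η 1 - qpow η (-1)) ^ (p + j))))
      (qpow η c * ((Complex.exp (2 * (u + η)) - 1) ^ j)⁻¹) := by
  have h : ‖Complex.exp (2 * u) - 1‖ * ‖Complex.exp (2 * η)‖ < ‖Complex.exp (2 * η) - 1‖ := by
    refine (mul_lt_mul_of_pos_right h₃ (norm_pos_iff.2 (Complex.exp_ne_zero (2 * η)))).trans_eq ?_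
    rw [← norm_mul, sub_mul, ← Complex.exp_add, one_mul, neg_mul, neg_add_cancel, Complex.exp_zero,
      norm_sub_rev]
  have key := (hasSum_inv_sub_one_pow hq h j).mul_left (qpow η c)
  rw [sub_add_cancel, ← Complex.exp_add, add_comm (2 * η), ← mul_add] at key
  convert! key using 2 with p
  have e : Complex.exp (2 * η) - 1 = qpow η 1 * (qpow η 1 - qpow η (-1)) := by
    rw [mul_sub, qpow_one_mul_qpow_neg_one, ← qpow_add, qpow]
    ring_nf
  have e' : qpow η c * Complex.exp (2 * η) ^ p = qpow η 1 ^ (p + j) * qpow η (c + p - j) := by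
    rw [qpow, qpow, qpow, ← Complex.exp_nat_mul, ← Complex.exp_nat_mul, ← Complex.exp_add,
      ← Complex.exp_add]
    congr 1
    push_cast
    ring
  have e₀ : qpow η 1 ^ (p + j) ≠ 0 := pow_ne_zero _ (qpow_ne_zero η 1)
  rw [e, mul_pow, ← mul_assoc (qpow η c), mul_comm (qpow η c), mul_assoc, mul_left_comm (qpow η c),
    ← mul_div_assoc (qpow η c), e', mul_div_mul_left _ _ e₀]

/-- Obtained from `hasSum_fOp_add` by `η ↦ -η`; the sign `(-1)^(p+j)` comes from replacing `q⁻¹ - q`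
by `q - q⁻¹`. -/
theorem hasSum_fOp_sub {η : ℂ} (hq : Complex.exp (2 * η) ≠ 1) (c u : ℂ)
    (h₂ : ‖Complex.exp (2 * u) - 1‖ < ‖Complex.exp (2 * η) - 1‖) (j : ℕ) :
    HasSum (fun p : ℕ => (Complex.exp (2 * u) - 1) ^ p * (negChoose j p *
        (-((-1) ^ (p + 1 + j) * qpow η (j - p - c)) / (qpow η 1 - qpow η (-1)) ^ (p + j))))
      (qpow η (-c) * ((Complex.exp (2 * (u - η)) - 1) ^ j)⁻¹) := by
  have hq' : Complex.exp (2 * -η) ≠ 1 := by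
    rw [mul_neg, Complex.exp_neg]
    exact fun h => hq (inv_eq_one.1 h)
  have key := hasSum_fOp_add hq' c u (by rwa [neg_mul_neg]) j
  have e : ∀ x, qpow (-η) x = qpow η (-x) := fun x => by rw [qpow, qpow, neg_mul_comm]
  simp only [e, neg_neg] at key
  rw [sub_eq_add_neg]
  convert! key using 2 with p
  have e' : (-(c + p - j) : ℂ) = j - p - c := by ring
  rw [e', ← neg_sub (qpow η 1), neg_pow (qpow η 1 - qpow η (-1)), add_right_comm p 1 j,
    pow_succ (-1 : ℂ)]
  have h1 : ((-1 : ℂ) ^ (p + j)) * (-1) ^ (p + j) = 1 := by rw [← mul_pow]; simp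
  have h2 : ((-1 : ℂ) ^ (p + j)) ≠ 0 := pow_ne_zero _ (by simp)
  congr 2
  rw [mul_comm ((-1 : ℂ) ^ (p + j)) ((qpow η 1 - qpow η (-1)) ^ (p + j)), ← div_div, eq_div_iff h2,
    div_mul_eq_mul_div]
  congr 1
  linear_combination qpow η (j - p - c) * h1

theorem hasSum_exp_neg {u : ℂ} (h₁ : ‖Complex.exp (2 * u) - 1‖ < 1) (j : ℕ) :
    HasSum (fun p => (Complex.exp (2 * u) - 1) ^ p * negChoose j p) (Complex.exp (-2 * j * u)) := by
  have key := hasSum_negChoose j h₁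
  rw [add_sub_cancel, ← Complex.exp_nat_mul, ← Complex.exp_neg] at key
  simpa only [mul_comm, mul_left_comm, neg_mul, mul_neg] using key

theorem hasSum_exp_neg_mul_tStar {η : ℂ} (α : ℂ) {u : ℂ} (h₁ : ‖Complex.exp (2 * u) - 1‖ < 1)
    (h₂ : ‖Complex.exp (2 * u) - 1‖ < ‖Complex.exp (2 * η) - 1‖)
    (h₃ : ‖Complex.exp (2 * u) - 1‖ < ‖Complex.exp (-2 * η) - 1‖) (X : Op n) (x y : Conf n)
    (j : ℕ) :
    HasSum (fun p => ∑ k ∈ Finset.range (p + 1), (Complex.exp (2 * u) - 1) ^ p *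
        (negChoose j k * tStarMode η α (p + 1 - k) X x y))
      (Complex.exp (-2 * j * u) * tStar η α u X x y) := by
  have ha := hasSum_exp_neg h₁ j
  have hb := hasSum_tStar α h₁ h₂ h₃ X x y
  have key := hasSum_sum_range_mul_of_summable_norm ha.summable.norm hb.summable.norm
  rw [ha.tsum_eq, hb.tsum_eq] at key
  convert! key using 2 with p
  refine Finset.sum_congr rfl fun k hk => ?_
  have hk' : k ≤ p := Nat.lt_succ_iff.1 (Finset.mem_range.1 hk)
  have e : (Complex.exp (2 * u) - 1) ^ p =
      (Complex.exp (2 * u) - 1) ^ k * (Complex.exp (2 * u) - 1) ^ (p - k) := by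
    rw [← pow_add, Nat.add_sub_cancel' hk']
  rw [e, show p + 1 - k = p - k + 1 by omega]
  ring

theorem hasSum_bStar {η : ℂ} (hq : Complex.exp η ^ 4 ≠ 1) (α : ℂ) {s : ℤ}
    {X : Op n} (hX : HasSpin s X) {u : ℂ} (h₀ : Complex.exp (2 * u) ≠ 1)
    (h₁ : ‖Complex.exp (2 * u) - 1‖ < 1)
    (h₂ : ‖Complex.exp (2 * u) - 1‖ < ‖Complex.exp (2 * η) - 1‖)
    (h₃ : ‖Complex.exp (2 * u) - 1‖ < ‖Complex.exp (-2 * η) - 1‖) (x y : Conf n) :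
    HasSum (fun p : ℕ => Complex.exp ((α + s + 1) * u) * ((Complex.exp (2 * u) - 1) ^ p *
        bStarMode η α s (p + 1) X x y)) (bStar η α s u X x y) := by
  have hq2 : Complex.exp (2 * η) ≠ 1 := fun h => hq (by
    rw [← Complex.exp_nat_mul, show ((4 : ℕ) : ℂ) * η = 2 * η + 2 * η by push_cast; ring,
      Complex.exp_add, h, one_mul])
  have H₁ := hasSum_sum fun j (_ : j ∈ Finset.range (n + 1)) =>
    ((hasSum_fOp_add hq2 (α + s + 1) u h₃ j).add (hasSum_fOp_sub hq2 (α + s + 1) u h₂ j)).mul_right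
      (fCoeff η α s j X x y)
  have H₂ := hasSum_sum fun j (_ : j ∈ Finset.range (s + 1).toNat) =>
    (hasSum_exp_neg h₁ j).mul_right
      ((qpow η (α + s + 1 - 2 * j) + qpow η (2 * j - α - s - 1)) / den η α s j * kappa η α s j X x y)
  have H₃ := hasSum_tStar_fCoeff hq α hX h₀ h₁ h₂ h₃ x y
  have H₄ := hasSum_sum fun j (_ : j ∈ Finset.range (s + 1).toNat) =>
    (hasSum_exp_neg_mul_tStar α h₁ h₂ h₃ (kappa η α s j X) x y j).mul_left (den η α s j)⁻¹
  have key := (((H₁.add H₂).sub H₃).sub H₄).mul_left (Complex.exp ((α + s + 1) * u))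
  have e₁ : Complex.exp ((α + s + 1) * (u + η)) =
      Complex.exp ((α + s + 1) * u) * qpow η (α + s + 1) := by
    rw [qpow, ← Complex.exp_add]; ring_nf
  have e₂ : Complex.exp ((α + s + 1) * (u - η)) =
      Complex.exp ((α + s + 1) * u) * qpow η (-(α + s + 1)) := by
    rw [qpow, ← Complex.exp_add]; ring_nf
  have e₃ : ∀ j : ℕ, qpow η (α + s + 1) * Complex.exp (-2 * j * (u + η)) =
      Complex.exp (-2 * j * u) * qpow η (α + s + 1 - 2 * j) := fun j => by
    rw [qpow, qpow, ← Complex.exp_add, ← Complex.exp_add]; ring_nf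
  have e₄ : ∀ j : ℕ, qpow η (-(α + s + 1)) * Complex.exp (-2 * j * (u - η)) =
      Complex.exp (-2 * j * u) * qpow η (2 * j - α - s - 1) := fun j => by
    rw [qpow, qpow, ← Complex.exp_add, ← Complex.exp_add]; ring_nf
  convert! key using 1
  · funext p
    congr 1
    rw [bStarMode]
    simp only [Matrix.add_apply, Matrix.sub_apply, Matrix.sum_apply, Matrix.smul_apply, smul_eq_mul]
    rw [mul_sub, mul_sub, mul_add]
    refine congrArg₂ _ (congrArg₂ _ (congrArg₂ _ ?_ ?_) ?_) ?_
    · rw [Finset.mul_sum]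
      refine Finset.sum_congr rfl fun j _ => ?_
      have e₆ : qpow η (α + s + ((p + 1 : ℕ) : ℂ) - j) = qpow η (α + s + 1 + p - j) := by
        congr 1
        push_cast
        ring
      have e₇ : qpow η (j - ((p + 1 : ℕ) : ℂ) - α - s) = qpow η (j - p - (α + s + 1)) := by
        congr 1
        push_cast
        ring
      rw [e₆, e₇, show p + 1 + j - 1 = p + j by omega, Nat.add_sub_cancel]
      ring
    · rw [Finset.mul_sum]
      refine Finset.sum_congr rfl fun j _ => ?_
      rw [Nat.add_sub_cancel]
      ring
    · rw [Finset.mul_sum]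
    · simp only [Finset.mul_sum]
      refine Finset.sum_congr rfl fun j _ => Finset.sum_congr rfl fun k _ => ?_
      ring
  · rw [bStar, Matrix.sub_apply, Matrix.add_apply, fOp, fOp, fOp, tStar_smul, tStar_add, tStar_sum,
      tStar_sum]
    simp only [tStar_smul, Matrix.smul_apply, Matrix.add_apply, Matrix.sum_apply, smul_eq_mul]
    rw [e₁, e₂, mul_assoc, mul_assoc, ← mul_add, ← mul_sub]
    congr 1
    rw [mul_add, mul_add, mul_add]
    simp only [Finset.mul_sum]
    have e₅ : ∀ a b c d e f : ℂ, a + b + (c + d) - (e + f) = a + c + (b + d) - e - f := by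
      intros; ring
    rw [e₅, ← Finset.sum_add_distrib, ← Finset.sum_add_distrib]
    congr 1
    · congr 1
      congr 1
      · refine Finset.sum_congr rfl fun j _ => ?_
        ring
      · refine Finset.sum_congr rfl fun j _ => ?_
        rw [← mul_assoc, ← mul_assoc, ← mul_div_assoc, ← mul_div_assoc, e₃, e₄]
        ring
    · refine Finset.sum_congr rfl fun j _ => ?_
      ring

end

end

end XXZ

/-! ### The expansion and the limit at `ζ² = 1` -/

theorem mainTheorem5 (n : ℕ) (η α : ℂ)
    (hq : Complex.exp (4 * η) ≠ 1)
    (hα : ∀ m : ℤ, Complex.exp (2 * η * (α + m)) ≠ 1)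
    (s : ℤ) (X : XXZ.Op n) (hX : XXZ.HasSpin s X) :
    (∀ u : ℂ, Complex.exp (2 * u) ≠ 1 →
      ‖Complex.exp (2 * u) - 1‖ < 1 →
      ‖Complex.exp (2 * u) - 1‖ < ‖Complex.exp (2 * η) - 1‖ →
      ‖Complex.exp (2 * u) - 1‖ < ‖Complex.exp (-2 * η) - 1‖ →
      HasSum
        (fun p : ℕ => (Complex.exp ((α + s + 1) * u) * (Complex.exp (2 * u) - 1) ^ p) •
          XXZ.bStarMode η α s (p + 1) X)
        (XXZ.bStar η α s u X)) ∧
    (∀ u₀ : ℂ, Complex.exp (2 * u₀) = 1 →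
      Tendsto (fun u => XXZ.bStar η α s u X) (𝓝[≠] u₀)
        (𝓝 (Complex.exp ((α + s + 1) * u₀) • XXZ.bStarMode η α s 1 X))) := by
  have hq' : Complex.exp η ^ 4 ≠ 1 := by rwa [← Complex.exp_nat_mul, Nat.cast_ofNat]
  have hq2 : Complex.exp (2 * η) ≠ 1 := fun h => hq (by
    rw [show 4 * η = 2 * η + 2 * η by ring, Complex.exp_add, h, one_mul])
  have hq2' : Complex.exp (-2 * η) ≠ 1 := by
    rw [neg_mul, Complex.exp_neg]
    exact fun h => hq2 (inv_eq_one.1 h)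
  refine ⟨fun u h₀ h₁ h₂ h₃ => Pi.hasSum.2 fun x => Pi.hasSum.2 fun y => ?_, fun u₀ hu₀ =>
    tendsto_pi_nhds.2 fun x => tendsto_pi_nhds.2 fun y => ?_⟩
  · simpa only [Matrix.smul_apply, smul_eq_mul, mul_assoc] using
      XXZ.hasSum_bStar hq' α hX h₀ h₁ h₂ h₃ x y
  · obtain ⟨ρ, hρ₀, hρ⟩ := exists_between (lt_min one_pos (lt_min
      (norm_pos_iff.2 (sub_ne_zero.2 hq2)) (norm_pos_iff.2 (sub_ne_zero.2 hq2'))))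
    rw [lt_min_iff, lt_min_iff] at hρ
    set b : ℕ → ℂ := fun p => XXZ.bStarMode η α s (p + 1) X x y with hb
    set w : ℂ → ℂ := fun u => Complex.exp (2 * u) - 1 with hw
    have hs : ∀ u, w u ≠ 0 → ‖w u‖ ≤ ρ → HasSum (fun p => w u ^ p * b p)
        (Complex.exp (-((α + s + 1) * u)) * XXZ.bStar η α s u X x y) := by
      intro u h₀ h
      have := (XXZ.hasSum_bStar hq' α hX (sub_ne_zero.1 h₀) (h.trans_lt hρ.1) (h.trans_lt hρ.2.1)
        (h.trans_lt hρ.2.2) x y).mul_left (Complex.exp (-((α + s + 1) * u)))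
      simpa only [← mul_assoc, ← Complex.exp_add, neg_add_cancel, Complex.exp_zero, one_mul] using this
    have hw₀ : w u₀ = 0 := by rw [hw]; simp only [hu₀, sub_self]
    have hwt : Tendsto w (𝓝[≠] u₀) (𝓝 0) := by
      have : ContinuousAt w u₀ := by rw [hw]; fun_prop
      rw [← hw₀]
      exact this.tendsto.mono_left nhdsWithin_le_nhds
    have hne : ∀ᶠ u in 𝓝[≠] u₀, w u ≠ 0 := by
      have : HasDerivAt w (Complex.exp (2 * u₀) * (2 * 1)) u₀ :=
        (((hasDerivAt_id' u₀).const_mul 2).cexp).sub_const 1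
      exact this.eventually_ne (by simp)
    have hle : ∀ᶠ u in 𝓝[≠] u₀, ‖w u‖ ≤ ρ := by
      have := hwt.norm
      rw [norm_zero] at this
      exact this.eventually_le_const hρ₀
    -- The expansion at the single point `ζ² = 1 + ρ` converges absolutely and dominates the series
    -- for all `u` with `‖ζ² - 1‖ ≤ ρ`.
    have hsm : Summable fun p => ‖((ρ : ℂ)) ^ p * b p‖ := by
      have hρ' : (1 + ρ : ℂ) ≠ 0 := by
        intro h
        have := congrArg Complex.re h
        simp at this
        linarith
      have e : w (Complex.log (1 + ρ) / 2) = ρ := by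
        rw [hw]
        simp only
        rw [XXZ.exp_two_mul_log_div_two hρ', add_sub_cancel_left]
      have := hs (Complex.log (1 + ρ) / 2) (by rw [e]; exact_mod_cast hρ₀.ne')
        (by rw [e, Complex.norm_real, Real.norm_of_nonneg hρ₀.le])
      rw [e] at this
      exact this.summable.norm
    have hlim : Tendsto (fun u => ∑' p, w u ^ p * b p) (𝓝[≠] u₀) (𝓝 (∑' p, (0 : ℂ) ^ p * b p)) := by
      refine tendsto_tsum_of_dominated_convergence hsm (fun p => (hwt.pow p).mul_const _) ?_
      filter_upwards [hle] with u hu p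
      rw [norm_mul, norm_mul, norm_pow, norm_pow, Complex.norm_real, Real.norm_of_nonneg hρ₀.le]
      gcongr
    have h0 : ∑' p, (0 : ℂ) ^ p * b p = b 0 := by
      rw [tsum_eq_single 0 fun p hp => by rw [zero_pow hp, zero_mul], pow_zero, one_mul]
    rw [h0] at hlim
    have hexp : Tendsto (fun u => Complex.exp ((α + s + 1) * u)) (𝓝[≠] u₀)
        (𝓝 (Complex.exp ((α + s + 1) * u₀))) := by
      have : ContinuousAt (fun u => Complex.exp ((α + s + 1) * u)) u₀ := by fun_prop
      exact this.tendsto.mono_left nhdsWithin_le_nhds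
    refine (hexp.mul hlim).congr' ?_
    filter_upwards [hne, hle] with u h₀ h
    rw [(hs u h₀ h).tsum_eq, ← mul_assoc, ← Complex.exp_add, add_neg_cancel, Complex.exp_zero, one_mul]
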